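/- All manifolds are smooth, Hausdorff, second countable and without boundary. **Setting.** Let $M$ be a $d$-dimensional manifold with a Weyl class $[g,a]$, i.e. a class of pairs of a smooth metric of signature $(p,q)$ and a smooth $1$-form under $(g,a)\sim(\mathcal B^{-2}g,\ a-\mathrm d\log\mathcal B)$, $\mathcal B$ a smooth positive function. Let $\pi:\mathcal P_W\to M$ be a Weyl structure, i.e. a smooth principal $\mathbb R_+$-bundle with dilatations $\delta_s$ and fundamental vector field $T$, together with an $\mathbb R_+$-equivariant smooth isomorphism over $M$ with the metric bundle $\{(x,s^2g_x): s>0\}$, on which $\delta_s$ acts by $(x,h)\mapsto(x,s^2h)$. The tautological tensor on $\mathcal P_W$ is $\mathbf g_0(w_1,w_2)=h(\pi_*w_1,\pi_*w_2)$ at the point corresponding to $(x,h)$. Extend $\delta_s$ to $\mathcal P_W\times\mathbb R$ by acting on the first factor, and let $\mathcal T=(T,0)$. A *Weyl pre-ambient space* for $(M,[g,a])$ is a pair $(\tilde M,\tilde g)$, where $\tilde M$ is a dilatation-invariant open neighbourhood of $\mathcal P_W\times\{0\}$ in $\mathcal P_W\times\mathbb R$ and $\tilde g$ is a smooth metric on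 $\tilde M$ of signature $(p+1,q+1)$ with $\delta_s^*\tilde g=s^2\tilde g$ for all $s>0$ and $\iota^*\tilde g=\mathbf g_0$ for $\iota(p)=(p,0)$. Fix a representative $(g,a)$ of the class. Let $t:\mathcal P_W\to\mathbb R_+$ be the fibre coordinate it determines (the point with coordinates $(x,t)$ corresponds to $(x,t^2g_x)$), put $n=t^{-1}\mathrm dt+\pi^*a$, and let $H_p=\ker n_p\subset T_p\mathcal P_W$ be the horizontal space. A Weyl pre-ambient space $(\tilde M,\tilde g)$ is in *Weyl-normal form with acceleration* $\mathcal A$ (a vector field on $\tilde M$) if (i) for each $p\in\mathcal P_W$ the set $I_p=\{\rho:(p,\rho)\in\tilde M\}$ is an open interval containing $0$; (ii) each curve $I_p\ni\rho\mapsto(p,\rho)$, with velocity $\mathcal U=\partial_\rho$, has acceleration $\tilde\nabla_{\mathcal U}\,\mathcal U=\mathcal A$ for the Levi-Civita connection of $\tilde g$, and $\tilde g(\mathcal T,\mathcal A)=0$; (iii) $\tilde g|_{\rho=0}=\mathbf g_0+2t^2\,n\,\mathrm d\rho$ (symmetric product). A vector $V\in T_{(p,0)}(\mathcal P_W\times\mathbb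 R)$ is *$(g,a)$-transversal* for $\tilde g$ if $\tilde g(V,\mathcal T)=t(p)^2$, $\tilde g(V,w)=0$ for all $w\in H_p$, and $\tilde g(V,V)=0$. An *acceleration law* on $(\tilde M,\tilde g)$ is a smooth assignment $(z,u)\mapsto\mathcal A(z,u)\in T_z\tilde M$, for $z\in\tilde M$ and $u\in T_z\tilde M$, that is dilatation-equivariant, $\mathcal A(\delta_sz,\delta_{s*}u)=\delta_{s*}\mathcal A(z,u)$, and satisfies $\tilde g(\mathcal T,\mathcal A(z,u))=0$; for instance, a smooth dilatation-invariant vector field on $\tilde M$ that is orthogonal to $\mathcal T$. **Theorem.** Let $(\tilde M,\tilde g)$ be a Weyl pre-ambient space for $(M,[g,a])$, let $(g,a)$ be a representative, and let $\mathcal A$ be an acceleration law on $(\tilde M,\tilde g)$. Then there is a dilatation-invariant open set $\tilde M'\subset\mathcal P_W\times\mathbb R$ containing $\mathcal P_W\times\{0\}$ on which there is a unique diffeomorphism $\phi$ onto an open subset of $\tilde M$ that commutes with dilatations, is the identity on $\mathcal P_W\times\{0\}$, and is such that $(\tilde M',\phi^*\tilde g)$ is a Weyl pre-ambient space in Weyl-normal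 form with the acceleration $\mathcal A'$ determined by $\phi_*\mathcal A'_{z}=\mathcal A(\phi(z),\phi_*\partial_\rho|_{z})$, $z\in\tilde M'$. Moreover, at each $(p,0)$ there is exactly one $(g,a)$-transversal vector for $\tilde g$, and it is the initial velocity of the curve $\lambda\mapsto\phi(p,\lambda)$; on the interval $\{\lambda:(p,\lambda)\in\tilde M'\}$ this curve has velocity $\mathcal U$ and acceleration $\tilde\nabla_{\mathcal U}\,\mathcal U=\mathcal A(\phi(p,\lambda),\mathcal U)$. If in addition $\tilde g(u,\mathcal A(z,u))=0$ for all $z$ and $u$, then also $\phi^*\tilde g(\partial_\rho,\mathcal A')=0$ on $\tilde M'$. -/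

import Mathlib

open Set Bundle
open scoped Manifold ContDiff Topology

noncomputable section

/-- A field of bilinear forms on the tangent spaces of the manifold `X` (a covariant 2-tensor). -/
abbrev BilinField {V H : Type*} [NormedAddCommGroup V] [NormedSpace ℝ V] [TopologicalSpace H]
    (I : ModelWithCorners ℝ V H) (X : Type*) [TopologicalSpace X] [ChartedSpace H X] :=
  ∀ x : X, TangentSpace I x →L[ℝ] TangentSpace I x →L[ℝ] ℝ

/-- `B` has signature `(p, q)`: there is a basis, orthonormal for `B`, with `p` vectors of square
`1` and `q` vectors of square `-1`. In particular `B` is symmetric and nondegenerate. -/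
def HasSignature {V : Type*} [AddCommGroup V] [Module ℝ V] [TopologicalSpace V]
    (B : V →L[ℝ] V →L[ℝ] ℝ) (p q : ℕ) : Prop :=
  ∃ b : Module.Basis (Fin p ⊕ Fin q) ℝ V,
    (∀ i j, i ≠ j → B (b i) (b j) = 0) ∧
    (∀ i, B (b (Sum.inl i)) (b (Sum.inl i)) = 1) ∧
    (∀ j, B (b (Sum.inr j)) (b (Sum.inr j)) = -1)

/-- A field of bilinear forms is smooth on the set `s`. -/
def SmoothBilinOn {V H : Type*} [NormedAddCommGroup V] [NormedSpace ℝ V] [TopologicalSpace H]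
    {I : ModelWithCorners ℝ V H} {X : Type*} [TopologicalSpace X] [ChartedSpace H X]
    [IsManifold I ∞ X] (g : BilinField I X) (s : Set X) : Prop :=
  ContMDiffOn I (I.prod 𝓘(ℝ, V →L[ℝ] V →L[ℝ] ℝ)) ∞
    (fun x ↦ TotalSpace.mk' (V →L[ℝ] V →L[ℝ] ℝ)
      (E := fun x : X ↦ TangentSpace I x →L[ℝ] TangentSpace I x →L[ℝ] ℝ) x (g x)) s

/-- The pullback of a field of bilinear forms by a map. -/
def pullbackBilin {V H : Type*} [NormedAddCommGroup V] [NormedSpace ℝ V] [TopologicalSpace H]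
    {I : ModelWithCorners ℝ V H} {X : Type*} [TopologicalSpace X] [ChartedSpace H X]
    {V' H' : Type*} [NormedAddCommGroup V'] [NormedSpace ℝ V'] [TopologicalSpace H']
    {I' : ModelWithCorners ℝ V' H'} {X' : Type*} [TopologicalSpace X'] [ChartedSpace H' X']
    (f : X → X') (g : BilinField I' X') : BilinField I X :=
  fun x ↦ (ContinuousLinearMap.precomp ℝ (mfderiv I I' f x)).comp ((g (f x)).comp (mfderiv I I' f x))

section Acceleration

variable {V H : Type*} [NormedAddCommGroup V] [NormedSpace ℝ V] [TopologicalSpace H]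
  {I : ModelWithCorners ℝ V H} {X : Type*} [TopologicalSpace X] [ChartedSpace H X]

/-- The components of `g` in the preferred chart around `x₀`, as a function on the model space. -/
def chartMetric (g : BilinField I X) (x₀ : X) : V → V →L[ℝ] V →L[ℝ] ℝ :=
  pullbackBilin (I := 𝓘(ℝ, V)) (I' := I) (extChartAt I x₀).symm g

set_option synthInstance.maxHeartbeats 200000 in
/-- Christoffel symbols of the first kind of `g` at `x₀`, in the preferred chart around `x₀`:
`Γ(u, v, w) = (∂_u g(v, w) + ∂_v g(u, w) - ∂_w g(u, v)) / 2`, as a linear form in `w`. -/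
def christoffelFirst (g : BilinField I X) (x₀ : X) (u v : V) : V →L[ℝ] ℝ :=
  let D : V →L[ℝ] V →L[ℝ] V →L[ℝ] ℝ := fderiv ℝ (chartMetric g x₀) (extChartAt I x₀ x₀)
  (1 / 2 : ℝ) • (D u v + D v u - (D.flip u).flip v)

/-- Christoffel symbols (of the second kind) of `g` at `x₀`, in the preferred chart around `x₀`:
for nondegenerate `g` the vector `Γ` with `g(Γ(u, v), w) = Γ(u, v, w)` for all `w`. -/
def christoffel (g : BilinField I X) (x₀ : X) (u v : V) : V :=
  (chartMetric g x₀ (extChartAt I x₀ x₀)).inverse (christoffelFirst g x₀ u v)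

/-- The acceleration `∇_{c'} c'` at parameter `τ` of the curve `c`, for the Levi-Civita connection
of the pseudo-Riemannian metric `g`: in the preferred chart around `c τ` (through which the tangent
space at `c τ` is the model space) it is `c'' + Γ(c', c')`. -/
def acceleration (g : BilinField I X) (c : ℝ → X) (τ : ℝ) : TangentSpace I (c τ) :=
  let y : ℝ → V := fun σ ↦ extChartAt I (c τ) (c σ)
  (deriv (deriv y) τ + christoffel g (c τ) (deriv y τ) (deriv y τ) : V)

end Acceleration

section Weyl

variable (E F M P : Type*)
  [NormedAddCommGroup E] [NormedSpace ℝ E]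
  [NormedAddCommGroup F] [NormedSpace ℝ F]
  [TopologicalSpace M] [ChartedSpace E M] [IsManifold 𝓘(ℝ, E) ∞ M]
  [TopologicalSpace P] [ChartedSpace F P] [IsManifold 𝓘(ℝ, F) ∞ P]

/-- A Weyl structure over `M`: a smooth principal bundle `P → M` with group the positive reals.
The dilatation `dil s` is meaningful for `s > 0` only. -/
structure WeylStructure where
  proj : P → M
  smooth_proj : ContMDiff 𝓘(ℝ, F) 𝓘(ℝ, E) ∞ proj
  dil : ℝ → P → P
  smooth_dil : ContMDiffOn (𝓘(ℝ, ℝ).prod 𝓘(ℝ, F)) 𝓘(ℝ, F) ∞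
    (fun z : ℝ × P ↦ dil z.1 z.2) (Ioi 0 ×ˢ univ)
  dil_one : ∀ x, dil 1 x = x
  dil_mul : ∀ s s' x, 0 < s → 0 < s' → dil (s * s') x = dil s (dil s' x)
  dil_free : ∀ s x, 0 < s → dil s x = x → s = 1
  proj_dil : ∀ s x, 0 < s → proj (dil s x) = proj x
  locallyTrivial : ∀ x₀ : M, ∃ U : Set M, IsOpen U ∧ x₀ ∈ U ∧
    ∃ T : PartialDiffeomorph 𝓘(ℝ, F) (𝓘(ℝ, E).prod 𝓘(ℝ, ℝ)) P (M × ℝ) ∞,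
      T.source = proj ⁻¹' U ∧ T.target = U ×ˢ Ioi 0 ∧
      (∀ x ∈ T.source, (T x).1 = proj x) ∧
      (∀ s x, 0 < s → x ∈ T.source → (T (dil s x)).2 = (T x).2 * s)

/-- A pair `(g, a)` of a smooth pseudo-Riemannian metric of signature `(p, q)` and a smooth 1-form
on `M`. -/
structure WeylPair (p q : ℕ) where
  g : BilinField 𝓘(ℝ, E) M
  smooth_g : SmoothBilinOn g univ
  signature_g : ∀ x, HasSignature (g x) p q
  a : ∀ x : M, TangentSpace 𝓘(ℝ, E) x →L[ℝ] ℝ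
  smooth_a : ContMDiff 𝓘(ℝ, E) (𝓘(ℝ, E).prod 𝓘(ℝ, E →L[ℝ] ℝ)) ∞
    (fun x ↦ TotalSpace.mk' (E →L[ℝ] ℝ)
      (E := fun x : M ↦ TangentSpace 𝓘(ℝ, E) x →L[ℝ] ℝ) x (a x))

variable {E F M P} {p q : ℕ}

/-- `(g', a') = (B⁻² g, a - d log B)` for some smooth positive function `B` on `M`. -/
def WeylRel (r r' : WeylPair E M p q) : Prop :=
  ∃ B : M → ℝ, ContMDiff 𝓘(ℝ, E) 𝓘(ℝ, ℝ) ∞ B ∧ (∀ x, 0 < B x) ∧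
    (∀ x, r'.g x = ((B x) ^ 2)⁻¹ • r.g x) ∧
    (∀ x, r'.a x = r.a x - mvfderiv 𝓘(ℝ, E) (fun y ↦ Real.log (B y)) x)


theorem WeylRel.refl (r : WeylPair E M p q) : WeylRel r r := by
  refine ⟨fun _ ↦ 1, contMDiff_const, fun _ ↦ one_pos, fun x ↦ by simp, fun x ↦ ?_⟩
  have h : HasMFDerivAt 𝓘(ℝ, E) 𝓘(ℝ, ℝ) (fun _ : M ↦ Real.log 1) x 0 := hasMFDerivAt_const ..
  simp [mvfderiv, h.mfderiv]

theorem WeylRel.mdifferentiableAt_log {B : M → ℝ} (hB : ContMDiff 𝓘(ℝ, E) 𝓘(ℝ, ℝ) ∞ B)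
    (hpos : ∀ x, 0 < B x) (x : M) :
    MDifferentiableAt 𝓘(ℝ, E) 𝓘(ℝ, ℝ) (fun y ↦ Real.log (B y)) x :=
  ((Real.differentiableAt_log (hpos x).ne').mdifferentiableAt).comp x
    ((hB x).mdifferentiableAt (by simp))

theorem WeylRel.symm {r r' : WeylPair E M p q} (h : WeylRel r r') : WeylRel r' r := by
  obtain ⟨B, hB, hpos, hg, ha⟩ := h
  refine ⟨fun x ↦ (B x)⁻¹, ?_, fun x ↦ inv_pos.2 (hpos x), fun x ↦ ?_, fun x ↦ ?_⟩
  · exact hB.inv₀ fun x ↦ (hpos x).ne'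
  · rw [hg x, smul_smul]
    have := (hpos x).ne'
    rw [show (((B x)⁻¹ ^ 2)⁻¹ * (B x ^ 2)⁻¹) = 1 by field_simp, one_smul]
  · have h1 : (fun y ↦ Real.log (B y)⁻¹) = -fun y ↦ Real.log (B y) := by
      funext y; simp [Real.log_inv]
    rw [h1, ha x, mvfderiv_neg]
    abel

theorem WeylRel.trans {r r' r'' : WeylPair E M p q} (h : WeylRel r r') (h' : WeylRel r' r'') :
    WeylRel r r'' := by
  obtain ⟨B, hB, hpos, hg, ha⟩ := h
  obtain ⟨B', hB', hpos', hg', ha'⟩ := h'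
  refine ⟨fun x ↦ B x * B' x, hB.mul hB', fun x ↦ mul_pos (hpos x) (hpos' x), fun x ↦ ?_,
    fun x ↦ ?_⟩
  · rw [hg' x, hg x, smul_smul, mul_pow, mul_inv, mul_comm]
  · have h1 : (fun y ↦ Real.log (B y * B' y)) =
        (fun y ↦ Real.log (B y)) + fun y ↦ Real.log (B' y) := by
      funext y
      exact Real.log_mul (hpos y).ne' (hpos' y).ne'
    rw [h1, ha' x, ha x, mvfderiv_add (WeylRel.mdifferentiableAt_log hB hpos x)
      (WeylRel.mdifferentiableAt_log hB' hpos' x)]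
    abel

variable (E M p q) in
/-- The equivalence relation whose classes are the Weyl classes. -/
def weylSetoid : Setoid (WeylPair E M p q) where
  r := WeylRel
  iseqv := ⟨WeylRel.refl, WeylRel.symm, WeylRel.trans⟩

variable (E M p q) in
/-- Weyl classes `[g, a]` on `M`, with metrics of signature `(p, q)`. -/
abbrev WeylClass := Quotient (weylSetoid E M p q)

/-- The Weyl class represented by a pair `(g, a)`. -/
def WeylPair.weylClass (r : WeylPair E M p q) : WeylClass E M p q :=
  Quotient.mk (weylSetoid E M p q) r

variable (E M) in
/-- The total space of the bundle of bilinear forms on the tangent spaces of `M`. -/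
abbrev FormBundle :=
  TotalSpace (E →L[ℝ] E →L[ℝ] ℝ)
    (fun x : M ↦ TangentSpace 𝓘(ℝ, E) x →L[ℝ] TangentSpace 𝓘(ℝ, E) x →L[ℝ] ℝ)

/-- The metric bundle: all pairs `(x, s² g_x)` with `s > 0` and `g` a metric of the class. -/
def metricBundle (C : WeylClass E M p q) : Set (FormBundle E M) :=
  {z | ∃ r : WeylPair E M p q, r.weylClass = C ∧ ∃ s : ℝ, 0 < s ∧ z.2 = s ^ 2 • r.g z.1}

/-- An isomorphism of the Weyl structure with the metric bundle, `x ↦ (π x, form x)`: smooth,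
fibre-preserving, bijective, and intertwining `δ_s` with `(x, h) ↦ (x, s² h)`. -/
structure MetricBundleIso (W : WeylStructure E F M P) (C : WeylClass E M p q) where
  form : ∀ x : P, TangentSpace 𝓘(ℝ, E) (W.proj x) →L[ℝ] TangentSpace 𝓘(ℝ, E) (W.proj x) →L[ℝ] ℝ
  smooth_form : ContMDiff 𝓘(ℝ, F) (𝓘(ℝ, E).prod 𝓘(ℝ, E →L[ℝ] E →L[ℝ] ℝ)) ∞
    (fun x ↦ (⟨W.proj x, form x⟩ : FormBundle E M))
  bijOn : BijOn (fun x ↦ (⟨W.proj x, form x⟩ : FormBundle E M)) univ (metricBundle C)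
  form_dil : ∀ s x, 0 < s →
    (⟨W.proj (W.dil s x), form (W.dil s x)⟩ : FormBundle E M) = ⟨W.proj x, s ^ 2 • form x⟩

/-- `t` is the fibre coordinate on `P` determined by the representative `r = (g, a)`: it is the
second component of an equivariant global trivialization of `P`, and the point with coordinates
`(x, t)` corresponds to the point `(x, t² g_x)` of the metric bundle. -/
structure IsFibreCoordinate {W : WeylStructure E F M P} {C : WeylClass E M p q}
    (h : MetricBundleIso W C) (r : WeylPair E M p q) (t : P → ℝ) : Prop where
  smooth : ContMDiff 𝓘(ℝ, F) 𝓘(ℝ, ℝ) ∞ t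
  pos : ∀ x, 0 < t x
  dil : ∀ s x, 0 < s → t (W.dil s x) = t x * s
  form_eq : ∀ x, h.form x = (t x) ^ 2 • r.g (W.proj x)

/-- The tautological tensor on `P`: `g₀(w₁, w₂) = h(π_* w₁, π_* w₂)`. -/
def tautological {W : WeylStructure E F M P} {C : WeylClass E M p q}
    (h : MetricBundleIso W C) (x : P) (w₁ w₂ : TangentSpace 𝓘(ℝ, F) x) : ℝ :=
  h.form x (mfderiv 𝓘(ℝ, F) 𝓘(ℝ, E) W.proj x w₁) (mfderiv 𝓘(ℝ, F) 𝓘(ℝ, E) W.proj x w₂)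

/-- The connection form `n = t⁻¹ dt + π^* a` on `P`. -/
def connectionForm (W : WeylStructure E F M P) (r : WeylPair E M p q) (t : P → ℝ) (x : P)
    (w : TangentSpace 𝓘(ℝ, F) x) : ℝ :=
  (t x)⁻¹ * mvfderiv 𝓘(ℝ, F) t x w + r.a (W.proj x) (mfderiv 𝓘(ℝ, F) 𝓘(ℝ, E) W.proj x w)

/-- The fundamental vector field `T` of the dilatations: the velocity of `s ↦ δ_s x` at `s = 1`. -/
def fundamentalField (W : WeylStructure E F M P) (x : P) : TangentSpace 𝓘(ℝ, F) x :=
  (mfderiv 𝓘(ℝ, ℝ) 𝓘(ℝ, F) (fun s ↦ W.dil s x) 1 : ℝ →L[ℝ] F) (1 : ℝ)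

variable (F) in
/-- The model of `P × ℝ`. -/
abbrev ambientModel : ModelWithCorners ℝ (F × ℝ) (ModelProd F ℝ) := 𝓘(ℝ, F).prod 𝓘(ℝ, ℝ)

/-- The tangent vector `(w, c) = w + c ∂_ρ` of `P × ℝ` at `z`, with `w` tangent to `P`. -/
def ambientVec (z : P × ℝ) (w : TangentSpace 𝓘(ℝ, F) z.1) (c : ℝ) :
    TangentSpace (ambientModel F) z :=
  ((w, c) : F × ℝ)

/-- The coordinate vector `∂_ρ` of `P × ℝ` at `z`. -/
def rhoVec (z : P × ℝ) : TangentSpace (ambientModel F) z := ambientVec z 0 1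

/-- The dilatation of `P × ℝ`, acting on the first factor. -/
def WeylStructure.ambientDil (W : WeylStructure E F M P) (s : ℝ) (z : P × ℝ) : P × ℝ :=
  (W.dil s z.1, z.2)

/-- The extension of the fundamental vector field to `P × ℝ`. -/
def ambientField (W : WeylStructure E F M P) (z : P × ℝ) : TangentSpace (ambientModel F) z :=
  ambientVec z (fundamentalField W z.1) 0

/-- `Ω` is a dilatation-invariant open neighbourhood of `P × {0}` in `P × ℝ`. -/
structure IsAmbientDomain (W : WeylStructure E F M P) (Ω : Set (P × ℝ)) : Prop where
  isOpen : IsOpen Ω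
  dil_mem : ∀ s z, 0 < s → z ∈ Ω → W.ambientDil s z ∈ Ω
  zero_mem : ∀ x : P, (x, (0 : ℝ)) ∈ Ω

/-- `(Ω, g)` is a Weyl pre-ambient space for `(M, C)`. -/
structure IsWeylPreAmbient {W : WeylStructure E F M P} {C : WeylClass E M p q}
    (h : MetricBundleIso W C) (Ω : Set (P × ℝ)) (g : BilinField (ambientModel F) (P × ℝ)) :
    Prop where
  domain : IsAmbientDomain W Ω
  initial : ∀ (x : P) (w₁ w₂ : TangentSpace 𝓘(ℝ, F) x),
    g (x, 0) (ambientVec (x, 0) w₁ 0) (ambientVec (x, 0) w₂ 0) = tautological h x w₁ w₂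
  smooth : SmoothBilinOn g Ω
  signature : ∀ z ∈ Ω, HasSignature (g z) (p + 1) (q + 1)
  homogeneous : ∀ s z, 0 < s → z ∈ Ω →
    pullbackBilin (I := ambientModel F) (I' := ambientModel F) (W.ambientDil s) g z = s ^ 2 • g z

/-- `(Ω, g)` is a Weyl pre-ambient space in Weyl-normal form, relative to the representative
`r = (g, a)` with fibre coordinate `t`, with acceleration `A` (a vector field on `Ω`). -/
structure IsWeylNormalForm {W : WeylStructure E F M P} {C : WeylClass E M p q}
    (h : MetricBundleIso W C) (r : WeylPair E M p q) (t : P → ℝ)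
    (Ω : Set (P × ℝ)) (g : BilinField (ambientModel F) (P × ℝ))
    (A : ∀ z : P × ℝ, TangentSpace (ambientModel F) z) : Prop where
  preAmbient : IsWeylPreAmbient h Ω g
  interval : ∀ x : P, OrdConnected {ρ : ℝ | (x, ρ) ∈ Ω}
  acceleration_eq : ∀ x ρ, (x, ρ) ∈ Ω →
    acceleration (I := ambientModel F) g (fun σ ↦ (x, σ)) ρ = A (x, ρ)
  acceleration_perp : ∀ z ∈ Ω, g z (ambientField W z) (A z) = 0
  initial_full : ∀ (x : P) (w₁ w₂ : TangentSpace 𝓘(ℝ, F) x) (c₁ c₂ : ℝ),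
    g (x, 0) (ambientVec (x, 0) w₁ c₁) (ambientVec (x, 0) w₂ c₂) =
      tautological h x w₁ w₂ +
        (t x) ^ 2 * (connectionForm W r t x w₁ * c₂ + connectionForm W r t x w₂ * c₁)

/-- `V`, a tangent vector of `P × ℝ` at `(x, 0)`, is a `(g, a)`-transversal vector for the ambient
metric `gt`, where `r = (g, a)`. -/
structure IsTransversal (W : WeylStructure E F M P) (r : WeylPair E M p q) (t : P → ℝ)
    (gt : BilinField (ambientModel F) (P × ℝ)) (x : P)
    (V : TangentSpace (ambientModel F) (x, (0 : ℝ))) : Prop where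
  fundamental : gt (x, 0) V (ambientField W (x, 0)) = (t x) ^ 2
  horizontal : ∀ w : TangentSpace 𝓘(ℝ, F) x, connectionForm W r t x w = 0 →
    gt (x, 0) V (ambientVec (x, 0) w 0) = 0
  null : gt (x, 0) V V = 0

/-- `A` is an acceleration law on `(Ω, g)`: it assigns to every velocity `u` at `z ∈ Ω` a tangent
vector `A z u` at `z`, smoothly and equivariantly under dilatations, and orthogonal to the
fundamental vector field. A smooth dilatation-invariant vector field orthogonal to the fundamental
field is the case where `A z u` does not depend on `u`. -/
structure IsAccelerationLaw (W : WeylStructure E F M P) (Ω : Set (P × ℝ))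
    (g : BilinField (ambientModel F) (P × ℝ))
    (A : ∀ z : P × ℝ, TangentSpace (ambientModel F) z → TangentSpace (ambientModel F) z) :
    Prop where
  smooth : ContMDiffOn (ambientModel F).tangent (ambientModel F).tangent ∞
    (fun v : TangentBundle (ambientModel F) (P × ℝ) ↦
      (⟨v.1, A v.1 v.2⟩ : TangentBundle (ambientModel F) (P × ℝ)))
    {v | v.1 ∈ Ω}
  equivariant : ∀ s z (u : TangentSpace (ambientModel F) z), 0 < s → z ∈ Ω →
    A (W.ambientDil s z) (mfderiv (ambientModel F) (ambientModel F) (W.ambientDil s) z u) =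
      mfderiv (ambientModel F) (ambientModel F) (W.ambientDil s) z (A z u)
  perp : ∀ z ∈ Ω, ∀ u, g z (ambientField W z) (A z u) = 0

/-- `φ` is a diffeomorphism of `Ω'` onto an open subset of `Ω`, commuting with dilatations and
restricting to the identity of `P × {0}`, such that `(Ω', φ^* g)` is in Weyl-normal form with
acceleration `A'`, the vector field on `Ω'` which `φ` carries to the acceleration prescribed by the
law `A` for the velocities of the curves `ρ ↦ φ (x, ρ)`. -/
structure PutsInWeylNormalForm {W : WeylStructure E F M P} {C : WeylClass E M p q}
    (h : MetricBundleIso W C) (r : WeylPair E M p q) (t : P → ℝ)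
    (Ω : Set (P × ℝ)) (g : BilinField (ambientModel F) (P × ℝ))
    (A : ∀ z : P × ℝ, TangentSpace (ambientModel F) z → TangentSpace (ambientModel F) z)
    (Ω' : Set (P × ℝ))
    (A' : ∀ z : P × ℝ, TangentSpace (ambientModel F) z)
    (φ : PartialDiffeomorph (ambientModel F) (ambientModel F) (P × ℝ) (P × ℝ) ∞) : Prop where
  source_eq : φ.source = Ω'
  target_subset : φ.target ⊆ Ω
  comm_dil : ∀ s z, 0 < s → z ∈ Ω' → φ (W.ambientDil s z) = W.ambientDil s (φ z)
  id_zero : ∀ x : P, φ (x, 0) = (x, 0)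
  related : ∀ z ∈ Ω', mfderiv (ambientModel F) (ambientModel F) φ z (A' z) =
    A (φ z) (mfderiv (ambientModel F) (ambientModel F) φ z (rhoVec z))
  normalForm : IsWeylNormalForm h r t Ω'
    (pullbackBilin (I := ambientModel F) (I' := ambientModel F) φ g) A'

end Weyl
end

/-! The normal form determines the curves `ρ ↦ φ (x, ρ)`. They must solve the second order equation
`∇_{c'} c' = A (c, c')`. Since `φ` fixes `P × {0}`, its derivative there is `w + c ∂_ρ ↦ w + c U`,
where `U` is the initial velocity, so condition (iii) on the metric along `ρ = 0` says exactly that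
`U` is transversal.

The transversal vector exists and is unique by linear algebra. The tautological tensor degenerates
along the fundamental vector `T`, so the vectors whose products with the tangent space of `P` are
`t² n` form an affine line in the direction `T`. On this line the square is an affine function of
slope `2 t² n(T) = 2 t² ≠ 0`, hence it has one zero (`isNullSolution_nullSolution`,
`IsNullSolution.unique`). An explicit formula gives smoothness in the base point.

So `φ` can only be the map `normalMap` that follows the solution with transversal initial velocity.
Uniqueness is uniqueness for the differential equation on the interval `{ρ | (x, ρ) ∈ Ω'}`.
Existence rests on smooth dependence on initial data (`exists_contDiffOn_flow`), proved by applying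
the implicit function theorem to the integral equation in `C([0,1], E)`. Dilatations are
homotheties, so they preserve the Levi-Civita connection, the law and the transversal vectors; hence
`normalMap` is equivariant. Its derivative on `P × {0}` is invertible because `U` is not tangent to
`P`, so it is injective near each point. Equivariance spreads this injectivity along an orbit
(`exists_injOn_saturated`), and a continuous radius function on `M` makes it global
(`exists_injOn_of_locally`).

The remaining properties of the normal form follow by pulling back: acceleration is natural under
local diffeomorphisms (`acceleration_comp`), and an equivariant map carries the fundamental field to
itself. -/

set_option linter.unusedSectionVars false
set_option synthInstance.maxHeartbeats 200000

/-! ### Smoothness of superposition operators on spaces of continuous maps -/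

section Superposition

variable {K : Type*} [TopologicalSpace K] [CompactSpace K]

/-- Pointwise application `A ↦ (h ↦ (s ↦ A s (h s)))` of a continuous family of operators. -/
noncomputable def ContinuousMap.pointwiseApply (K : Type*) [TopologicalSpace K] [CompactSpace K]
    (E G : Type*) [NormedAddCommGroup E] [NormedSpace ℝ E]
    [NormedAddCommGroup G] [NormedSpace ℝ G] :
    C(K, E →L[ℝ] G) →L[ℝ] C(K, E) →L[ℝ] C(K, G) :=
  LinearMap.mkContinuous₂
    (LinearMap.mk₂ ℝ
      (fun (A : C(K, E →L[ℝ] G)) (h : C(K, E)) ↦ (⟨fun s ↦ A s (h s), by fun_prop⟩ : C(K, G)))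
      (by intros; ext; simp) (by intros; ext; simp) (by intros; ext; simp) (by intros; ext; simp))
    1 (fun A h ↦ by
      rw [ContinuousMap.norm_le _ (by positivity)]
      intro s
      rw [one_mul]
      exact ((A s).le_opNorm _).trans
        (mul_le_mul (A.norm_coe_le_norm s) (h.norm_coe_le_norm s) (norm_nonneg _) (norm_nonneg A)))

theorem ContinuousMap.pointwiseApply_apply {E G : Type*} [NormedAddCommGroup E] [NormedSpace ℝ E]
    [NormedAddCommGroup G] [NormedSpace ℝ G] (A : C(K, E →L[ℝ] G)) (h : C(K, E)) (s : K) :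
    ContinuousMap.pointwiseApply K E G A h s = A s (h s) := rfl

/-- The mean value inequality at each `s` has to be uniform in `s`. The uniformity comes from
continuity of `z ↦ f' ∘ z` for the sup norm, so no compactness in `E` is needed. -/
theorem ContinuousMap.hasFDerivAt_comp_left {E G : Type*} [NormedAddCommGroup E] [NormedSpace ℝ E]
    [NormedAddCommGroup G] [NormedSpace ℝ G] (f : C(E, G)) (f' : C(E, E →L[ℝ] G))
    (hf : ∀ x, HasFDerivAt f (f' x) x) (y : C(K, E)) :
    HasFDerivAt (fun z : C(K, E) ↦ f.comp z)
      (ContinuousMap.pointwiseApply K E G (f'.comp y)) y := by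
  rw [hasFDerivAt_iff_isLittleO_nhds_zero, Asymptotics.isLittleO_iff]
  intro ε hε
  have hc : Continuous fun z : C(K, E) ↦ f'.comp z := ContinuousMap.continuous_postcomp f'
  obtain ⟨δ, hδ, H⟩ := (Metric.continuousAt_iff (α := C(K, E)) (β := C(K, E →L[ℝ] G))).1 (hc.continuousAt (x := y)) ε hε
  filter_upwards [Metric.ball_mem_nhds (0 : C(K, E)) hδ] with h hh
  rw [mem_ball_zero_iff] at hh
  rw [ContinuousMap.norm_le _ (by positivity)]
  intro s
  -- Perturbing `y` by the constant map `z - y s` stays within `δ` of `y` in sup norm and takes the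
  -- value `z` at `s`.
  have hb : ∀ z ∈ Metric.ball (y s) δ, ‖f' z - f' (y s)‖ ≤ ε := by
    intro z hz
    have h1 : dist (y + ContinuousMap.const K (z - y s)) y < δ := by
      rw [dist_eq_norm, add_sub_cancel_left]
      refine lt_of_le_of_lt ?_ (mem_ball_iff_norm.1 hz)
      exact (ContinuousMap.norm_le _ (norm_nonneg _)).2 fun _ ↦ le_rfl
    have h2 := (ContinuousMap.dist_apply_le_dist s).trans (H h1).le
    simpa [dist_eq_norm] using h2
  have hs : ‖h s‖ < δ := (h.norm_coe_le_norm s).trans_lt hh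
  have key := (convex_ball (y s) δ).norm_image_sub_le_of_norm_hasFDerivWithin_le'
    (f := f) (f' := f') (φ := f' (y s)) (C := ε) (fun z _ ↦ (hf z).hasFDerivWithinAt) hb
    (Metric.mem_ball_self hδ) (y := y s + h s) (by simpa using hs)
  rw [add_sub_cancel_left] at key
  refine le_trans ?_ (key.trans (mul_le_mul_of_nonneg_left (h.norm_coe_le_norm s) hε.le))
  exact le_of_eq (by simp [ContinuousMap.pointwiseApply_apply])

/-- The derivative is again a superposition operator, with `fderiv ℝ f` in place of `f`, followed by
a continuous linear map. The induction therefore changes the codomain to `E →L[ℝ] G`; the universe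
`max u v` of `G` is stable under this. -/
theorem ContinuousMap.contDiff_comp_left_nat.{u, v} {E : Type u} [NormedAddCommGroup E] [NormedSpace ℝ E]
    (n : ℕ) : ∀ {G : Type (max u v)} [NormedAddCommGroup G] [NormedSpace ℝ G] (f : C(E, G)),
      ContDiff ℝ n f → ContDiff ℝ n (fun z : C(K, E) ↦ f.comp z) := by
  induction n with
  | zero =>
    intro G _ _ f _
    exact contDiff_zero.2 (ContinuousMap.continuous_postcomp f)
  | succ n ih =>
    intro G _ _ f hf
    push_cast at hf ⊢
    have hd : ∀ x, HasFDerivAt f (fderiv ℝ f x) x := fun x ↦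
      ((hf.differentiable (by simp)) x).hasFDerivAt
    have hf' : ContDiff ℝ n (fderiv ℝ f) := hf.fderiv_right le_rfl
    rw [contDiff_succ_iff_hasFDerivAt]
    refine ⟨fun z ↦ ContinuousMap.pointwiseApply K E G
      ((⟨fderiv ℝ f, hf'.continuous⟩ : C(E, E →L[ℝ] G)).comp z), ?_, fun z ↦ ?_⟩
    · exact (ContinuousMap.pointwiseApply K E G).contDiff.comp (ih ⟨fderiv ℝ f, hf'.continuous⟩ hf')
    · exact ContinuousMap.hasFDerivAt_comp_left f ⟨fderiv ℝ f, hf'.continuous⟩ hd z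

theorem ContinuousMap.contDiff_comp_left {E : Type*} [NormedAddCommGroup E] [NormedSpace ℝ E]
    (f : C(E, E)) (hf : ContDiff ℝ ∞ f) : ContDiff ℝ ∞ (fun z : C(K, E) ↦ f.comp z) :=
  contDiff_infty.2 fun n ↦ ContinuousMap.contDiff_comp_left_nat.{_, _} n f (contDiff_infty.1 hf n)

end Superposition

/-! ### Smooth dependence of flows on time and initial point -/

section Flow

variable {E : Type*} [NormedAddCommGroup E] [NormedSpace ℝ E]

/-- The primitive `s ↦ ∫₀ˢ y` of a continuous curve on the unit interval. -/
noncomputable def unitPrimitive (E : Type*) [NormedAddCommGroup E] [NormedSpace ℝ E] :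
    C(Icc (0 : ℝ) 1, E) →L[ℝ] C(Icc (0 : ℝ) 1, E) :=
  LinearMap.mkContinuous
    { toFun := fun y ↦ ⟨fun s ↦ ∫ τ in (0 : ℝ)..s, y (projIcc 0 1 zero_le_one τ), by
        have : Continuous fun τ : ℝ ↦ y (projIcc 0 1 zero_le_one τ) :=
          y.continuous.comp continuous_projIcc
        exact (intervalIntegral.continuous_primitive
          (fun a b ↦ this.intervalIntegrable a b) 0).comp continuous_subtype_val⟩
      map_add' := fun y z ↦ by
        ext s
        have h : ∀ y : C(Icc (0 : ℝ) 1, E), IntervalIntegrable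
            (fun τ : ℝ ↦ y (projIcc 0 1 zero_le_one τ)) MeasureTheory.volume 0 s :=
          fun y ↦ (y.continuous.comp continuous_projIcc).intervalIntegrable _ _
        simpa using intervalIntegral.integral_add (h y) (h z)
      map_smul' := fun c y ↦ by
        ext s
        simp }
    1 (fun y ↦ by
      rw [one_mul, ContinuousMap.norm_le _ (norm_nonneg _)]
      intro s
      refine (intervalIntegral.norm_integral_le_of_norm_le_const
        (C := ‖y‖) fun τ _ ↦ y.norm_coe_le_norm _).trans ?_
      rw [sub_zero, abs_of_nonneg s.2.1]
      exact mul_le_of_le_one_right (norm_nonneg _) s.2.2)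

/-- The map whose zeros `((x, l), y)` are the solutions `y` of `y' = l f(y)`, `y(0) = x`. -/
noncomputable def flowEquation (f : C(E, E)) (u : (E × ℝ) × C(Icc (0 : ℝ) 1, E)) :
    C(Icc (0 : ℝ) 1, E) :=
  u.2 - ContinuousLinearMap.const ℝ (Icc (0 : ℝ) 1) u.1.1 -
    u.1.2 • unitPrimitive E (f.comp u.2)

theorem contDiff_flowEquation (f : C(E, E)) (hf : ContDiff ℝ ∞ f) :
    ContDiff ℝ ∞ (flowEquation f) := by
  have h1 : ContDiff ℝ ∞ fun u : (E × ℝ) × C(Icc (0 : ℝ) 1, E) ↦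
      unitPrimitive E (f.comp u.2) :=
    (unitPrimitive E).contDiff.comp ((ContinuousMap.contDiff_comp_left f hf).comp contDiff_snd)
  have h2 : ContDiff ℝ ∞ fun u : (E × ℝ) × C(Icc (0 : ℝ) 1, E) ↦
      ContinuousLinearMap.const (M := E) ℝ (Icc (0 : ℝ) 1) u.1.1 :=
    (ContinuousLinearMap.const (M := E) ℝ (Icc (0 : ℝ) 1)).contDiff.comp
      (contDiff_fst.comp contDiff_fst)
  exact (contDiff_snd.sub h2).sub ((contDiff_snd.comp contDiff_fst).smul h1)

/-- At `l = 0` the integral term vanishes and the equation is affine in `y`. This is what makes the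
implicit function theorem applicable near time zero. -/
theorem fderiv_flowEquation_comp_inr (f : C(E, E)) (hf : ContDiff ℝ ∞ f) (x : E)
    (y : C(Icc (0 : ℝ) 1, E)) :
    fderiv ℝ (flowEquation f) ((x, 0), y) ∘L ContinuousLinearMap.inr ℝ (E × ℝ) _ =
      ContinuousLinearMap.id ℝ _ := by
  have h1 : HasFDerivAt (flowEquation f) (fderiv ℝ (flowEquation f) ((x, 0), y)) ((x, 0), y) :=
    ((contDiff_flowEquation f hf).differentiable (by simp) _).hasFDerivAt
  have h2 := h1.comp y (hasFDerivAt_prodMk_right (𝕜 := ℝ) (x, (0 : ℝ)) y)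
  have h3 : HasFDerivAt (fun z : C(Icc (0 : ℝ) 1, E) ↦
      z - ContinuousLinearMap.const ℝ (Icc (0 : ℝ) 1) x) (ContinuousLinearMap.id ℝ _) y :=
    (hasFDerivAt_id y).sub_const _
  refine h2.unique (h3.congr_of_eventuallyEq (Filter.Eventually.of_forall fun z ↦ ?_))
  simp [flowEquation]

/-- The fundamental theorem of calculus for the rescaled curve `s ↦ c (l s)`. Rescaling turns the
time `l` into a parameter and keeps all curves in the fixed space `C([0,1], E)`. -/
theorem flowEquation_eq_zero (f : C(E, E)) [CompleteSpace E] {c : ℝ → E} {ε l : ℝ}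
    (hc : ∀ t ∈ Ioo (-ε) ε, HasDerivAt c (f (c t)) t) (hl : l ∈ Ioo (-ε) ε)
    (y : C(Icc (0 : ℝ) 1, E)) (hy : ∀ s, y s = c (l * s)) :
    flowEquation f ((c 0, l), y) = 0 := by
  ext s
  have hmem : ∀ τ ∈ Icc (0 : ℝ) 1, l * τ ∈ Ioo (-ε) ε := by
    intro τ hτ
    have h1 : |l * τ| < ε := by
      rw [abs_mul, abs_of_nonneg hτ.1]
      exact (mul_le_of_le_one_right (abs_nonneg _) hτ.2).trans_lt (abs_lt.2 hl)
    exact abs_lt.1 h1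
  have hsub : uIcc (0 : ℝ) s ⊆ Icc 0 1 := by
    rw [uIcc_of_le s.2.1]
    exact Icc_subset_Icc_right s.2.2
  have h1 : ∀ τ ∈ uIcc (0 : ℝ) s, HasDerivAt (fun τ ↦ c (l * τ))
      (l • f (y (projIcc 0 1 zero_le_one τ))) τ := by
    intro τ hτ
    have h2 := (hc _ (hmem τ (hsub hτ))).scomp τ ((hasDerivAt_id τ).const_mul l)
    rw [hy, projIcc_of_mem zero_le_one (hsub hτ)]
    simpa [Function.comp_def] using h2
  have h3 : IntervalIntegrable (fun τ ↦ l • f (y (projIcc 0 1 zero_le_one τ)))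
      MeasureTheory.volume 0 s :=
    ((f.continuous.comp (y.continuous.comp continuous_projIcc)).const_smul l).intervalIntegrable _ _
  have h4 := intervalIntegral.integral_eq_sub_of_hasDerivAt h1 h3
  rw [intervalIntegral.integral_smul, mul_zero] at h4
  change y s - c 0 - l • (∫ τ in (0 : ℝ)..s, f (y (projIcc 0 1 zero_le_one τ))) = 0
  rw [h4, hy]
  abel

/-- Picard–Lindelöf supplies a continuous local flow. Its rescaled orbits `Y z` depend continuously
on `z` and solve `flowEquation`, so by local uniqueness they coincide with the smooth implicit
function; evaluating at `s = 1` recovers the flow. -/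
theorem exists_contDiffOn_flow_of_contDiff [CompleteSpace E] {f : E → E} (hf : ContDiff ℝ ∞ f)
    (x₀ : E) :
    ∃ r > 0, ∃ α : E × ℝ → E, (∀ x ∈ Metric.ball x₀ r, α (x, 0) = x ∧
      ∀ t ∈ Ioo (-r) r, HasDerivAt (fun s ↦ α (x, s)) (f (α (x, t))) t) ∧
      ContDiffOn ℝ ∞ α (Metric.ball x₀ r ×ˢ Ioo (-r) r) := by
  obtain ⟨ε, hε, a, r, L, K, hr, hpl⟩ :=
    IsPicardLindelof.of_contDiffAt_one (x₀ := x₀) (hf.contDiffAt.of_le (by simp))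
  obtain ⟨α, hα, hαc⟩ :=
    (hpl 0).exists_forall_mem_closedBall_eq_hasDerivWithinAt_continuousOn
  simp only [zero_sub, zero_add] at hα hαc
  set Z : Set (E × ℝ) := Metric.ball x₀ r ×ˢ Ioo (-ε) ε with hZ
  have hZo : IsOpen Z := Metric.isOpen_ball.prod isOpen_Ioo
  have hd : ∀ x ∈ Metric.ball x₀ (r : ℝ), ∀ t ∈ Ioo (-ε) ε,
      HasDerivAt (fun s ↦ α (x, s)) (f (α (x, t))) t := fun x hx t ht ↦
    ((hα x (Metric.ball_subset_closedBall hx)).2 t (Ioo_subset_Icc_self ht)).hasDerivAt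
      (Icc_mem_nhds ht.1 ht.2)
  have hαZ : ContinuousOn α Z :=
    hαc.mono (prod_mono Metric.ball_subset_closedBall Ioo_subset_Icc_self)
  have hmem : ∀ z ∈ Z, ∀ s : Icc (0 : ℝ) 1, (z.1, z.2 * (s : ℝ)) ∈ Z := by
    intro z hz s
    refine ⟨hz.1, abs_lt.1 ?_⟩
    rw [abs_mul, abs_of_nonneg s.2.1]
    exact (mul_le_of_le_one_right (abs_nonneg _) s.2.2).trans_lt (abs_lt.2 hz.2)
  have hYc : Continuous fun w : Z × Icc (0 : ℝ) 1 ↦ α (w.1.1.1, w.1.1.2 * (w.2 : ℝ)) :=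
    hαZ.comp_continuous (by fun_prop) fun w ↦ hmem _ w.1.2 w.2
  classical
  let Y : E × ℝ → C(Icc (0 : ℝ) 1, E) := fun z ↦
    if hz : z ∈ Z then ⟨fun s ↦ α (z.1, z.2 * (s : ℝ)),
      hYc.comp (Continuous.prodMk_right (⟨z, hz⟩ : Z))⟩ else 0
  have hY : ∀ z ∈ Z, ∀ s, Y z s = α (z.1, z.2 * (s : ℝ)) := fun z hz s ↦ by
    simp only [Y, dif_pos hz, ContinuousMap.coe_mk]
  have hYcont : ContinuousOn Y Z := by
    rw [continuousOn_iff_continuous_domRestrict]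
    refine ContinuousMap.continuous_of_continuous_uncurry _ (hYc.congr fun w ↦ ?_)
    exact (hY _ w.1.2 w.2).symm
  let F : C(E, E) := ⟨f, hf.continuous⟩
  have hFs := contDiff_flowEquation F hf
  have hzero : ∀ z ∈ Z, flowEquation F (z, Y z) = 0 := by
    intro z hz
    have h0 : α (z.1, 0) = z.1 := (hα z.1 (Metric.ball_subset_closedBall hz.1)).1
    have := flowEquation_eq_zero F (c := fun s ↦ α (z.1, s)) (hd z.1 hz.1) hz.2 (Y z) (hY z hz)
    simpa only [h0] using this
  let D : (E × ℝ) × C(Icc (0 : ℝ) 1, E) → C(Icc (0 : ℝ) 1, E) →L[ℝ] C(Icc (0 : ℝ) 1, E) :=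
    fun u ↦ fderiv ℝ (flowEquation F) u ∘L ContinuousLinearMap.inr ℝ (E × ℝ) _
  have hDc : Continuous D :=
    (hFs.continuous_fderiv (by simp)).clm_comp continuous_const
  have hz₀ : (x₀, (0 : ℝ)) ∈ Z := ⟨Metric.mem_ball_self hr, by simpa using hε⟩
  -- The partial derivative is the identity at `(x₀, 0)`, it varies continuously, and the invertible
  -- operators form an open set.
  have hinv : ∀ᶠ z in 𝓝 (x₀, (0 : ℝ)), (D (z, Y z)).IsInvertible := by
    have h1 : ContinuousAt (fun z ↦ D (z, Y z)) (x₀, 0) :=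
      hDc.continuousAt.comp (continuousAt_id.prodMk (hYcont.continuousAt (hZo.mem_nhds hz₀)))
    have h2 : D ((x₀, 0), Y (x₀, 0)) =
        (ContinuousLinearEquiv.refl ℝ C(Icc (0 : ℝ) 1, E) : _ →L[ℝ] _) :=
      fderiv_flowEquation_comp_inr F hf x₀ _
    have h3 := ContinuousLinearEquiv.nhds (ContinuousLinearEquiv.refl ℝ C(Icc (0 : ℝ) 1, E))
    rw [← h2] at h3
    filter_upwards [h1 h3] with z hz
    exact hz
  have hsmooth : ∀ z ∈ Z, (D (z, Y z)).IsInvertible → ContDiffAt ℝ ∞ α z := by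
    intro z hz hi
    have hc : ContDiffAt ℝ ∞ (flowEquation F) (z, Y z) := hFs.contDiffAt
    have h1 := hc.eventually_apply_eq_iff_implicitFunction (by simp) hi
    have h2 : ContinuousAt (fun w ↦ (w, Y w)) z :=
      continuousAt_id.prodMk (hYcont.continuousAt (hZo.mem_nhds hz))
    -- Continuity of `Y` keeps `(w, Y w)` in the region where the implicit function gives the only
    -- solution.
    have h3 : hc.implicitFunction (by simp) hi =ᶠ[𝓝 z] Y := by
      filter_upwards [h2.eventually h1, hZo.mem_nhds hz] with w hw hwZ
      exact hw.1 ((hzero w hwZ).trans (hzero z hz).symm)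
    have h4 : ContDiffAt ℝ ∞ Y z :=
      (hc.contDiffAt_implicitFunction (by simp) hi).congr_of_eventuallyEq h3.symm
    have h5 : ContDiffAt ℝ ∞ (fun w ↦ ContinuousMap.evalCLM (M := E) ℝ
        (1 : Icc (0 : ℝ) 1) (Y w)) z :=
      (ContinuousMap.evalCLM (M := E) ℝ (1 : Icc (0 : ℝ) 1)).contDiff.contDiffAt.comp z h4
    refine h5.congr_of_eventuallyEq ?_
    filter_upwards [hZo.mem_nhds hz] with w hw
    simp [hY w hw]
  obtain ⟨ρ, hρ, hρs⟩ := Metric.mem_nhds_iff.1 (hinv.and (hZo.mem_nhds hz₀))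
  have hbox : Metric.ball x₀ ρ ×ˢ Ioo (-ρ) ρ ⊆ Metric.ball (x₀, (0 : ℝ)) ρ := by
    rintro ⟨x, t⟩ ⟨hx, ht⟩
    rw [← ball_prod_same]
    exact ⟨hx, by simpa [Real.ball_eq_Ioo] using ht⟩
  have hρ0 : (0 : ℝ) ∈ Ioo (-ρ) ρ := by simpa using hρ
  refine ⟨ρ, hρ, α, fun x hx ↦ ⟨?_, fun t ht ↦ ?_⟩, fun z hz ↦ ?_⟩
  · exact (hα x (Metric.ball_subset_closedBall (hρs (hbox (mk_mem_prod hx hρ0))).2.1)).1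
  · exact hd x (hρs (hbox (mk_mem_prod hx hρ0))).2.1 t (hρs (hbox (mk_mem_prod hx ht))).2.2
  · exact (hsmooth z (hρs (hbox hz)).2 (hρs (hbox hz)).1).contDiffWithinAt

/-- **Smooth dependence on initial conditions**: a smooth vector field has a smooth local flow. -/
theorem exists_contDiffOn_flow [FiniteDimensional ℝ E] {f : E → E} {U : Set E} (hU : IsOpen U)
    (hf : ContDiffOn ℝ ∞ f U) {x₀ : E} (hx₀ : x₀ ∈ U) :
    ∃ r > 0, ∃ α : E × ℝ → E, (∀ x ∈ Metric.ball x₀ r, α (x, 0) = x ∧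
      ∀ t ∈ Ioo (-r) r, α (x, t) ∈ U ∧ HasDerivAt (fun s ↦ α (x, s)) (f (α (x, t))) t) ∧
      ContDiffOn ℝ ∞ α (Metric.ball x₀ r ×ˢ Ioo (-r) r) := by
  have : CompleteSpace E := FiniteDimensional.complete ℝ E
  obtain ⟨δ, hδ, hδU⟩ := Metric.isOpen_iff.1 hU x₀ hx₀
  -- The superposition operator needs a field defined on all of `E`, so `f` is cut off: `b` is `1`
  -- on the ball of radius `δ / 3` and supported in that of radius `δ / 2`.
  let b : ContDiffBump x₀ := ⟨δ / 3, δ / 2, by positivity, by linarith⟩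
  have hbs : tsupport b ⊆ U := by
    rw [b.tsupport_eq]
    exact (Metric.closedBall_subset_ball (by simp only [b]; linarith)).trans hδU
  have hg : ContDiff ℝ ∞ fun x ↦ b x • f x := by
    rw [contDiff_iff_contDiffAt]
    intro x
    by_cases hx : x ∈ tsupport b
    · exact b.contDiff.contDiffAt.smul (hf.contDiffAt (hU.mem_nhds (hbs hx)))
    · refine (contDiffAt_const (c := (0 : E))).congr_of_eventuallyEq ?_
      filter_upwards [(isClosed_tsupport b).isOpen_compl.mem_nhds hx] with y hy
      rw [image_eq_zero_of_notMem_tsupport hy, zero_smul]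
  obtain ⟨r, hr, α, hα, hs⟩ := exists_contDiffOn_flow_of_contDiff hg x₀
  have ho : IsOpen (Metric.ball x₀ r ×ˢ Ioo (-r) r) := Metric.isOpen_ball.prod isOpen_Ioo
  have h0 : (x₀, (0 : ℝ)) ∈ Metric.ball x₀ r ×ˢ Ioo (-r) r :=
    ⟨Metric.mem_ball_self hr, by simpa using hr⟩
  have hc : ContinuousAt α (x₀, 0) := hs.continuousOn.continuousAt (ho.mem_nhds h0)
  -- For initial points near `x₀` and short times the flow stays where `b = 1`, and there it solves
  -- the original equation.
  have hc' : α ⁻¹' Metric.ball x₀ (δ / 3) ∈ 𝓝 (x₀, (0 : ℝ)) := by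
    refine hc.preimage_mem_nhds (Metric.isOpen_ball.mem_nhds ?_)
    rw [(hα x₀ (Metric.mem_ball_self hr)).1]
    exact Metric.mem_ball_self (by positivity)
  obtain ⟨ρ, hρ, hρs⟩ := Metric.mem_nhds_iff.1 (Filter.inter_mem hc' (ho.mem_nhds h0))
  have hbox : Metric.ball x₀ ρ ×ˢ Ioo (-ρ) ρ ⊆ Metric.ball (x₀, (0 : ℝ)) ρ := by
    rintro ⟨x, t⟩ ⟨hx, ht⟩
    rw [← ball_prod_same]
    exact ⟨hx, by simpa [Real.ball_eq_Ioo] using ht⟩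
  refine ⟨ρ, hρ, α, fun x hx ↦ ⟨?_, fun t ht ↦ ?_⟩, hs.mono fun z hz ↦ (hρs (hbox hz)).2⟩
  · exact (hα x (hρs (hbox (mk_mem_prod hx (show (0 : ℝ) ∈ _ by simpa using hρ)))).2.1).1
  · have h1 := hρs (hbox (mk_mem_prod hx ht))
    refine ⟨hδU (Metric.ball_subset_ball (by linarith) h1.1), ?_⟩
    have h2 := (hα x h1.2.1).2 t h1.2.2
    rwa [b.one_of_mem_closedBall (Metric.ball_subset_closedBall h1.1), one_smul] at h2

end Flow

/-! ### Covariant acceleration in a vector space and its naturality -/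

section FlatAcceleration

variable {V V' : Type*} [NormedAddCommGroup V] [NormedSpace ℝ V]
  [NormedAddCommGroup V'] [NormedSpace ℝ V']

/-- The pullback `(u, v) ↦ B (L u) (L v)` of a bilinear form. -/
noncomputable def bilinPullback (L : V →L[ℝ] V') (B : V' →L[ℝ] V' →L[ℝ] ℝ) : V →L[ℝ] V →L[ℝ] ℝ :=
  (ContinuousLinearMap.precomp ℝ L).comp (B.comp L)

@[simp] theorem bilinPullback_apply (L : V →L[ℝ] V') (B : V' →L[ℝ] V' →L[ℝ] ℝ) (u v : V) :
    bilinPullback L B u v = B (L u) (L v) := rfl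

theorem contDiff_precomp :
    ContDiff ℝ ∞ fun L : V →L[ℝ] V' ↦
      (ContinuousLinearMap.precomp ℝ L : (V' →L[ℝ] ℝ) →L[ℝ] V →L[ℝ] ℝ) := by
  exact ContinuousLinearMap.contDiff (𝕜 := ℝ) (E := V →L[ℝ] V')
    (F := (V' →L[ℝ] ℝ) →L[ℝ] V →L[ℝ] ℝ) (n := ∞) (ContinuousLinearMap.compL ℝ V V' ℝ).flip

theorem ContDiffWithinAt.bilinPullback {W : Type*} [NormedAddCommGroup W] [NormedSpace ℝ W]
    {L : W → V →L[ℝ] V'} {B : W → V' →L[ℝ] V' →L[ℝ] ℝ} {s : Set W} {x : W}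
    (hL : ContDiffWithinAt ℝ ∞ L s x) (hB : ContDiffWithinAt ℝ ∞ B s x) :
    ContDiffWithinAt ℝ ∞ (fun z ↦ _root_.bilinPullback (L z) (B z)) s x := by
  have h1 : ContDiffWithinAt ℝ ∞ (fun z ↦
      (ContinuousLinearMap.precomp ℝ (L z) : (V' →L[ℝ] ℝ) →L[ℝ] V →L[ℝ] ℝ)) s x :=
    contDiff_precomp.contDiffAt.comp_contDiffWithinAt x hL
  exact h1.clm_comp (hB.clm_comp hL)

/-- Christoffel symbols of the first kind, on a vector space. -/
noncomputable def christoffelForm (G : V → V →L[ℝ] V →L[ℝ] ℝ) (y u v : V) : V →L[ℝ] ℝ :=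
  let D : V →L[ℝ] V →L[ℝ] V →L[ℝ] ℝ := fderiv ℝ G y
  (1 / 2 : ℝ) • (D u v + D v u - (D.flip u).flip v)

theorem christoffelForm_apply (G : V → V →L[ℝ] V →L[ℝ] ℝ) (y u v w : V) :
    christoffelForm G y u v w =
      (1 / 2 : ℝ) * (fderiv ℝ G y u v w + fderiv ℝ G y v u w - fderiv ℝ G y w u v) := rfl

/-- Covariant acceleration of a curve in a vector space with a field of bilinear forms. -/
noncomputable def flatAcceleration (G : V → V →L[ℝ] V →L[ℝ] ℝ) (c : ℝ → V) (τ : ℝ) : V :=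
  deriv (deriv c) τ + (G (c τ)).inverse (christoffelForm G (c τ) (deriv c τ) (deriv c τ))

theorem flatAcceleration_congr {G G' : V → V →L[ℝ] V →L[ℝ] ℝ} {c c' : ℝ → V} {τ : ℝ}
    (hc : c =ᶠ[𝓝 τ] c') (hG : G =ᶠ[𝓝 (c τ)] G') :
    flatAcceleration G c τ = flatAcceleration G' c' τ := by
  have h1 : deriv c =ᶠ[𝓝 τ] deriv c' := hc.deriv
  have h0 := hc.eq_of_nhds
  simp only [flatAcceleration, christoffelForm, hG.fderiv_eq, hG.eq_of_nhds, h1.deriv_eq,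
    h1.eq_of_nhds]
  rw [h0]

theorem fderiv_bilinPullback {θ : V → V'} {G' : V' → V' →L[ℝ] V' →L[ℝ] ℝ} {y : V}
    (hθ : ContDiffAt ℝ ∞ θ y) (hG' : DifferentiableAt ℝ G' (θ y)) (u v w : V) :
    fderiv ℝ (fun z ↦ bilinPullback (fderiv ℝ θ z) (G' (θ z))) y u v w =
      fderiv ℝ G' (θ y) (fderiv ℝ θ y u) (fderiv ℝ θ y v) (fderiv ℝ θ y w) +
      G' (θ y) (fderiv ℝ (fderiv ℝ θ) y u v) (fderiv ℝ θ y w) +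
      G' (θ y) (fderiv ℝ θ y v) (fderiv ℝ (fderiv ℝ θ) y u w) := by
  have hθ1 : HasFDerivAt θ (fderiv ℝ θ y) y := (hθ.differentiableAt (by simp)).hasFDerivAt
  have hL : DifferentiableAt ℝ (fderiv ℝ θ) y :=
    (hθ.fderiv_right (m := ∞) (by simp)).differentiableAt (by simp)
  have hB : HasFDerivAt (fun z ↦ G' (θ z)) ((fderiv ℝ G' (θ y)).comp (fderiv ℝ θ y)) y :=
    HasFDerivAt.comp (g := G') y hG'.hasFDerivAt hθ1
  have hv : ∀ v, HasFDerivAt (fun z ↦ fderiv ℝ θ z v) ((fderiv ℝ (fderiv ℝ θ) y).flip v) y :=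
    fun v ↦ by simpa using hL.hasFDerivAt.clm_apply (hasFDerivAt_const v y)
  have hd : DifferentiableAt ℝ (fun z ↦ bilinPullback (fderiv ℝ θ z) (G' (θ z))) y := by
    have h1 : DifferentiableAt ℝ (fun z ↦
        (ContinuousLinearMap.precomp ℝ (fderiv ℝ θ z) : (V' →L[ℝ] ℝ) →L[ℝ] V →L[ℝ] ℝ)) y :=
      DifferentiableAt.comp (g := fun L : V →L[ℝ] V' ↦
        (ContinuousLinearMap.precomp ℝ L : (V' →L[ℝ] ℝ) →L[ℝ] V →L[ℝ] ℝ)) y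
        (contDiff_precomp.differentiable (by simp) _) hL
    exact h1.clm_comp (hB.differentiableAt.clm_comp hL)
  have h1 := (hd.hasFDerivAt.clm_apply (hasFDerivAt_const v y)).clm_apply (hasFDerivAt_const w y)
  have h2 := (hB.clm_apply (hv v)).clm_apply (hv w)
  have h3 := congrArg (fun l : V →L[ℝ] ℝ ↦ l u) (h1.unique h2)
  simp at h3
  rw [h3]
  ring

/-- The classical transformation law. By symmetry of the second derivative of `θ` and of `G'`, four
of the six second order terms cancel and the other two are equal. -/
theorem christoffelForm_bilinPullback {θ : V → V'} {G' : V' → V' →L[ℝ] V' →L[ℝ] ℝ} {y : V}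
    (hθ : ContDiffAt ℝ ∞ θ y) (hG' : DifferentiableAt ℝ G' (θ y))
    (hs : ∀ u v, G' (θ y) u v = G' (θ y) v u) (u v w : V) :
    christoffelForm (fun z ↦ bilinPullback (fderiv ℝ θ z) (G' (θ z))) y u v w =
      christoffelForm G' (θ y) (fderiv ℝ θ y u) (fderiv ℝ θ y v) (fderiv ℝ θ y w) +
      G' (θ y) (fderiv ℝ (fderiv ℝ θ) y u v) (fderiv ℝ θ y w) := by
  have hsymm : IsSymmSndFDerivAt ℝ θ y := (hθ.of_le (m := 2) ENat.LEInfty.out).isSymmSndFDerivAt (by simp)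
  simp only [christoffelForm_apply, fderiv_bilinPullback hθ hG']
  rw [hsymm v u, hsymm w u, hsymm w v, hs (fderiv ℝ θ y v) (fderiv ℝ (fderiv ℝ θ) y u w)]
  ring

/-- Raising an index commutes with pullback: this carries the transformation law from symbols of the
first kind to those of the second kind. -/
theorem bilinPullback_inverse_apply {L : V →L[ℝ] V'} {B : V' →L[ℝ] V' →L[ℝ] ℝ}
    (hL : L.IsInvertible) (hB : B.IsInvertible) {ν : V →L[ℝ] ℝ} {ν' : V' →L[ℝ] ℝ}
    (h : ∀ w, ν w = ν' (L w)) : L ((bilinPullback L B).inverse ν) = B.inverse ν' := by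
  obtain ⟨e, rfl⟩ := hL
  obtain ⟨b, rfl⟩ := hB
  have hinv : (bilinPullback (e : V →L[ℝ] V') (b : V' →L[ℝ] V' →L[ℝ] ℝ)).IsInvertible :=
    ⟨e.trans (b.trans (e.symm.arrowCongr (ContinuousLinearEquiv.refl ℝ ℝ))), by
      ext u v
      simp [ContinuousLinearEquiv.arrowCongr]⟩
  have h1 : (bilinPullback (e : V →L[ℝ] V') (b : V' →L[ℝ] V' →L[ℝ] ℝ)).inverse ν =
      e.symm (b.symm ν') := by
    rw [hinv.inverse_apply_eq]
    ext w
    simp [h]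
  rw [h1]
  simp

theorem deriv_deriv_comp {θ : V → V'} {c : ℝ → V} {τ : ℝ} (hθ : ContDiffAt ℝ ∞ θ (c τ))
    (hc : ContDiffAt ℝ ∞ c τ) :
    deriv (deriv (θ ∘ c)) τ = fderiv ℝ (fderiv ℝ θ) (c τ) (deriv c τ) (deriv c τ) +
      fderiv ℝ θ (c τ) (deriv (deriv c) τ) := by
  have hL : DifferentiableAt ℝ (fderiv ℝ θ) (c τ) :=
    (hθ.fderiv_right (m := ∞) (by simp)).differentiableAt (by simp)
  have hc1 : HasDerivAt c (deriv c τ) τ := (hc.differentiableAt (by simp)).hasDerivAt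
  have hc2 : DifferentiableAt ℝ (deriv c) τ := by
    have := (hc.fderiv_right (m := ∞) (by simp)).differentiableAt (by simp)
    exact this.clm_apply (differentiableAt_const (1 : ℝ))
  have hev : deriv (θ ∘ c) =ᶠ[𝓝 τ] fun σ ↦ fderiv ℝ θ (c σ) (deriv c σ) := by
    have h1 : ∀ᶠ σ in 𝓝 τ, ContDiffAt ℝ 1 c σ :=
      (hc.of_le (by simp)).eventually (by simp)
    have h2 : ∀ᶠ z in 𝓝 (c τ), ContDiffAt ℝ 1 θ z :=
      (hθ.of_le (by simp)).eventually (by simp)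
    filter_upwards [h1, hc.continuousAt.eventually h2] with σ h3 h4
    exact ((h4.differentiableAt (by simp)).hasFDerivAt.comp_hasDerivAt σ
      (h3.differentiableAt (by simp)).hasDerivAt).deriv
  rw [hev.deriv_eq]
  have := (hL.hasFDerivAt.comp_hasDerivAt τ hc1).clm_apply hc2.hasDerivAt
  exact this.deriv

/-- Naturality of the covariant acceleration under local diffeomorphisms of vector spaces. -/
theorem flatAcceleration_comp {θ : V → V'} {G : V → V →L[ℝ] V →L[ℝ] ℝ}
    {G' : V' → V' →L[ℝ] V' →L[ℝ] ℝ} {c : ℝ → V} {τ : ℝ}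
    (hθ : ContDiffAt ℝ ∞ θ (c τ)) (hθi : (fderiv ℝ θ (c τ)).IsInvertible)
    (hc : ContDiffAt ℝ ∞ c τ) (hG' : DifferentiableAt ℝ G' (θ (c τ)))
    (hs : ∀ u v, G' (θ (c τ)) u v = G' (θ (c τ)) v u) (hi : (G' (θ (c τ))).IsInvertible)
    (hG : G =ᶠ[𝓝 (c τ)] fun z ↦ bilinPullback (fderiv ℝ θ z) (G' (θ z))) :
    flatAcceleration G' (θ ∘ c) τ = fderiv ℝ θ (c τ) (flatAcceleration G c τ) := by
  rw [flatAcceleration_congr (c' := c) Filter.EventuallyEq.rfl hG]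
  have hc1 : HasDerivAt c (deriv c τ) τ := (hc.differentiableAt (by simp)).hasDerivAt
  have h1 : deriv (θ ∘ c) τ = fderiv ℝ θ (c τ) (deriv c τ) :=
    ((hθ.differentiableAt (by simp)).hasFDerivAt.comp_hasDerivAt τ hc1).deriv
  simp only [flatAcceleration, map_add]
  rw [deriv_deriv_comp hθ hc, h1]
  -- The inhomogeneous term of the Christoffel symbols, once raised, is the same `D²θ(c', c')` that
  -- appears in the second derivative of `θ ∘ c`; hence the two sides agree.
  rw [bilinPullback_inverse_apply hθi hi (ν' := christoffelForm G' (θ (c τ))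
      (fderiv ℝ θ (c τ) (deriv c τ)) (fderiv ℝ θ (c τ) (deriv c τ)) +
      G' (θ (c τ)) (fderiv ℝ (fderiv ℝ θ) (c τ) (deriv c τ) (deriv c τ)))
      (fun w ↦ christoffelForm_bilinPullback hθ hG' hs _ _ w)]
  rw [map_add]
  have h2 : (G' (θ (c τ))).inverse (G' (θ (c τ))
      (fderiv ℝ (fderiv ℝ θ) (c τ) (deriv c τ) (deriv c τ))) =
      fderiv ℝ (fderiv ℝ θ) (c τ) (deriv c τ) (deriv c τ) := by
    rw [hi.inverse_apply_eq]
  rw [h2]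
  simp only [Function.comp_apply]
  abel

end FlatAcceleration

/-! ### Bilinear fields and acceleration on manifolds, read in charts -/

section ManifoldBridge

variable {V H : Type*} [NormedAddCommGroup V] [NormedSpace ℝ V] [TopologicalSpace H]
  {I : ModelWithCorners ℝ V H} {X : Type*} [TopologicalSpace X] [ChartedSpace H X]
  {V' H' : Type*} [NormedAddCommGroup V'] [NormedSpace ℝ V'] [TopologicalSpace H']
  {I' : ModelWithCorners ℝ V' H'} {X' : Type*} [TopologicalSpace X'] [ChartedSpace H' X']
  {V'' H'' : Type*} [NormedAddCommGroup V''] [NormedSpace ℝ V''] [TopologicalSpace H'']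
  {I'' : ModelWithCorners ℝ V'' H''} {X'' : Type*} [TopologicalSpace X''] [ChartedSpace H'' X'']

theorem pullbackBilin_apply (f : X → X') (g : BilinField I' X') (x : X) (u v : TangentSpace I x) :
    pullbackBilin (I := I) f g x u v = g (f x) (mfderiv I I' f x u) (mfderiv I I' f x v) := rfl

theorem pullbackBilin_comp {f : X' → X''} {k : X → X'} (g : BilinField I'' X'') {x : X}
    (hf : MDifferentiableAt I' I'' f (k x)) (hk : MDifferentiableAt I I' k x) :
    pullbackBilin (I := I) (f ∘ k) g x =
      pullbackBilin (I := I) k (pullbackBilin (I := I') f g) x := by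
  ext u v
  rw [pullbackBilin_apply, pullbackBilin_apply, pullbackBilin_apply, mfderiv_comp x hf hk]
  rfl

theorem pullbackBilin_congr {f f' : X → X'} (g : BilinField I' X') {x : X} (h : f =ᶠ[𝓝 x] f') :
    (pullbackBilin (I := I) f g x : V →L[ℝ] V →L[ℝ] ℝ) = pullbackBilin (I := I) f' g x := by
  have h0 := h.eq_of_nhds
  have h1 : (mfderiv I I' f x : V →L[ℝ] V') = mfderiv I I' f' x := h.mfderiv_eq
  have h2 : (g (f x) : V' →L[ℝ] V' →L[ℝ] ℝ) = g (f' x) := by rw [h0]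
  exact congrArg₂ (bilinPullback (V := V) (V' := V')) h1 h2

theorem mfderiv_eq_fderiv_chart [I.Boundaryless] {f : X → X'} {x : X}
    (hf : MDifferentiableAt I I' f x) :
    (mfderiv I I' f x : V →L[ℝ] V') =
      fderiv ℝ (extChartAt I' (f x) ∘ f ∘ (extChartAt I x).symm) (extChartAt I x x) := by
  have h : (mfderiv I I' f x : V →L[ℝ] V') =
      fderivWithin ℝ (writtenInExtChartAt I I' x f) (range I) (extChartAt I x x) := if_pos hf
  rw [I.range_eq_univ, fderivWithin_univ] at h
  exact h

theorem contMDiffAt_extChartAt_symm [IsManifold I ∞ X] [I.Boundaryless] {x₀ : X} {y : V}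
    (hy : y ∈ (extChartAt I x₀).target) :
    ContMDiffAt 𝓘(ℝ, V) I ∞ (extChartAt I x₀).symm y :=
  (contMDiffOn_extChartAt_symm x₀).contMDiffAt ((isOpen_extChartAt_target x₀).mem_nhds hy)

theorem contMDiffAt_extChartAt_of_mem [IsManifold I ∞ X] {x₀ x : X}
    (hx : x ∈ (extChartAt I x₀).source) :
    ContMDiffAt I 𝓘(ℝ, V) ∞ (extChartAt I x₀) x :=
  contMDiffAt_extChartAt' (by rwa [extChartAt_source] at hx)

theorem isInvertible_mfderiv_extChartAt_symm' [IsManifold I ∞ X] [I.Boundaryless] {x₀ : X} {y : V}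
    (hy : y ∈ (extChartAt I x₀).target) :
    (mfderiv 𝓘(ℝ, V) I (extChartAt I x₀).symm y).IsInvertible := by
  have : IsManifold I 1 X := IsManifold.of_le (n := ∞) (by simp)
  have h := isInvertible_mfderivWithin_extChartAt_symm hy
  rwa [I.range_eq_univ, mfderivWithin_univ] at h

theorem chartMetric_apply (g : BilinField I X) (x₀ : X) (y u v : V) :
    chartMetric g x₀ y u v = g ((extChartAt I x₀).symm y)
      (mfderiv 𝓘(ℝ, V) I (extChartAt I x₀).symm y u)
      (mfderiv 𝓘(ℝ, V) I (extChartAt I x₀).symm y v) := rfl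

theorem trivializationAt_bilin_snd [IsManifold I ∞ X] [I.Boundaryless] (g : BilinField I X)
    {x₀ x : X} (hx : x ∈ (extChartAt I x₀).source) :
    (trivializationAt (V →L[ℝ] V →L[ℝ] ℝ)
      (fun x : X ↦ TangentSpace I x →L[ℝ] TangentSpace I x →L[ℝ] ℝ) x₀ ⟨x, g x⟩).2 =
      chartMetric g x₀ (extChartAt I x₀ x) := by
  have : IsManifold I 1 X := IsManifold.of_le (n := ∞) (by simp)
  have hx' : x ∈ (chartAt H x₀).source := by rwa [extChartAt_source] at hx
  ext u v
  rw [hom_trivializationAt_apply]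
  have h1 := inCoordinates_apply_eq₂ (F₁ := V) (E₁ := fun x : X ↦ TangentSpace I x)
    (F₂ := V) (E₂ := fun x : X ↦ TangentSpace I x) (F₃ := ℝ) (E₃ := fun _ : X ↦ ℝ)
    (ϕ := g x) (v := u) (w := v) (x₀ := x₀) (x := x) (by simpa using hx') (by simpa using hx')
    (by simp)
  refine h1.trans ?_
  have h2 := TangentBundle.symmL_trivializationAt (I := I) hx'
  rw [I.range_eq_univ, mfderivWithin_univ] at h2
  have h3 : ∀ u : V, (trivializationAt V (TangentSpace I) x₀).symm x u =
      (mfderiv 𝓘(ℝ, V) I (extChartAt I x₀).symm (extChartAt I x₀ x) : V →L[ℝ] V) u := by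
    intro u
    have := congrArg (fun l : V →L[ℝ] V ↦ l u) h2
    rw [← Trivialization.symmL_apply (R := ℝ) _ (by simpa using hx')]
    exact this
  rw [h3, h3, chartMetric_apply, (extChartAt I x₀).left_inv hx]
  simp

/-- Smoothness of a section of the bundle of forms is tested in its trivializations, and by
`trivializationAt_bilin_snd` these give the chart components. -/
theorem smoothBilinOn_iff [IsManifold I ∞ X] [I.Boundaryless] {g : BilinField I X} {s : Set X}
    (hs : IsOpen s) : SmoothBilinOn g s ↔ ∀ (x₀ : X) (y : V), y ∈ (extChartAt I x₀).target →
      (extChartAt I x₀).symm y ∈ s → ContDiffAt ℝ ∞ (chartMetric g x₀) y := by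
  have : IsManifold I 1 X := IsManifold.of_le (n := ∞) (by simp)
  have key : ∀ (x₀ x : X), x ∈ (extChartAt I x₀).source →
      (ContMDiffAt I (I.prod 𝓘(ℝ, V →L[ℝ] V →L[ℝ] ℝ)) ∞
        (fun x ↦ TotalSpace.mk' (V →L[ℝ] V →L[ℝ] ℝ)
          (E := fun x : X ↦ TangentSpace I x →L[ℝ] TangentSpace I x →L[ℝ] ℝ) x (g x)) x ↔
        ContMDiffAt I 𝓘(ℝ, V →L[ℝ] V →L[ℝ] ℝ) ∞
          (fun x ↦ chartMetric g x₀ (extChartAt I x₀ x)) x) := by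
    intro x₀ x hx
    rw [(trivializationAt (V →L[ℝ] V →L[ℝ] ℝ)
      (fun x : X ↦ TangentSpace I x →L[ℝ] TangentSpace I x →L[ℝ] ℝ) x₀).contMDiffAt_section_iff
      (by rw [extChartAt_source] at hx; simpa using hx)]
    refine Filter.EventuallyEq.contMDiffAt_iff ?_
    filter_upwards [(isOpen_extChartAt_source (I := I) x₀).mem_nhds hx] with z hz
    exact trivializationAt_bilin_snd g hz
  constructor
  · intro h x₀ y hy hys
    have h1 := (key x₀ _ ((extChartAt I x₀).map_target hy)).1 ((h _ hys).contMDiffAt (hs.mem_nhds hys))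
    have h2 := h1.comp y (contMDiffAt_extChartAt_symm hy)
    refine (h2.congr_of_eventuallyEq ?_).contDiffAt
    filter_upwards [(isOpen_extChartAt_target (I := I) x₀).mem_nhds hy] with z hz
    simp only [Function.comp_apply]
    rw [(extChartAt I x₀).right_inv hz]
  · intro h x hx
    refine ((key x x (mem_extChartAt_source x)).2 ?_).contMDiffWithinAt
    have h1 := h x (extChartAt I x x) (mem_extChartAt_target x) (by simpa using hx)
    exact h1.contMDiffAt.comp x contMDiffAt_extChartAt

theorem mfderiv_extChartAt_symm_self [IsManifold I ∞ X] [I.Boundaryless] (x : X) (v : V) :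
    (mfderiv 𝓘(ℝ, V) I (extChartAt I x).symm (extChartAt I x x) : V →L[ℝ] V) v = v := by
  have : IsManifold I 1 X := IsManifold.of_le (n := ∞) (by simp)
  have h := mfderivWithin_range_extChartAt_symm (I := I) (x := x)
  rw [I.range_eq_univ, mfderivWithin_univ] at h
  exact congrArg (fun l : V →L[ℝ] V ↦ l v) h

/-- The preferred chart at `x` has the identity as derivative at `x`, because the tangent space at
`x` is the model space through that chart. -/
theorem chartMetric_self [IsManifold I ∞ X] [I.Boundaryless] (g : BilinField I X) (x : X) :
    chartMetric g x (extChartAt I x x) = (g x : V →L[ℝ] V →L[ℝ] ℝ) := by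
  ext u v
  have h : (g ((extChartAt I x).symm (extChartAt I x x)) : V →L[ℝ] V →L[ℝ] ℝ) = g x := by
    rw [extChartAt_to_inv]
  rw [chartMetric_apply]
  refine Eq.trans ?_ (congrArg (fun B : V →L[ℝ] V →L[ℝ] ℝ ↦ B u v) h)
  exact congrArg₂ (fun a b : V ↦
    (g ((extChartAt I x).symm (extChartAt I x x)) : V →L[ℝ] V →L[ℝ] ℝ) a b)
    (mfderiv_extChartAt_symm_self x u) (mfderiv_extChartAt_symm_self x v)

theorem acceleration_eq_flatAcceleration (g : BilinField I X) (c : ℝ → X) (τ : ℝ) :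
    (acceleration g c τ : V) =
      flatAcceleration (chartMetric g (c τ)) (fun σ ↦ extChartAt I (c τ) (c σ)) τ := rfl

/-- Functoriality of pullback applied to `f ∘ κ⁻¹ = κ'⁻¹ ∘ (κ' ∘ f ∘ κ⁻¹)`. It holds on a
neighbourhood of `y`, as is needed in order to differentiate the components. -/
theorem chartMetric_pullbackBilin_eventuallyEq [IsManifold I ∞ X] [I.Boundaryless]
    [IsManifold I' ∞ X'] [I'.Boundaryless] {f : X → X'} (g : BilinField I' X') {x₀ : X} {x₁ : X'}
    {y : V} (hy : y ∈ (extChartAt I x₀).target)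
    (hf : ContMDiffAt I I' ∞ f ((extChartAt I x₀).symm y))
    (hx₁ : f ((extChartAt I x₀).symm y) ∈ (extChartAt I' x₁).source) :
    chartMetric (pullbackBilin (I := I) f g) x₀ =ᶠ[𝓝 y] fun z ↦
      bilinPullback (fderiv ℝ (extChartAt I' x₁ ∘ f ∘ (extChartAt I x₀).symm) z)
        (chartMetric g x₁ ((extChartAt I' x₁ ∘ f ∘ (extChartAt I x₀).symm) z)) := by
  have : IsManifold I 1 X := IsManifold.of_le (n := ∞) (by simp)
  have : IsManifold I' 1 X' := IsManifold.of_le (n := ∞) (by simp)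
  set κ := extChartAt I x₀
  set κ' := extChartAt I' x₁
  have hκ : ContMDiffAt 𝓘(ℝ, V) I ∞ κ.symm y := contMDiffAt_extChartAt_symm hy
  have h1 : ∀ᶠ z in 𝓝 y, ContMDiffAt I I' 1 f (κ.symm z) :=
    hκ.continuousAt.eventually (contMDiffAt_iff_contMDiffAt_nhds (by simp) |>.1 (hf.of_le (by simp)))
  have h2 : ∀ᶠ z in 𝓝 y, f (κ.symm z) ∈ κ'.source :=
    (hf.continuousAt.comp hκ.continuousAt).eventually
      ((isOpen_extChartAt_source (I := I') x₁).mem_nhds hx₁)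
  filter_upwards [h1, h2.eventually_nhds, (isOpen_extChartAt_target (I := I) x₀).mem_nhds hy]
    with z hz1 hz2 hz3
  have hzκ : MDifferentiableAt 𝓘(ℝ, V) I κ.symm z :=
    (contMDiffAt_extChartAt_symm hz3).mdifferentiableAt (by simp)
  have hzf : MDifferentiableAt I I' f (κ.symm z) := hz1.mdifferentiableAt (by simp)
  have hzκ' : MDifferentiableAt I' 𝓘(ℝ, V') κ' (f (κ.symm z)) :=
    (contMDiffAt_extChartAt_of_mem hz2.self_of_nhds).mdifferentiableAt (by simp)
  have hzκ's : MDifferentiableAt 𝓘(ℝ, V') I' κ'.symm ((κ' ∘ f ∘ κ.symm) z) :=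
    (contMDiffAt_extChartAt_symm (κ'.map_source hz2.self_of_nhds)).mdifferentiableAt (by simp)
  have hθ : MDifferentiableAt 𝓘(ℝ, V) 𝓘(ℝ, V') (κ' ∘ f ∘ κ.symm) z :=
    hzκ'.comp z (hzf.comp z hzκ)
  have e1 : pullbackBilin (I := 𝓘(ℝ, V)) (f ∘ κ.symm) g z =
      pullbackBilin (I := 𝓘(ℝ, V)) κ.symm (pullbackBilin (I := I) f g) z :=
    pullbackBilin_comp g hzf hzκ
  have e2 : (f ∘ κ.symm) =ᶠ[𝓝 z] κ'.symm ∘ (κ' ∘ f ∘ κ.symm) := by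
    filter_upwards [hz2] with w hw
    exact (κ'.left_inv hw).symm
  have e3 : (pullbackBilin (I := 𝓘(ℝ, V)) (f ∘ κ.symm) g z : V →L[ℝ] V →L[ℝ] ℝ) =
    pullbackBilin (I := 𝓘(ℝ, V)) (κ'.symm ∘ (κ' ∘ f ∘ κ.symm)) g z := pullbackBilin_congr g e2
  have e4 : pullbackBilin (I := 𝓘(ℝ, V)) (κ'.symm ∘ (κ' ∘ f ∘ κ.symm)) g z =
      pullbackBilin (I := 𝓘(ℝ, V)) (κ' ∘ f ∘ κ.symm)
        (pullbackBilin (I := 𝓘(ℝ, V')) κ'.symm g) z :=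
    pullbackBilin_comp g hzκ's hθ
  have e5 : (pullbackBilin (I := 𝓘(ℝ, V)) (κ' ∘ f ∘ κ.symm)
        (pullbackBilin (I := 𝓘(ℝ, V')) κ'.symm g) z : V →L[ℝ] V →L[ℝ] ℝ) =
      bilinPullback (fderiv ℝ (κ' ∘ f ∘ κ.symm) z)
        (chartMetric g x₁ ((κ' ∘ f ∘ κ.symm) z)) := by
    have : (mfderiv 𝓘(ℝ, V) 𝓘(ℝ, V') (κ' ∘ f ∘ κ.symm) z : V →L[ℝ] V') =
      fderiv ℝ (κ' ∘ f ∘ κ.symm) z := mfderiv_eq_fderiv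
    exact congrArg (fun l : V →L[ℝ] V' ↦ bilinPullback l
      (chartMetric g x₁ ((κ' ∘ f ∘ κ.symm) z))) this
  exact e1.symm.trans (e3.trans (e4.trans e5))

/-- Naturality of the covariant acceleration under local diffeomorphisms. -/
theorem acceleration_comp [IsManifold I ∞ X] [I.Boundaryless] [IsManifold I' ∞ X']
    [I'.Boundaryless] {f : X → X'} {g : BilinField I' X'} {c : ℝ → X} {τ : ℝ}
    (hf : ContMDiffAt I I' ∞ f (c τ)) (hfi : (mfderiv I I' f (c τ)).IsInvertible)
    (hc : ContMDiffAt 𝓘(ℝ, ℝ) I ∞ c τ)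
    (hg : ContDiffAt ℝ ∞ (chartMetric g (f (c τ))) (extChartAt I' (f (c τ)) (f (c τ))))
    (hs : ∀ u v, g (f (c τ)) u v = g (f (c τ)) v u) (hi : (g (f (c τ))).IsInvertible) :
    acceleration g (fun σ ↦ f (c σ)) τ =
      mfderiv I I' f (c τ) (acceleration (pullbackBilin (I := I) f g) c τ) := by
  have : IsManifold I 1 X := IsManifold.of_le (n := ∞) (by simp)
  have : IsManifold I' 1 X' := IsManifold.of_le (n := ∞) (by simp)
  set κ := extChartAt I (c τ) with hκdef
  set κ' := extChartAt I' (f (c τ)) with hκ'def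
  have hyt : κ (c τ) ∈ κ.target := mem_extChartAt_target (c τ)
  have hinv : κ.symm (κ (c τ)) = c τ := extChartAt_to_inv (c τ)
  have hθ : ContDiffAt ℝ ∞ (κ' ∘ f ∘ κ.symm) (κ (c τ)) := by
    refine ContMDiffAt.contDiffAt ?_
    have h1 : ContMDiffAt 𝓘(ℝ, V) I ∞ κ.symm (κ (c τ)) := contMDiffAt_extChartAt_symm hyt
    have h2 : ContMDiffAt I 𝓘(ℝ, V') ∞ (κ' ∘ f) (c τ) :=
      ContMDiffAt.comp (c τ) contMDiffAt_extChartAt hf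
    exact ContMDiffAt.comp (g := κ' ∘ f) (κ (c τ)) (by rwa [hinv]) h1
  have hcc : ContDiffAt ℝ ∞ (fun σ ↦ κ (c σ)) τ :=
    ContMDiffAt.contDiffAt (ContMDiffAt.comp τ contMDiffAt_extChartAt hc)
  have hm : (mfderiv I I' f (c τ) : V →L[ℝ] V') = fderiv ℝ (κ' ∘ f ∘ κ.symm) (κ (c τ)) :=
    mfderiv_eq_fderiv_chart (hf.mdifferentiableAt (by simp))
  have hθv : (κ' ∘ f ∘ κ.symm) (κ (c τ)) = κ' (f (c τ)) := by simp [hinv]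
  have hself : chartMetric g (f (c τ)) (κ' (f (c τ))) = (g (f (c τ)) : V' →L[ℝ] V' →L[ℝ] ℝ) :=
    chartMetric_self g _
  have hG : chartMetric (pullbackBilin (I := I) f g) (c τ) =ᶠ[𝓝 (κ (c τ))] fun z ↦
      bilinPullback (fderiv ℝ (κ' ∘ f ∘ κ.symm) z)
        (chartMetric g (f (c τ)) ((κ' ∘ f ∘ κ.symm) z)) :=
    chartMetric_pullbackBilin_eventuallyEq g hyt (by rwa [hinv])
      (by rw [hinv]; exact mem_extChartAt_source _)
  have key := flatAcceleration_comp (V := V) (V' := V') (c := fun σ ↦ κ (c σ)) (τ := τ) hθ (by rw [← hm]; exact hfi)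
    hcc (G' := chartMetric g (f (c τ))) (by rw [hθv]; exact hg.differentiableAt (by simp))
    (by rw [hθv, hself]; exact hs) (by rw [hθv, hself]; exact hi) hG
  rw [← hm] at key
  -- The curve equals its image under the chart and back only while it stays in the chart domain;
  -- acceleration depends on the germ alone.
  have e : flatAcceleration (chartMetric g (f (c τ))) (fun σ ↦ κ' (f (c σ))) τ =
      flatAcceleration (chartMetric g (f (c τ))) ((κ' ∘ f ∘ κ.symm) ∘ fun σ ↦ κ (c σ)) τ := by
    refine flatAcceleration_congr ?_ Filter.EventuallyEq.rfl
    filter_upwards [hc.continuousAt.preimage_mem_nhds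
      ((isOpen_extChartAt_source (I := I) (c τ)).mem_nhds (mem_extChartAt_source _))] with σ hσ
    simp only [Function.comp_apply]
    rw [κ.left_inv hσ]
  exact e.trans key

end ManifoldBridge

/-! ### Linear algebra of forms with a signature -/

section Signature

theorem HasSignature.symm {V : Type*} [AddCommGroup V] [Module ℝ V] [TopologicalSpace V]
    {B : V →L[ℝ] V →L[ℝ] ℝ} {p q : ℕ} (h : HasSignature B p q) (u v : V) : B u v = B v u := by
  obtain ⟨b, h0, -, -⟩ := h
  have h1 : ∀ i j, B (b i) (b j) = B (b j) (b i) := by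
    intro i j
    by_cases hij : i = j
    · rw [hij]
    · rw [h0 i j hij, h0 j i (Ne.symm hij)]
  rw [← b.sum_repr u, ← b.sum_repr v]
  simp only [map_sum, map_smul, FunLike.coe_sum, Finset.sum_apply, smul_apply, smul_eq_mul,
    Finset.mul_sum]
  rw [Finset.sum_comm]
  refine Finset.sum_congr rfl fun i _ ↦ Finset.sum_congr rfl fun j _ ↦ ?_
  rw [h1]
  ring

theorem HasSignature.eq_zero {V : Type*} [AddCommGroup V] [Module ℝ V] [TopologicalSpace V]
    {B : V →L[ℝ] V →L[ℝ] ℝ} {p q : ℕ} (h : HasSignature B p q) {u : V} (hu : ∀ v, B u v = 0) :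
    u = 0 := by
  obtain ⟨b, h0, h1, h2⟩ := h
  have key : ∀ i, B u (b i) = b.repr u i * B (b i) (b i) := by
    intro i
    conv_lhs => rw [← b.sum_repr u]
    simp only [map_sum, map_smul, FunLike.coe_sum, Finset.sum_apply, smul_apply, smul_eq_mul]
    exact Finset.sum_eq_single i (fun j _ hj ↦ by rw [h0 j i hj, mul_zero]) (by simp)
  refine b.ext_elem fun i ↦ ?_
  have h3 := key i
  rw [hu] at h3
  rcases i with i | i
  · rw [h1] at h3; simpa using h3.symm
  · rw [h2] at h3; simpa using h3.symm

theorem HasSignature.isInvertible {V : Type*} [NormedAddCommGroup V] [NormedSpace ℝ V]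
    [FiniteDimensional ℝ V] {B : V →L[ℝ] V →L[ℝ] ℝ} {p q : ℕ} (h : HasSignature B p q) :
    B.IsInvertible := by
  have hinj : Function.Injective (B : V →ₗ[ℝ] V →L[ℝ] ℝ) := by
    rw [injective_iff_map_eq_zero]
    intro u hu
    refine h.eq_zero fun v ↦ ?_
    have : B u = 0 := hu
    rw [this]; rfl
  have hd : Module.finrank ℝ V = Module.finrank ℝ (V →L[ℝ] ℝ) := by
    rw [← (LinearMap.toContinuousLinearMap (𝕜 := ℝ) (E := V) (F' := ℝ)).finrank_eq]
    exact Subspace.dual_finrank_eq.symm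
  exact ⟨(LinearEquiv.ofInjectiveOfFinrankEq _ hinj hd).toContinuousLinearEquiv, by ext; rfl⟩

end Signature

/-! ### Velocity, equation of motion and smooth laws -/

section LawCurves

variable {V H : Type*} [NormedAddCommGroup V] [NormedSpace ℝ V] [TopologicalSpace H]
  {I : ModelWithCorners ℝ V H} {X : Type*} [TopologicalSpace X] [ChartedSpace H X]
  {V' H' : Type*} [NormedAddCommGroup V'] [NormedSpace ℝ V'] [TopologicalSpace H']
  {I' : ModelWithCorners ℝ V' H'} {X' : Type*} [TopologicalSpace X'] [ChartedSpace H' X']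

theorem acceleration_model (G : BilinField 𝓘(ℝ, V) V) (c : ℝ → V) (τ : ℝ) :
    (acceleration G c τ : V) = flatAcceleration (V := V) G c τ := by
  have he : (extChartAt 𝓘(ℝ, V) (c τ) : V → V) = id := by
    rw [extChartAt_model_space_eq_id]; rfl
  have hs : ((extChartAt 𝓘(ℝ, V) (c τ)).symm : V → V) = id := by
    rw [extChartAt_model_space_eq_id]; rfl
  have h : chartMetric G (c τ) = G := by
    unfold chartMetric
    rw [hs]
    funext y
    ext u v
    rw [pullbackBilin_apply, mfderiv_id]
    rfl
  rw [acceleration_eq_flatAcceleration, h, he]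
  rfl

theorem acceleration_congr (g : BilinField I X) {c c' : ℝ → X} {τ : ℝ} (h : c =ᶠ[𝓝 τ] c') :
    (acceleration g c τ : V) = (acceleration g c' τ : V) := by
  rw [acceleration_eq_flatAcceleration, acceleration_eq_flatAcceleration, h.eq_of_nhds]
  have h' : (fun σ ↦ extChartAt I (c' τ) (c σ)) =ᶠ[𝓝 τ] fun σ ↦ extChartAt I (c' τ) (c' σ) := by
    filter_upwards [h] with σ hσ
    rw [hσ]
  exact flatAcceleration_congr (V := V) h' Filter.EventuallyEq.rfl

theorem SmoothBilinOn.pullbackBilin [IsManifold I ∞ X] [I.Boundaryless]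
    [IsManifold I' ∞ X'] [I'.Boundaryless] {f : X → X'} {g : BilinField I' X'} {s : Set X}
    {s' : Set X'} (hs : IsOpen s) (hs' : IsOpen s') (hf : ContMDiffOn I I' ∞ f s)
    (hm : MapsTo f s s') (hg : SmoothBilinOn g s') :
    SmoothBilinOn (_root_.pullbackBilin (I := I) f g) s := by
  rw [smoothBilinOn_iff hs]
  rw [smoothBilinOn_iff hs'] at hg
  intro x₀ y hy hys
  have hfy := hf.contMDiffAt (hs.mem_nhds hys)
  set x₁ := f ((extChartAt I x₀).symm y) with hx₁
  refine ContDiffAt.congr_of_eventuallyEq ?_ (chartMetric_pullbackBilin_eventuallyEq g hy hfy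
    (mem_extChartAt_source (I := I') x₁))
  have hθ : ContDiffAt ℝ ∞ (extChartAt I' x₁ ∘ f ∘ (extChartAt I x₀).symm) y := by
    refine ContMDiffAt.contDiffAt ?_
    exact contMDiffAt_extChartAt.comp y (hfy.comp y (contMDiffAt_extChartAt_symm hy))
  have hB : ContDiffAt ℝ ∞ (chartMetric g x₁)
      ((extChartAt I' x₁ ∘ f ∘ (extChartAt I x₀).symm) y) := by
    refine hg x₁ _ (mem_extChartAt_target x₁) ?_
    rw [Function.comp_apply, Function.comp_apply, ← hx₁, extChartAt_to_inv]
    exact hm hys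
  exact ContDiffWithinAt.bilinPullback (hθ.fderiv_right (m := ∞) (by simp)) (hB.comp y hθ)

/-- The velocity of a curve. -/
noncomputable def curveVelocity (I : ModelWithCorners ℝ V H) (c : ℝ → X) (τ : ℝ) :
    TangentSpace I (c τ) :=
  (mfderiv 𝓘(ℝ, ℝ) I c τ : ℝ →L[ℝ] V) (1 : ℝ)

theorem curveVelocity_congr {c c' : ℝ → X} {τ : ℝ} (h : c =ᶠ[𝓝 τ] c') :
    (curveVelocity I c τ : V) = (curveVelocity I c' τ : V) := by
  have h1 : (mfderiv 𝓘(ℝ, ℝ) I c τ : ℝ →L[ℝ] V) = mfderiv 𝓘(ℝ, ℝ) I c' τ := h.mfderiv_eq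
  exact congrArg (fun l : ℝ →L[ℝ] V ↦ l 1) h1

theorem curveVelocity_comp {f : X → X'} {c : ℝ → X} {τ : ℝ}
    (hf : MDifferentiableAt I I' f (c τ)) (hc : MDifferentiableAt 𝓘(ℝ, ℝ) I c τ) :
    curveVelocity I' (fun σ ↦ f (c σ)) τ = mfderiv I I' f (c τ) (curveVelocity I c τ) := by
  have h := mfderiv_comp τ hf hc
  exact congrArg (fun l : ℝ →L[ℝ] V' ↦ l 1) h

theorem curveVelocity_model (c : ℝ → V) (τ : ℝ) : (curveVelocity 𝓘(ℝ, V) c τ : V) = deriv c τ := by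
  have h : (mfderiv 𝓘(ℝ, ℝ) 𝓘(ℝ, V) c τ : ℝ →L[ℝ] V) = fderiv ℝ c τ := mfderiv_eq_fderiv
  exact congrArg (fun l : ℝ →L[ℝ] V ↦ l 1) h

/-- The curve `c` satisfies the equation of motion `∇_{c'} c' = A (c, c')` at `τ`. -/
def ObeysLawAt (g : BilinField I X) (A : ∀ z : X, TangentSpace I z → TangentSpace I z)
    (c : ℝ → X) (τ : ℝ) : Prop :=
  acceleration g c τ = A (c τ) (curveVelocity I c τ)

theorem obeysLawAt_congr (g : BilinField I X)
    (A : ∀ z : X, TangentSpace I z → TangentSpace I z) {c c' : ℝ → X} {τ : ℝ}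
    (h : c =ᶠ[𝓝 τ] c') : ObeysLawAt g A c τ ↔ ObeysLawAt g A c' τ := by
  have h1 := acceleration_congr g h
  have h2 := curveVelocity_congr (I := I) h
  -- The values of `A` at `c τ` and `c' τ` have different types. Comparing them in the model space,
  -- with variable base points, allows substitution.
  have h3 : ∀ (z z' : X) (_ : z = z') (v v' : V) (_ : v = v'), (A z v : V) = (A z' v' : V) := by
    rintro z z' rfl v v' rfl
    rfl
  have h4 := h3 _ _ h.eq_of_nhds _ _ h2
  exact ⟨fun h' ↦ (h1.symm.trans h').trans h4, fun h' ↦ (h1.trans h').trans h4.symm⟩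

/-- The hypotheses under which the equation of motion `∇_{c'} c' = A (c, c')` is a smooth second
order differential equation on `Ω`. -/
structure IsSmoothLaw [IsManifold I ∞ X] (g : BilinField I X) (A : ∀ z : X, TangentSpace I z → TangentSpace I z)
    (Ω : Set X) : Prop where
  isOpen : IsOpen Ω
  smooth_metric : ∀ (x₀ : X) (y : V), y ∈ (extChartAt I x₀).target →
    (extChartAt I x₀).symm y ∈ Ω → ContDiffAt ℝ ∞ (chartMetric g x₀) y
  symm : ∀ z ∈ Ω, ∀ u v, g z u v = g z v u
  isInvertible : ∀ z ∈ Ω, (g z).IsInvertible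
  smooth_law : ContMDiffOn I.tangent I.tangent ∞
    (fun v : TangentBundle I X ↦ (⟨v.1, A v.1 v.2⟩ : TangentBundle I X)) {v | v.1 ∈ Ω}

/-- The acceleration law `A` in the preferred chart around `x₀`. -/
noncomputable def lawChart (A : ∀ z : X, TangentSpace I z → TangentSpace I z) (x₀ : X)
    (z : V × V) : V :=
  mfderiv I 𝓘(ℝ, V) (extChartAt I x₀) ((extChartAt I x₀).symm z.1)
    (A ((extChartAt I x₀).symm z.1) (mfderiv 𝓘(ℝ, V) I (extChartAt I x₀).symm z.1 z.2))

/-- The part of the domain of the preferred chart around `x₀` over which `Ω` lies. -/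
def chartDomain (I : ModelWithCorners ℝ V H) (x₀ : X) (Ω : Set X) : Set V :=
  (extChartAt I x₀).target ∩ (extChartAt I x₀).symm ⁻¹' Ω

theorem isOpen_chartDomain [I.Boundaryless] (x₀ : X) {Ω : Set X} (hΩ : IsOpen Ω) :
    IsOpen (chartDomain I x₀ Ω) :=
  (continuousOn_extChartAt_symm x₀).isOpen_inter_preimage (isOpen_extChartAt_target x₀) hΩ

end LawCurves

/-! ### The equation of motion as a smooth ordinary differential equation -/

section LawOde

variable {V H : Type*} [NormedAddCommGroup V] [NormedSpace ℝ V] [TopologicalSpace H]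
  {I : ModelWithCorners ℝ V H} {X : Type*} [TopologicalSpace X] [ChartedSpace H X]

/-- The charts of the tangent bundle consist of a chart and its derivative. This identifies the
smoothness of `A` as a map of the tangent bundle with the smoothness of `lawChart`. -/
theorem extChartAt_tangent_symm_apply [IsManifold I ∞ X] [I.Boundaryless] (x₀ : X) {z : V × V}
    (hz : z.1 ∈ (extChartAt I x₀).target) :
    (extChartAt I.tangent (⟨x₀, (0 : V)⟩ : TangentBundle I X)).symm z =
      ⟨(extChartAt I x₀).symm z.1,
        (mfderiv 𝓘(ℝ, V) I (extChartAt I x₀).symm z.1 : V →L[ℝ] V) z.2⟩ := by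
  have : IsManifold I 1 X := IsManifold.of_le (n := ∞) (by simp)
  have h1 := FiberBundle.extChartAt (IB := I) (F := V) (E := (TangentSpace I : X → Type _))
    (⟨x₀, (0 : V)⟩ : TangentBundle I X)
  have hs := (extChartAt I x₀).map_target hz
  have hs' : (extChartAt I x₀).symm z.1 ∈ (chartAt H x₀).source := by
    rwa [extChartAt_source] at hs
  have h2 := TangentBundle.symmL_trivializationAt (I := I) hs'
  rw [I.range_eq_univ, mfderivWithin_univ, (extChartAt I x₀).right_inv hz] at h2
  have h3 : (extChartAt I.tangent (⟨x₀, (0 : V)⟩ : TangentBundle I X)).symm z =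
      (trivializationAt V (TangentSpace I) x₀).toPartialEquiv.symm
        ((extChartAt I x₀).symm z.1, z.2) := by
    rw [ModelWithCorners.tangent, h1]
    rfl
  rw [h3]
  have h4 := (trivializationAt V (TangentSpace I) x₀).mk_symm
    (b := (extChartAt I x₀).symm z.1) (by simpa using hs') z.2
  refine h4.symm.trans ?_
  rw [← Trivialization.symmL_apply (R := ℝ) _ (by simpa using hs'), h2]
  rfl

theorem extChartAt_tangent_apply_snd [IsManifold I ∞ X] [I.Boundaryless] (x₀ : X) {x : X}
    (hx : x ∈ (extChartAt I x₀).source) (u : TangentSpace I x) :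
    (extChartAt I.tangent (⟨x₀, (0 : V)⟩ : TangentBundle I X) ⟨x, u⟩).2 =
      mfderiv I 𝓘(ℝ, V) (extChartAt I x₀) x u := by
  have : IsManifold I 1 X := IsManifold.of_le (n := ∞) (by simp)
  have h1 := FiberBundle.extChartAt (IB := I) (F := V) (E := (TangentSpace I : X → Type _))
    (⟨x₀, (0 : V)⟩ : TangentBundle I X)
  have hx' : x ∈ (chartAt H x₀).source := by rwa [extChartAt_source] at hx
  have h2 := TangentBundle.continuousLinearMapAt_trivializationAt (I := I) hx'
  rw [ModelWithCorners.tangent, h1]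
  have h3 := congrArg (fun l ↦ l u) h2
  refine Eq.trans ?_ h3
  rw [Trivialization.continuousLinearMapAt_apply, Trivialization.linearMapAt_apply,
    if_pos (by simpa using hx')]
  rfl

theorem contDiffOn_lawChart [IsManifold I ∞ X] [I.Boundaryless] {g : BilinField I X}
    {A : ∀ z : X, TangentSpace I z → TangentSpace I z} {Ω : Set X} (hL : IsSmoothLaw g A Ω)
    (x₀ : X) : ContDiffOn ℝ ∞ (lawChart A x₀) (chartDomain I x₀ Ω ×ˢ univ) := by
  have : IsManifold I 1 X := IsManifold.of_le (n := ∞) (by simp)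
  have hM : IsManifold I.tangent ∞ (TangentBundle I X) := inferInstance
  set q : TangentBundle I X := ⟨x₀, (0 : V)⟩ with hq
  have ht : chartDomain I x₀ Ω ×ˢ univ ⊆ (extChartAt I.tangent q).target := by
    rintro ⟨y, v⟩ ⟨⟨hy, -⟩, -⟩
    have h1 := FiberBundle.extChartAt_target (IB := I) (F := V)
      (E := (TangentSpace I : X → Type _)) q
    rw [ModelWithCorners.tangent, h1]
    refine ⟨⟨hy, ?_⟩, mem_univ _⟩
    have := (extChartAt I x₀).map_target hy
    rw [extChartAt_source] at this
    simpa using this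
  have h1 : ContMDiffOn 𝓘(ℝ, V × V) I.tangent ∞ (extChartAt I.tangent q).symm
      (chartDomain I x₀ Ω ×ˢ univ) := (contMDiffOn_extChartAt_symm q).mono ht
  have h2 : ContMDiffOn 𝓘(ℝ, V × V) I.tangent ∞ (fun z : V × V ↦
      (⟨(extChartAt I x₀).symm z.1, A ((extChartAt I x₀).symm z.1)
        (mfderiv 𝓘(ℝ, V) I (extChartAt I x₀).symm z.1 z.2)⟩ : TangentBundle I X))
      (chartDomain I x₀ Ω ×ˢ univ) := by
    refine (hL.smooth_law.comp h1 ?_).congr ?_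
    · rintro z ⟨hz, -⟩
      change ((extChartAt I.tangent q).symm z).1 ∈ Ω
      rw [hq, extChartAt_tangent_symm_apply x₀ hz.1]
      exact hz.2
    · rintro z ⟨hz, -⟩
      simp only [Function.comp_apply]
      rw [hq, extChartAt_tangent_symm_apply x₀ hz.1]
  have h3 : ContMDiffOn 𝓘(ℝ, V × V) 𝓘(ℝ, V × V) ∞ (fun z : V × V ↦ extChartAt I.tangent q
      (⟨(extChartAt I x₀).symm z.1, A ((extChartAt I x₀).symm z.1)
        (mfderiv 𝓘(ℝ, V) I (extChartAt I x₀).symm z.1 z.2)⟩ : TangentBundle I X))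
      (chartDomain I x₀ Ω ×ˢ univ) := by
    refine (contMDiffOn_extChartAt (I := I.tangent) (x := q)).comp h2 ?_
    rintro z ⟨hz, -⟩
    have := (extChartAt I x₀).map_target hz.1
    rw [extChartAt_source] at this
    rw [mem_preimage, TangentBundle.mem_chart_source_iff]
    exact this
  refine ((contDiff_snd.comp_contDiffOn h3.contDiffOn)).congr ?_
  rintro z ⟨hz, -⟩
  exact (extChartAt_tangent_apply_snd x₀ ((extChartAt I x₀).map_target hz.1) _).symm

/-- The first order system equivalent to the equation of motion, in the preferred chart. -/
noncomputable def lawField (g : BilinField I X)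
    (A : ∀ z : X, TangentSpace I z → TangentSpace I z) (x₀ : X) (z : V × V) : V × V :=
  (z.2, lawChart A x₀ z -
    (chartMetric g x₀ z.1).inverse (christoffelForm (chartMetric g x₀) z.1 z.2 z.2))

theorem isInvertible_chartMetric [IsManifold I ∞ X] [I.Boundaryless] {g : BilinField I X}
    {A : ∀ z : X, TangentSpace I z → TangentSpace I z} {Ω : Set X} (hL : IsSmoothLaw g A Ω)
    {x₀ : X} {y : V} (hy : y ∈ chartDomain I x₀ Ω) : (chartMetric g x₀ y).IsInvertible := by
  obtain ⟨e, he⟩ := isInvertible_mfderiv_extChartAt_symm' (I := I) hy.1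
  obtain ⟨b, hb⟩ := hL.isInvertible _ hy.2
  let e' : V ≃L[ℝ] V := e
  let b' : V ≃L[ℝ] V →L[ℝ] ℝ := b
  refine ⟨e'.trans (b'.trans (e'.symm.arrowCongr (ContinuousLinearEquiv.refl ℝ ℝ))), ?_⟩
  ext u v
  rw [chartMetric_apply, ← he, ← hb]
  simp only [ContinuousLinearEquiv.coe_coe, ContinuousLinearEquiv.trans_apply,
    ContinuousLinearEquiv.arrowCongr_apply, ContinuousLinearEquiv.symm_symm,
    ContinuousLinearEquiv.refl_apply]
  rfl

theorem ContDiffAt.fderiv_fst_apply {V N : Type*} [NormedAddCommGroup V] [NormedSpace ℝ V]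
    [NormedAddCommGroup N] [NormedSpace ℝ N] {G : V → N} {u : V × V → V} {z : V × V}
    (hG : ContDiffAt ℝ ∞ G z.1) (hu : ContDiffAt ℝ ∞ u z) :
    ContDiffAt ℝ ∞ (fun z : V × V ↦ fderiv ℝ G z.1 (u z)) z :=
  (ContDiffAt.comp (g := fderiv ℝ G) z (hG.fderiv_right (m := ∞) (by simp))
    contDiffAt_fst).clm_apply hu

theorem contDiffOn_christoffelForm {V : Type*} [NormedAddCommGroup V] [NormedSpace ℝ V]
    [FiniteDimensional ℝ V] {G : V → V →L[ℝ] V →L[ℝ] ℝ} {s : Set (V × V)}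
    (hG : ∀ z ∈ s, ContDiffAt ℝ ∞ G z.1) :
    ContDiffOn ℝ ∞ (fun z : V × V ↦ christoffelForm G z.1 z.2 z.2) s := by
  refine contDiffOn_clm_apply.2 fun w z hz ↦ ContDiffAt.contDiffWithinAt ?_
  simp only [christoffelForm_apply]
  have hv : ContDiffAt ℝ ∞ (fun z : V × V ↦ z.2) z := contDiffAt_snd
  have hw : ContDiffAt ℝ ∞ (fun _ : V × V ↦ w) z := contDiffAt_const
  have h1 := (((hG z hz).fderiv_fst_apply hv).clm_apply hv).clm_apply hw
  have h2 := (((hG z hz).fderiv_fst_apply hw).clm_apply hv).clm_apply hv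
  exact contDiffAt_const.mul ((h1.add h1).sub h2)

theorem contDiffOn_lawField [FiniteDimensional ℝ V] [IsManifold I ∞ X] [I.Boundaryless]
    {g : BilinField I X} {A : ∀ z : X, TangentSpace I z → TangentSpace I z} {Ω : Set X}
    (hL : IsSmoothLaw g A Ω) (x₀ : X) :
    ContDiffOn ℝ ∞ (lawField g A x₀) (chartDomain I x₀ Ω ×ˢ univ) := by
  have : CompleteSpace V := FiniteDimensional.complete ℝ V
  refine contDiffOn_snd.prodMk ((contDiffOn_lawChart hL x₀).sub ?_)
  have hG : ∀ z ∈ chartDomain I x₀ Ω ×ˢ (univ : Set V),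
      ContDiffAt ℝ ∞ (chartMetric g x₀) z.1 := fun z hz ↦
    hL.smooth_metric x₀ z.1 hz.1.1 hz.1.2
  have hC : ContDiffOn ℝ ∞ (fun z : V × V ↦
      christoffelForm (chartMetric g x₀) z.1 z.2 z.2) (chartDomain I x₀ Ω ×ˢ univ) := 
    contDiffOn_christoffelForm hG
  have hi : ContDiffOn ℝ ∞ (fun z : V × V ↦ (chartMetric g x₀ z.1).inverse)
      (chartDomain I x₀ Ω ×ˢ univ) := fun z hz ↦
    ContDiffAt.contDiffWithinAt (ContDiffAt.comp (g := ContinuousLinearMap.inverse) z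
      (isInvertible_chartMetric hL hz.1).contDiffAt_map_inverse
      (ContDiffAt.comp z (hG z hz) contDiffAt_fst))
  exact hi.clm_apply hC

/-- By naturality, the inverse chart carries the flat acceleration of `y` to the acceleration of the
curve. Its derivative `L` is invertible, with inverse `L'`, so the equation of motion may be
compared after applying `L'`. -/
theorem obeysLawAt_chart_iff [IsManifold I ∞ X] [I.Boundaryless]
    {g : BilinField I X} {A : ∀ z : X, TangentSpace I z → TangentSpace I z} {Ω : Set X}
    (hL : IsSmoothLaw g A Ω) {x₀ : X} {y : ℝ → V} {τ : ℝ} (hy : ContDiffAt ℝ ∞ y τ)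
    (hm : y τ ∈ chartDomain I x₀ Ω) :
    ObeysLawAt g A (fun σ ↦ (extChartAt I x₀).symm (y σ)) τ ↔
      deriv (deriv y) τ = (lawField g A x₀ (y τ, deriv y τ)).2 := by
  have : IsManifold I 1 X := IsManifold.of_le (n := ∞) (by simp)
  set κ := extChartAt I x₀ with hκ
  have hκs : ContMDiffAt 𝓘(ℝ, V) I ∞ κ.symm (y τ) := contMDiffAt_extChartAt_symm hm.1
  have hsm : ContDiffAt ℝ ∞ (chartMetric g (κ.symm (y τ)))
      (extChartAt I (κ.symm (y τ)) (κ.symm (y τ))) :=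
    hL.smooth_metric _ _ (mem_extChartAt_target _) (by rw [extChartAt_to_inv]; exact hm.2)
  have hinv := isInvertible_mfderiv_extChartAt_symm' (I := I) hm.1
  have h1 := acceleration_comp (I := 𝓘(ℝ, V)) (I' := I) (c := y) (τ := τ) (g := g) hκs hinv
    hy.contMDiffAt hsm (hL.symm _ hm.2) (hL.isInvertible _ hm.2)
  have h2 := acceleration_model (pullbackBilin (I := 𝓘(ℝ, V)) κ.symm g) y τ
  have h3 : curveVelocity I (fun σ ↦ κ.symm (y σ)) τ =
      mfderiv 𝓘(ℝ, V) I κ.symm (y τ) (curveVelocity 𝓘(ℝ, V) y τ) :=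
    curveVelocity_comp (hκs.mdifferentiableAt (by simp))
      (hy.contMDiffAt.mdifferentiableAt (by simp))
  let L : V →L[ℝ] V := mfderiv 𝓘(ℝ, V) I κ.symm (y τ)
  let L' : V →L[ℝ] V := mfderiv I 𝓘(ℝ, V) κ (κ.symm (y τ))
  have hLL' : ∀ v, L (L' v) = v := by
    intro v
    have h := mfderivWithin_extChartAt_symm_comp_mfderiv_extChartAt (I := I) hm.1
    rw [I.range_eq_univ, mfderivWithin_univ] at h
    exact congrArg (fun l : V →L[ℝ] V ↦ l v) h
  have hL'L : ∀ v, L' (L v) = v := by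
    intro v
    have h := mfderiv_extChartAt_comp_mfderivWithin_extChartAt_symm (I := I) hm.1
    rw [I.range_eq_univ, mfderivWithin_univ] at h
    exact congrArg (fun l : V →L[ℝ] V ↦ l v) h
  have h1' : (acceleration g (fun σ ↦ κ.symm (y σ)) τ : V) =
      L (flatAcceleration (chartMetric g x₀) y τ) := h1.trans (congrArg L h2)
  have h3' : (curveVelocity I (fun σ ↦ κ.symm (y σ)) τ : V) = L (deriv y τ) :=
    h3.trans (congrArg L (curveVelocity_model y τ))
  have h4 : ObeysLawAt g A (fun σ ↦ κ.symm (y σ)) τ ↔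
      L (flatAcceleration (chartMetric g x₀) y τ) = (A (κ.symm (y τ)) (L (deriv y τ)) : V) := by
    have h5 : (A (κ.symm (y τ)) (curveVelocity I (fun σ ↦ κ.symm (y σ)) τ) : V) =
      A (κ.symm (y τ)) (L (deriv y τ)) := congrArg (A (κ.symm (y τ))) h3'
    exact ⟨fun h ↦ (h1'.symm.trans h).trans h5, fun h ↦ (h1'.trans h).trans h5.symm⟩
  have h6 : lawChart A x₀ (y τ, deriv y τ) = L' (A (κ.symm (y τ)) (L (deriv y τ))) := rfl
  rw [h4, lawField, h6]
  simp only [flatAcceleration]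
  rw [eq_sub_iff_add_eq]
  constructor
  · intro h
    rw [← h, hL'L]
  · intro h
    rw [h]
    exact hLL' _

/-- A smooth curve in `Ω` obeying the equation of motion. -/
structure IsLawCurve (g : BilinField I X) (A : ∀ z : X, TangentSpace I z → TangentSpace I z)
    (Ω : Set X) (c : ℝ → X) (J : Set ℝ) : Prop where
  smooth : ContMDiffOn 𝓘(ℝ, ℝ) I ∞ c J
  mem : ∀ τ ∈ J, c τ ∈ Ω
  obeys : ∀ τ ∈ J, ObeysLawAt g A c τ

theorem IsLawCurve.mono {g : BilinField I X} {A : ∀ z : X, TangentSpace I z → TangentSpace I z}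
    {Ω : Set X} {c : ℝ → X} {J J' : Set ℝ} (h : IsLawCurve g A Ω c J) (hJ : J' ⊆ J) :
    IsLawCurve g A Ω c J' :=
  ⟨h.smooth.mono hJ, fun τ hτ ↦ h.mem τ (hJ hτ), fun τ hτ ↦ h.obeys τ (hJ hτ)⟩

theorem IsLawCurve.chart_hasDerivAt [IsManifold I ∞ X] [I.Boundaryless] {g : BilinField I X}
    {A : ∀ z : X, TangentSpace I z → TangentSpace I z} {Ω : Set X} (hL : IsSmoothLaw g A Ω)
    {c : ℝ → X} {J : Set ℝ} (hJ : IsOpen J) (hc : IsLawCurve g A Ω c J) {x₀ : X} {τ : ℝ}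
    (hτ : τ ∈ J) (hs : c τ ∈ (extChartAt I x₀).source) :
    ContDiffAt ℝ ∞ (fun σ ↦ extChartAt I x₀ (c σ)) τ ∧
    HasDerivAt (fun σ ↦ (extChartAt I x₀ (c σ), deriv (fun σ ↦ extChartAt I x₀ (c σ)) σ))
      (lawField g A x₀ (extChartAt I x₀ (c τ), deriv (fun σ ↦ extChartAt I x₀ (c σ)) τ)) τ := by
  set κ := extChartAt I x₀ with hκ
  have hcτ : ContMDiffAt 𝓘(ℝ, ℝ) I ∞ c τ := hc.smooth.contMDiffAt (hJ.mem_nhds hτ)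
  have hy : ContDiffAt ℝ ∞ (fun σ ↦ κ (c σ)) τ :=
    ((contMDiffAt_extChartAt_of_mem hs).comp τ hcτ).contDiffAt
  have hinv : κ.symm (κ (c τ)) = c τ := κ.left_inv hs
  have hm : κ (c τ) ∈ chartDomain I x₀ Ω :=
    ⟨κ.map_source hs, by rw [mem_preimage, ← hκ, hinv]; exact hc.mem τ hτ⟩
  have hev : c =ᶠ[𝓝 τ] fun σ ↦ κ.symm (κ (c σ)) := by
    filter_upwards [hcτ.continuousAt.preimage_mem_nhds
      ((isOpen_extChartAt_source (I := I) x₀).mem_nhds hs)] with σ hσ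
    exact (κ.left_inv hσ).symm
  have h1 := (obeysLawAt_chart_iff hL hy hm).1 ((obeysLawAt_congr g A hev).1 (hc.obeys τ hτ))
  have hd2 : DifferentiableAt ℝ (deriv fun σ ↦ κ (c σ)) τ :=
    ((hy.fderiv_right (m := ∞) (by simp)).differentiableAt (by simp)).clm_apply
      (differentiableAt_const (1 : ℝ))
  refine ⟨hy, ?_⟩
  have h2 := (hy.differentiableAt (by simp)).hasDerivAt.prodMk hd2.hasDerivAt
  rw [h1] at h2
  exact h2

theorem deriv_chart_eq [IsManifold I ∞ X] {c : ℝ → X} {x₀ : X} {τ : ℝ}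
    (hc : MDifferentiableAt 𝓘(ℝ, ℝ) I c τ) (hs : c τ ∈ (extChartAt I x₀).source) :
    deriv (fun σ ↦ extChartAt I x₀ (c σ)) τ =
      mfderiv I 𝓘(ℝ, V) (extChartAt I x₀) (c τ) (curveVelocity I c τ) := by
  rw [← curveVelocity_model]
  exact curveVelocity_comp
    ((contMDiffAt_extChartAt_of_mem hs).mdifferentiableAt (by simp)) hc

/-- Position and velocity in the chart of `c τ` solve the same first order system, whose field is
smooth and so Lipschitz near the common initial value. -/
theorem IsLawCurve.eventuallyEq [FiniteDimensional ℝ V] [IsManifold I ∞ X] [I.Boundaryless]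
    {g : BilinField I X} {A : ∀ z : X, TangentSpace I z → TangentSpace I z} {Ω : Set X}
    (hL : IsSmoothLaw g A Ω) {c c' : ℝ → X} {J : Set ℝ} (hJ : IsOpen J)
    (hc : IsLawCurve g A Ω c J) (hc' : IsLawCurve g A Ω c' J) {τ : ℝ} (hτ : τ ∈ J)
    (h0 : c τ = c' τ) (h1 : deriv (fun σ ↦ extChartAt I (c τ) (c σ)) τ =
      deriv (fun σ ↦ extChartAt I (c τ) (c' σ)) τ) : c =ᶠ[𝓝 τ] c' := by
  have : CompleteSpace V := FiniteDimensional.complete ℝ V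
  set κ := extChartAt I (c τ) with hκ
  have hsrc := isOpen_extChartAt_source (I := I) (c τ)
  have hcs : ∀ᶠ σ in 𝓝 τ, c σ ∈ κ.source :=
    (hc.smooth.contMDiffAt (hJ.mem_nhds hτ)).continuousAt.preimage_mem_nhds
      (hsrc.mem_nhds (mem_extChartAt_source _))
  have hcs' : ∀ᶠ σ in 𝓝 τ, c' σ ∈ κ.source :=
    (hc'.smooth.contMDiffAt (hJ.mem_nhds hτ)).continuousAt.preimage_mem_nhds
      (hsrc.mem_nhds (by rw [← h0]; exact mem_extChartAt_source _))
  have hm : κ (c τ) ∈ chartDomain I (c τ) Ω :=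
    ⟨mem_extChartAt_target _, by rw [mem_preimage, extChartAt_to_inv]; exact hc.mem τ hτ⟩
  set z₀ : V × V := (κ (c τ), deriv (fun σ ↦ κ (c σ)) τ) with hz₀
  have hf : ContDiffAt ℝ 1 (lawField g A (c τ)) z₀ :=
    ((contDiffOn_lawField hL (c τ)).contDiffAt
      (((isOpen_chartDomain _ hL.isOpen).prod isOpen_univ).mem_nhds ⟨hm, mem_univ _⟩)).of_le
      (by simp)
  obtain ⟨K, s, hs, hlip⟩ := hf.exists_lipschitzOnWith
  have hd : ∀ᶠ σ in 𝓝 τ, HasDerivAt (fun σ ↦ (κ (c σ), deriv (fun σ ↦ κ (c σ)) σ))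
      (lawField g A (c τ) (κ (c σ), deriv (fun σ ↦ κ (c σ)) σ)) σ := by
    filter_upwards [hcs, hJ.mem_nhds hτ] with σ hσ hσJ
    exact (hc.chart_hasDerivAt hL hJ hσJ hσ).2
  have hd' : ∀ᶠ σ in 𝓝 τ, HasDerivAt (fun σ ↦ (κ (c' σ), deriv (fun σ ↦ κ (c' σ)) σ))
      (lawField g A (c τ) (κ (c' σ), deriv (fun σ ↦ κ (c' σ)) σ)) σ := by
    filter_upwards [hcs', hJ.mem_nhds hτ] with σ hσ hσJ
    exact (hc'.chart_hasDerivAt hL hJ hσJ hσ).2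
  have he : (κ (c τ), deriv (fun σ ↦ κ (c σ)) τ) = (κ (c' τ), deriv (fun σ ↦ κ (c' σ)) τ) := by
    rw [h1, ← h0]
  have hin := hd.self_of_nhds.continuousAt.preimage_mem_nhds hs
  have hin' := hd'.self_of_nhds.continuousAt.preimage_mem_nhds
    (show s ∈ 𝓝 (κ (c' τ), deriv (fun σ ↦ κ (c' σ)) τ) by rw [← he]; exact hs)
  have key := ODE_solution_unique_of_eventually (v := fun _ ↦ lawField g A (c τ))
    (s := fun _ ↦ s) (K := K) (Filter.Eventually.of_forall fun _ ↦ hlip)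
    (hd.and hin) (hd'.and hin') he
  filter_upwards [key, hcs, hcs'] with σ h2 h3 h4
  exact κ.injOn h3 h4 (congrArg Prod.fst h2)

/-- Uniqueness of the solutions of the equation of motion with given initial position and
velocity. -/
theorem IsLawCurve.eqOn [FiniteDimensional ℝ V] [IsManifold I ∞ X] [I.Boundaryless] [T2Space X]
    {g : BilinField I X} {A : ∀ z : X, TangentSpace I z → TangentSpace I z} {Ω : Set X}
    (hL : IsSmoothLaw g A Ω) {c c' : ℝ → X} {J : Set ℝ} (hJ : IsOpen J) (hJc : IsPreconnected J)
    (hc : IsLawCurve g A Ω c J) (hc' : IsLawCurve g A Ω c' J) {τ₀ : ℝ} (hτ₀ : τ₀ ∈ J)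
    (h0 : c τ₀ = c' τ₀) (h1 : (curveVelocity I c τ₀ : V) = curveVelocity I c' τ₀) :
    EqOn c c' J := by
  have hmd : ∀ {c}, IsLawCurve g A Ω c J → ∀ τ ∈ J, ContMDiffAt 𝓘(ℝ, ℝ) I ∞ c τ :=
    fun hc τ hτ ↦ hc.smooth.contMDiffAt (hJ.mem_nhds hτ)
  have hstart : c =ᶠ[𝓝 τ₀] c' := by
    refine hc.eventuallyEq hL hJ hc' hτ₀ h0 ?_
    rw [deriv_chart_eq ((hmd hc τ₀ hτ₀).mdifferentiableAt (by simp)) (mem_extChartAt_source _),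
      deriv_chart_eq ((hmd hc' τ₀ hτ₀).mdifferentiableAt (by simp))
        (by rw [← h0]; exact mem_extChartAt_source _)]
    have h3 : ∀ (z z' : X) (_ : z = z') (v v' : V) (_ : v = v'),
        (mfderiv I 𝓘(ℝ, V) (extChartAt I (c τ₀)) z : V →L[ℝ] V) v =
        (mfderiv I 𝓘(ℝ, V) (extChartAt I (c τ₀)) z' : V →L[ℝ] V) v' := by
      rintro z z' rfl v v' rfl
      rfl
    exact h3 _ _ h0 _ _ h1
  -- Connectedness of `J`: the set where the germs agree is open. At a limit point inside `J`,
  -- position and chart velocity agree by continuity, and local uniqueness applies again.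
  have hsub : J ⊆ {τ | c =ᶠ[𝓝 τ] c'} := by
    refine hJc.subset_of_closure_inter_subset isOpen_setOfPred_eventually_nhds ⟨τ₀, hτ₀, hstart⟩ ?_
    rintro τ ⟨hτcl, hτ⟩
    rw [mem_closure_iff_frequently] at hτcl
    have hct := (hmd hc τ hτ).continuousAt
    have hct' := (hmd hc' τ hτ).continuousAt
    have heq : c τ = c' τ := by
      refine tendsto_nhds_unique_of_frequently_eq hct hct' (hτcl.mono fun σ hσ ↦ hσ.self_of_nhds)
    refine hc.eventuallyEq hL hJ hc' hτ heq ?_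
    have hy := (hc.chart_hasDerivAt hL hJ hτ (mem_extChartAt_source (c τ))).2.continuousAt
    have hy' := (hc'.chart_hasDerivAt hL hJ hτ (x₀ := c τ)
      (by rw [← heq]; exact mem_extChartAt_source (c τ))).2.continuousAt
    refine tendsto_nhds_unique_of_frequently_eq hy.snd hy'.snd (hτcl.mono fun σ hσ ↦ ?_)
    have : (fun σ ↦ extChartAt I (c τ) (c σ)) =ᶠ[𝓝 σ] fun σ ↦ extChartAt I (c τ) (c' σ) := by
      filter_upwards [hσ] with ρ hρ
      rw [hρ]
    exact this.deriv_eq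
  exact fun τ hτ ↦ (hsub hτ).self_of_nhds

/-- Local existence of solutions of the equation of motion, with smooth dependence on the initial
position and velocity. -/
theorem exists_isLawCurve [FiniteDimensional ℝ V] [IsManifold I ∞ X] [I.Boundaryless]
    {g : BilinField I X} {A : ∀ z : X, TangentSpace I z → TangentSpace I z} {Ω : Set X}
    (hL : IsSmoothLaw g A Ω) {x₀ : X} (hx₀ : x₀ ∈ Ω) (v₀ : V) :
    ∃ r > 0, ∃ Y : (V × V) × ℝ → V,
      ContDiffOn ℝ ∞ Y (Metric.ball (extChartAt I x₀ x₀, v₀) r ×ˢ Ioo (-r) r) ∧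
      ∀ η ∈ Metric.ball (extChartAt I x₀ x₀, v₀) r, Y (η, 0) = η.1 ∧
        deriv (fun s ↦ Y (η, s)) 0 = η.2 ∧ (∀ t ∈ Ioo (-r) r, Y (η, t) ∈ chartDomain I x₀ Ω) ∧
        IsLawCurve g A Ω (fun s ↦ (extChartAt I x₀).symm (Y (η, s))) (Ioo (-r) r) := by
  have hopen : IsOpen (chartDomain I x₀ Ω ×ˢ (univ : Set V)) :=
    (isOpen_chartDomain _ hL.isOpen).prod isOpen_univ
  have hmem : (extChartAt I x₀ x₀, v₀) ∈ chartDomain I x₀ Ω ×ˢ (univ : Set V) :=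
    ⟨⟨mem_extChartAt_target _, by rwa [mem_preimage, extChartAt_to_inv]⟩, mem_univ _⟩
  obtain ⟨r, hr, α, hα, hs⟩ := exists_contDiffOn_flow hopen (contDiffOn_lawField hL x₀) hmem
  have hsY : ContDiffOn ℝ ∞ (fun z ↦ (α z).1)
      (Metric.ball (extChartAt I x₀ x₀, v₀) r ×ˢ Ioo (-r) r) := contDiff_fst.comp_contDiffOn hs
  refine ⟨r, hr, fun z ↦ (α z).1, hsY, fun η hη ↦ ?_⟩
  obtain ⟨h0, hd⟩ := hα η hη
  have hr0 : (0 : ℝ) ∈ Ioo (-r) r := by simpa using hr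
  have hd1 : ∀ t ∈ Ioo (-r) r, HasDerivAt (fun s ↦ (α (η, s)).1) (α (η, t)).2 t :=
    fun t ht ↦ (hd t ht).2.fst
  have hd2 : ∀ t ∈ Ioo (-r) r, HasDerivAt (fun s ↦ (α (η, s)).2)
      (lawField g A x₀ (α (η, t))).2 t :=
    fun t ht ↦ (hd t ht).2.snd
  have hev : ∀ t ∈ Ioo (-r) r, deriv (fun s ↦ (α (η, s)).1) =ᶠ[𝓝 t] fun s ↦ (α (η, s)).2 := by
    intro t ht
    filter_upwards [isOpen_Ioo.mem_nhds ht] with s hs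
    exact (hd1 s hs).deriv
  have hsη : ContDiffOn ℝ ∞ (fun s ↦ (α (η, s)).1) (Ioo (-r) r) := by
    refine hsY.comp (contDiff_prodMk_right η).contDiffOn fun s hs ↦ ⟨hη, hs⟩
  refine ⟨by simp [h0], ?_, fun t ht ↦ (hd t ht).1.1, ⟨?_, fun t ht ↦ (hd t ht).1.1.2, ?_⟩⟩
  · rw [(hev 0 hr0).eq_of_nhds, h0]
  · exact (contMDiffOn_extChartAt_symm x₀).comp hsη.contMDiffOn fun t ht ↦ (hd t ht).1.1.1
  · intro t ht
    refine (obeysLawAt_chart_iff hL (hsη.contDiffAt (isOpen_Ioo.mem_nhds ht))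
      (hd t ht).1.1).2 ?_
    rw [(hev t ht).deriv_eq, (hd2 t ht).deriv, (hev t ht).eq_of_nhds]

end LawOde

/-! ### Inverse function theorem on manifolds -/

section InverseFunction

variable {V H : Type*} [NormedAddCommGroup V] [NormedSpace ℝ V] [TopologicalSpace H]
  {I : ModelWithCorners ℝ V H} {X : Type*} [TopologicalSpace X] [ChartedSpace H X]
  {V' H' : Type*} [NormedAddCommGroup V'] [NormedSpace ℝ V'] [TopologicalSpace H']
  {I' : ModelWithCorners ℝ V' H'} {X' : Type*} [TopologicalSpace X'] [ChartedSpace H' X']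

/-- The inverse function theorem on manifolds. -/
theorem exists_local_inverse [CompleteSpace V] [IsManifold I ∞ X] [I.Boundaryless]
    [IsManifold I' ∞ X'] [I'.Boundaryless] {f : X → X'} {x : X} (hf : ContMDiffAt I I' ∞ f x)
    (hi : (mfderiv I I' f x).IsInvertible) :
    ∃ k : X' → X, k (f x) = x ∧ ContMDiffAt I' I ∞ k (f x) ∧ (∀ᶠ w in 𝓝 (f x), f (k w) = w) ∧
      ∀ᶠ z in 𝓝 x, k (f z) = z := by
  set κ := extChartAt I x with hκ
  set κ' := extChartAt I' (f x) with hκ'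
  have hfl : ContDiffAt ℝ ∞ (κ' ∘ f ∘ κ.symm) (κ x) := by
    refine ContMDiffAt.contDiffAt ?_
    have h1 : ContMDiffAt 𝓘(ℝ, V) I ∞ κ.symm (κ x) :=
      contMDiffAt_extChartAt_symm (mem_extChartAt_target x)
    have h2 : κ.symm (κ x) = x := extChartAt_to_inv x
    refine ContMDiffAt.comp (I' := I') (κ x) ?_ (ContMDiffAt.comp (I' := I) (κ x) ?_ h1)
    · rw [Function.comp_apply, h2]
      exact contMDiffAt_extChartAt
    · rw [h2]
      exact hf
  have hd := mfderiv_eq_fderiv_chart (hf.mdifferentiableAt (by simp))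
  obtain ⟨e, he⟩ := hi
  let e' : V ≃L[ℝ] V' := e
  have hfe : HasFDerivAt (κ' ∘ f ∘ κ.symm) (e' : V →L[ℝ] V') (κ x) := by
    have := (hfl.differentiableAt (by simp)).hasFDerivAt
    have h' : fderiv ℝ (κ' ∘ f ∘ κ.symm) (κ x) = (e' : V →L[ℝ] V') := hd.symm.trans he.symm
    rwa [h'] at this
  have hst := hfl.hasStrictFDerivAt' hfe (by simp)
  set l := hfl.localInverse hfe (by simp) with hl
  have hv : (κ' ∘ f ∘ κ.symm) (κ x) = κ' (f x) := by
    simp [hκ]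
  have hl0 : l (κ' (f x)) = κ x := by
    have := hfl.localInverse_apply_image hfe (by simp)
    rwa [hv] at this
  have hlc : ContDiffAt ℝ ∞ l (κ' (f x)) := by
    have := hfl.to_localInverse hfe (by simp)
    rwa [hv] at this
  have hk0 : κ.symm (l (κ' (f x))) = x := by rw [hl0, hκ, extChartAt_to_inv]
  have hkc : ContMDiffAt I' I ∞ (fun w ↦ κ.symm (l (κ' w))) (f x) := by
    refine ContMDiffAt.comp (I' := 𝓘(ℝ, V)) (f x) (g := κ.symm) (f := fun w ↦ l (κ' w)) ?_ ?_
    · rw [hl0]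
      exact contMDiffAt_extChartAt_symm (mem_extChartAt_target x)
    · exact ContMDiffAt.comp (I' := 𝓘(ℝ, V')) (f x) (g := l) (f := κ') hlc.contMDiffAt
        contMDiffAt_extChartAt
  have hr : ∀ᶠ y in 𝓝 (κ' (f x)), (κ' ∘ f ∘ κ.symm) (l y) = y := by
    have := hst.eventually_right_inverse
    rwa [hv] at this
  have hle : ∀ᶠ y in 𝓝 (κ x), l ((κ' ∘ f ∘ κ.symm) y) = y := hst.eventually_left_inverse
  refine ⟨fun w ↦ κ.symm (l (κ' w)), hk0, hkc, ?_, ?_⟩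
  · have h1 : ∀ᶠ w in 𝓝 (f x), f (κ.symm (l (κ' w))) ∈ κ'.source := by
      refine ContinuousAt.preimage_mem_nhds (f := fun w ↦ f (κ.symm (l (κ' w)))) ?_ ?_
      · refine ContinuousAt.comp (g := f) (f := fun w ↦ κ.symm (l (κ' w))) ?_ hkc.continuousAt
        simp only [hk0]
        exact hf.continuousAt
      · simp only [hk0]
        exact (isOpen_extChartAt_source _).mem_nhds (mem_extChartAt_source _)
    filter_upwards [h1, (continuousAt_extChartAt (I := I') (f x)).eventually hr,
      (isOpen_extChartAt_source (I := I') (f x)).mem_nhds (mem_extChartAt_source _)]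
      with w h2 h3 h4
    exact κ'.injOn h2 h4 h3
  · have h1 := (continuousAt_extChartAt (I := I) x).eventually hle
    filter_upwards [h1, (isOpen_extChartAt_source (I := I) x).mem_nhds (mem_extChartAt_source _)]
      with z h2 h3
    simp only [Function.comp_apply] at h2
    rw [← hκ, κ.left_inv h3] at h2
    rw [h2, κ.left_inv h3]

theorem exists_injOn_of_isInvertible_mfderiv [CompleteSpace V] [IsManifold I ∞ X] [I.Boundaryless]
    [IsManifold I' ∞ X'] [I'.Boundaryless] {f : X → X'} {x : X} (hf : ContMDiffAt I I' ∞ f x)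
    (hi : (mfderiv I I' f x).IsInvertible) : ∃ s ∈ 𝓝 x, InjOn f s := by
  obtain ⟨k, -, -, -, hk⟩ := exists_local_inverse hf hi
  exact ⟨_, hk, fun y hy z hz hyz ↦ by rw [← hy, ← hz, hyz]⟩

/-- An injective local diffeomorphism is a diffeomorphism onto its image. -/
theorem exists_partialDiffeomorph [CompleteSpace V] [IsManifold I ∞ X] [I.Boundaryless]
    [IsManifold I' ∞ X'] [I'.Boundaryless] [Nonempty X] {f : X → X'} {s : Set X} (hs : IsOpen s)
    (hf : ∀ x ∈ s, ContMDiffAt I I' ∞ f x) (hi : ∀ x ∈ s, (mfderiv I I' f x).IsInvertible)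
    (hinj : InjOn f s) :
    ∃ Φ : PartialDiffeomorph I I' X X' ∞, Φ.source = s ∧ Φ.target = f '' s ∧
      Φ.toFun = f := by
  have key : ∀ x ∈ s, ∃ k : X' → X, ContMDiffAt I' I ∞ k (f x) ∧
      ∀ᶠ w in 𝓝 (f x), k w ∈ s ∧ f (k w) = w := by
    intro x hx
    obtain ⟨k, h0, h1, h2, -⟩ := exists_local_inverse (hf x hx) (hi x hx)
    refine ⟨k, h1, Filter.Eventually.and ?_ h2⟩
    exact h1.continuousAt.preimage_mem_nhds (by rw [h0]; exact hs.mem_nhds hx)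
  have hopen : IsOpen (f '' s) := by
    rw [isOpen_iff_mem_nhds]
    rintro - ⟨x, hx, rfl⟩
    obtain ⟨k, -, h2⟩ := key x hx
    filter_upwards [h2] with w hw
    exact ⟨k w, hw.1, hw.2⟩
  refine ⟨⟨hinj.toPartialEquiv f s, hs, hopen, fun x hx ↦ (hf x hx).contMDiffWithinAt, ?_⟩,
    rfl, rfl, rfl⟩
  rintro - ⟨x, hx, rfl⟩
  obtain ⟨k, h1, h2⟩ := key x hx
  refine ContMDiffAt.contMDiffWithinAt (h1.congr_of_eventuallyEq ?_)
  -- Near `f x` the inverse of the injective map equals the smooth local inverse `k`, because `k w`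
  -- lies in `s`, where `f` is injective.
  filter_upwards [h2] with w hw
  have h3 : (hinj.toPartialEquiv f s).symm (f (k w)) = k w :=
    (hinj.toPartialEquiv f s).left_inv hw.1
  rwa [hw.2] at h3

end InverseFunction

/-! ### Velocities of curves and transport between tangent spaces -/

section Curves

variable {V H : Type*} [NormedAddCommGroup V] [NormedSpace ℝ V] [TopologicalSpace H]
  {I : ModelWithCorners ℝ V H} {X : Type*} [TopologicalSpace X] [ChartedSpace H X]
  {V' H' : Type*} [NormedAddCommGroup V'] [NormedSpace ℝ V'] [TopologicalSpace H']
  {I' : ModelWithCorners ℝ V' H'} {X' : Type*} [TopologicalSpace X'] [ChartedSpace H' X']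

theorem mfderiv_apply_congr (f : X → X') {x x' : X} (hx : x = x') {v v' : V} (hv : v = v') :
    (mfderiv I I' f x : V →L[ℝ] V') v = (mfderiv I I' f x' : V →L[ℝ] V') v' := by
  subst hx hv
  rfl

theorem curveVelocity_const (x : X) (τ : ℝ) : (curveVelocity I (fun _ ↦ x) τ : V) = 0 := by
  have h : (mfderiv 𝓘(ℝ, ℝ) I (fun _ : ℝ ↦ x) τ : ℝ →L[ℝ] V) = 0 := mfderiv_const
  exact congrArg (fun l : ℝ →L[ℝ] V ↦ l 1) h

theorem curveVelocity_prodMk {c : ℝ → X} {c' : ℝ → X'} {τ : ℝ}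
    (hc : MDifferentiableAt 𝓘(ℝ, ℝ) I c τ) (hc' : MDifferentiableAt 𝓘(ℝ, ℝ) I' c' τ) :
    (curveVelocity (I.prod I') (fun σ ↦ (c σ, c' σ)) τ : V × V') =
      ((curveVelocity I c τ : V), (curveVelocity I' c' τ : V')) := by
  have h := mfderiv_prodMk hc hc'
  exact congrArg (fun l : ℝ →L[ℝ] V × V' ↦ l 1) h

theorem bilinField_apply_congr (g : BilinField I X) {x x' : X} (hx : x = x') {u u' v v' : V}
    (hu : u = u') (hv : v = v') :
    (g x : V →L[ℝ] V →L[ℝ] ℝ) u v = (g x' : V →L[ℝ] V →L[ℝ] ℝ) u' v' := by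
  subst hx hu hv
  rfl

end Curves

/-! ### Dilatations, fundamental field and connection form -/

section WeylStructure

variable {E F M P : Type*}
  [NormedAddCommGroup E] [NormedSpace ℝ E]
  [NormedAddCommGroup F] [NormedSpace ℝ F]
  [TopologicalSpace M] [ChartedSpace E M] [IsManifold 𝓘(ℝ, E) ∞ M]
  [TopologicalSpace P] [ChartedSpace F P] [IsManifold 𝓘(ℝ, F) ∞ P]
  {p q : ℕ} {W : WeylStructure E F M P} {C : WeylClass E M p q} {h : MetricBundleIso W C}
  {r : WeylPair E M p q} {t : P → ℝ}
  {V' H' : Type*} [NormedAddCommGroup V'] [NormedSpace ℝ V'] [TopologicalSpace H']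
  {I' : ModelWithCorners ℝ V' H'} {X' : Type*} [TopologicalSpace X'] [ChartedSpace H' X']

namespace WeylStructure

theorem contMDiffAt_dil (W : WeylStructure E F M P) {s : ℝ} (hs : 0 < s) (x : P) :
    ContMDiffAt (𝓘(ℝ, ℝ).prod 𝓘(ℝ, F)) 𝓘(ℝ, F) ∞ (fun z : ℝ × P ↦ W.dil z.1 z.2) (s, x) :=
  W.smooth_dil.contMDiffAt ((isOpen_Ioi.prod isOpen_univ).mem_nhds ⟨hs, mem_univ _⟩)

theorem contMDiff_dil (W : WeylStructure E F M P) {s : ℝ} (hs : 0 < s) :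
    ContMDiff 𝓘(ℝ, F) 𝓘(ℝ, F) ∞ (W.dil s) := fun x ↦
  ContMDiffAt.comp (I' := 𝓘(ℝ, ℝ).prod 𝓘(ℝ, F)) x (g := fun z : ℝ × P ↦ W.dil z.1 z.2)
    (f := fun x ↦ (s, x)) (W.contMDiffAt_dil hs x) (contMDiffAt_const.prodMk contMDiffAt_id)

theorem contMDiffAt_orbit (W : WeylStructure E F M P) {s : ℝ} (hs : 0 < s) (x : P) :
    ContMDiffAt 𝓘(ℝ, ℝ) 𝓘(ℝ, F) ∞ (fun s ↦ W.dil s x) s :=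
  ContMDiffAt.comp (I' := 𝓘(ℝ, ℝ).prod 𝓘(ℝ, F)) s (g := fun z : ℝ × P ↦ W.dil z.1 z.2)
    (f := fun s ↦ (s, x)) (W.contMDiffAt_dil hs x) (contMDiffAt_id.prodMk contMDiffAt_const)

theorem contMDiff_ambientDil (W : WeylStructure E F M P) {s : ℝ} (hs : 0 < s) :
    ContMDiff (ambientModel F) (ambientModel F) ∞ (W.ambientDil s) :=
  (W.contMDiff_dil hs).prodMap contMDiff_id

theorem dil_inv (W : WeylStructure E F M P) {s : ℝ} (hs : 0 < s) (x : P) :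
    W.dil s⁻¹ (W.dil s x) = x := by
  rw [← W.dil_mul _ _ _ (inv_pos.2 hs) hs, inv_mul_cancel₀ hs.ne', W.dil_one]

theorem ambientDil_inv (W : WeylStructure E F M P) {s : ℝ} (hs : 0 < s) (z : P × ℝ) :
    W.ambientDil s⁻¹ (W.ambientDil s z) = z :=
  Prod.ext (W.dil_inv hs z.1) rfl

theorem ambientDil_inv' (W : WeylStructure E F M P) {s : ℝ} (hs : 0 < s) (z : P × ℝ) :
    W.ambientDil s (W.ambientDil s⁻¹ z) = z := by
  simpa using W.ambientDil_inv (inv_pos.2 hs) z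

theorem mfderiv_ambientDil (W : WeylStructure E F M P) {s : ℝ} (hs : 0 < s) (z : P × ℝ)
    (w : F) (c : ℝ) :
    (mfderiv (ambientModel F) (ambientModel F) (W.ambientDil s) z : F × ℝ →L[ℝ] F × ℝ) (w, c) =
      ((mfderiv 𝓘(ℝ, F) 𝓘(ℝ, F) (W.dil s) z.1 : F →L[ℝ] F) w, c) := by
  have h := mfderiv_prodMap (p := z) ((W.contMDiff_dil hs z.1).mdifferentiableAt (by simp))
    (mdifferentiableAt_id (I := 𝓘(ℝ, ℝ)) (x := z.2))
  have h' : (mfderiv 𝓘(ℝ, ℝ) 𝓘(ℝ, ℝ) (id : ℝ → ℝ) z.2 : ℝ →L[ℝ] ℝ) =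
    ContinuousLinearMap.id ℝ ℝ := mfderiv_id
  refine (congrArg (fun l : F × ℝ →L[ℝ] F × ℝ ↦ l (w, c)) h).trans ?_
  exact congrArg (fun l : ℝ →L[ℝ] ℝ ↦
    ((mfderiv 𝓘(ℝ, F) 𝓘(ℝ, F) (W.dil s) z.1 : F →L[ℝ] F) w, l c)) h'

theorem mfderiv_dil_inv (W : WeylStructure E F M P) {s : ℝ} (hs : 0 < s) (x : P) (w : F) :
    (mfderiv 𝓘(ℝ, F) 𝓘(ℝ, F) (W.dil s⁻¹) (W.dil s x) : F →L[ℝ] F)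
      ((mfderiv 𝓘(ℝ, F) 𝓘(ℝ, F) (W.dil s) x : F →L[ℝ] F) w) = w := by
  have h1 := mfderiv_comp x ((W.contMDiff_dil (inv_pos.2 hs) (W.dil s x)).mdifferentiableAt
    (by simp)) ((W.contMDiff_dil hs x).mdifferentiableAt (by simp))
  have h2 : W.dil s⁻¹ ∘ W.dil s = id := funext (W.dil_inv hs)
  rw [h2, mfderiv_id] at h1
  exact (congrArg (fun l : F →L[ℝ] F ↦ l w) h1).symm

theorem mfderiv_dil_inv' (W : WeylStructure E F M P) {s : ℝ} (hs : 0 < s) (x : P) (w : F) :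
    (mfderiv 𝓘(ℝ, F) 𝓘(ℝ, F) (W.dil s) x : F →L[ℝ] F)
      ((mfderiv 𝓘(ℝ, F) 𝓘(ℝ, F) (W.dil s⁻¹) (W.dil s x) : F →L[ℝ] F) w) = w := by
  have h1 := W.mfderiv_dil_inv (inv_pos.2 hs) (W.dil s x) w
  rw [inv_inv] at h1
  exact (mfderiv_apply_congr (W.dil s) (W.dil_inv hs x).symm rfl).trans h1

theorem isInvertible_mfderiv_ambientDil (W : WeylStructure E F M P) {s : ℝ} (hs : 0 < s)
    (z : P × ℝ) :
    (mfderiv (ambientModel F) (ambientModel F) (W.ambientDil s) z :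
      F × ℝ →L[ℝ] F × ℝ).IsInvertible := by
  refine ContinuousLinearMap.IsInvertible.of_inverse
    (g := (mfderiv (ambientModel F) (ambientModel F) (W.ambientDil s⁻¹) (W.ambientDil s z) :
      F × ℝ →L[ℝ] F × ℝ)) ?_ ?_
  · refine ContinuousLinearMap.ext fun ⟨w, c⟩ ↦ ?_
    have h1 := W.mfderiv_ambientDil (inv_pos.2 hs) (W.ambientDil s z) w c
    refine (congrArg _ h1).trans ((W.mfderiv_ambientDil hs z _ _).trans ?_)
    exact Prod.ext (W.mfderiv_dil_inv' hs z.1 w) rfl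
  · refine ContinuousLinearMap.ext fun ⟨w, c⟩ ↦ ?_
    have h1 := W.mfderiv_ambientDil hs z w c
    refine (congrArg _ h1).trans ((W.mfderiv_ambientDil (inv_pos.2 hs) (W.ambientDil s z) _ _).trans
      ?_)
    exact Prod.ext (W.mfderiv_dil_inv hs z.1 w) rfl

theorem mfderiv_fundamentalField (W : WeylStructure E F M P) {f : P → X'} {x : P}
    (hf : MDifferentiableAt 𝓘(ℝ, F) I' f x) :
    (mfderiv 𝓘(ℝ, F) I' f x : F →L[ℝ] V') (fundamentalField W x) =
      curveVelocity I' (fun s ↦ f (W.dil s x)) 1 := by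
  have h1 : W.dil 1 x = x := W.dil_one x
  have h2 := curveVelocity_comp (I' := I') (f := f) (c := fun s ↦ W.dil s x) (τ := 1)
    (I := 𝓘(ℝ, F)) (by rwa [h1]) ((W.contMDiffAt_orbit one_pos x).mdifferentiableAt (by simp))
  exact (mfderiv_apply_congr f h1.symm rfl).trans h2.symm

theorem mfderiv_proj_fundamentalField (W : WeylStructure E F M P) (x : P) :
    (mfderiv 𝓘(ℝ, F) 𝓘(ℝ, E) W.proj x : F →L[ℝ] E) (fundamentalField W x) = 0 := by
  rw [W.mfderiv_fundamentalField ((W.smooth_proj x).mdifferentiableAt (by simp))]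
  rw [curveVelocity_congr (c' := fun _ ↦ W.proj x), curveVelocity_const]
  filter_upwards [Ioi_mem_nhds one_pos] with s hs
  exact W.proj_dil s x hs

theorem curveVelocity_ambientDil (W : WeylStructure E F M P) (z : P × ℝ) :
    (curveVelocity (ambientModel F) (fun s ↦ W.ambientDil s z) 1 : F × ℝ) = ambientField W z := by
  refine (curveVelocity_prodMk ((W.contMDiffAt_orbit one_pos z.1).mdifferentiableAt (by simp))
    mdifferentiableAt_const).trans ?_
  exact Prod.ext rfl (curveVelocity_const _ _)

theorem mfderiv_ambientField (W : WeylStructure E F M P) {f : P × ℝ → X'} {z : P × ℝ}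
    (hf : MDifferentiableAt (ambientModel F) I' f z) :
    (mfderiv (ambientModel F) I' f z : F × ℝ →L[ℝ] V') (ambientField W z) =
      curveVelocity I' (fun s ↦ f (W.ambientDil s z)) 1 := by
  have h1 : W.ambientDil 1 z = z := Prod.ext (W.dil_one z.1) rfl
  have h3 : MDifferentiableAt 𝓘(ℝ, ℝ) (ambientModel F) (fun s ↦ W.ambientDil s z) 1 :=
    ((W.contMDiffAt_orbit one_pos z.1).mdifferentiableAt (by simp)).prodMk mdifferentiableAt_const
  have h2 := curveVelocity_comp (I' := I') (f := f) (c := fun s ↦ W.ambientDil s z) (τ := 1)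
    (I := ambientModel F) (by rwa [h1]) h3
  exact (mfderiv_apply_congr (V := F × ℝ) f h1.symm (W.curveVelocity_ambientDil z).symm).trans h2.symm

/-- The fundamental field is the velocity of the dilatation orbits at `s = 1`, and `f` carries
orbits to orbits with the same parameter. This yields the orthogonality of the pulled back
acceleration to the fundamental field. -/
theorem mfderiv_ambientField_of_comm (W : WeylStructure E F M P) {f : P × ℝ → P × ℝ} {z : P × ℝ}
    (hf : MDifferentiableAt (ambientModel F) (ambientModel F) f z)
    (hc : ∀ s, 0 < s → f (W.ambientDil s z) = W.ambientDil s (f z)) :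
    (mfderiv (ambientModel F) (ambientModel F) f z : F × ℝ →L[ℝ] F × ℝ) (ambientField W z) =
      ambientField W (f z) := by
  rw [W.mfderiv_ambientField hf]
  refine Eq.trans (curveVelocity_congr ?_) (W.curveVelocity_ambientDil (f z))
  filter_upwards [Ioi_mem_nhds one_pos] with s hs
  exact hc s hs

end WeylStructure

theorem IsFibreCoordinate.mfderiv_fundamentalField (ht : IsFibreCoordinate h r t) (x : P) :
    (mvfderiv 𝓘(ℝ, F) t x : F →L[ℝ] ℝ) (fundamentalField W x) = t x := by
  refine (W.mfderiv_fundamentalField ((ht.smooth x).mdifferentiableAt (by simp))).trans ?_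
  rw [curveVelocity_congr (c' := fun s ↦ t x * s), curveVelocity_model]
  · exact (by simp : deriv (fun s ↦ t x * s) 1 = t x)
  · filter_upwards [Ioi_mem_nhds one_pos] with s hs
    exact ht.dil s x hs

/-- The connection form as a continuous linear form. -/
noncomputable def connectionCLM (W : WeylStructure E F M P) (r : WeylPair E M p q) (t : P → ℝ)
    (x : P) : F →L[ℝ] ℝ :=
  (t x)⁻¹ • (mvfderiv 𝓘(ℝ, F) t x : F →L[ℝ] ℝ) +
    (r.a (W.proj x) : E →L[ℝ] ℝ).comp (mfderiv 𝓘(ℝ, F) 𝓘(ℝ, E) W.proj x : F →L[ℝ] E)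

theorem IsFibreCoordinate.connectionCLM_fundamentalField (ht : IsFibreCoordinate h r t) (x : P) :
    connectionCLM W r t x (fundamentalField W x) = 1 := by
  have h1 := ht.mfderiv_fundamentalField x
  have h2 := W.mfderiv_proj_fundamentalField x
  have h3 : connectionCLM W r t x (fundamentalField W x) =
      (t x)⁻¹ * (mvfderiv 𝓘(ℝ, F) t x : F →L[ℝ] ℝ) (fundamentalField W x) +
      (r.a (W.proj x) : E →L[ℝ] ℝ)
        ((mfderiv 𝓘(ℝ, F) 𝓘(ℝ, E) W.proj x : F →L[ℝ] E) (fundamentalField W x)) := rfl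
  rw [h3, h1, h2, map_zero, add_zero, inv_mul_cancel₀ (ht.pos x).ne']

/-- Under `δ_s` both `t` and `dt` are multiplied by `s`, so `t⁻¹ dt` is invariant, and `π` does not
change. -/
theorem IsFibreCoordinate.connectionCLM_dil (ht : IsFibreCoordinate h r t) {s : ℝ} (hs : 0 < s)
    (x : P) (w : F) :
    connectionCLM W r t (W.dil s x) ((mfderiv 𝓘(ℝ, F) 𝓘(ℝ, F) (W.dil s) x : F →L[ℝ] F) w) =
      connectionCLM W r t x w := by
  have hd := (W.contMDiff_dil hs x).mdifferentiableAt (by simp)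
  have h1 : (mvfderiv 𝓘(ℝ, F) t (W.dil s x) : F →L[ℝ] ℝ)
      ((mfderiv 𝓘(ℝ, F) 𝓘(ℝ, F) (W.dil s) x : F →L[ℝ] F) w) =
      s * (mvfderiv 𝓘(ℝ, F) t x : F →L[ℝ] ℝ) w := by
    have ha := mfderiv_comp x ((ht.smooth (W.dil s x)).mdifferentiableAt (by simp)) hd
    have hb := mfderiv_comp x (g := fun c : ℝ ↦ c * s) (I' := 𝓘(ℝ, ℝ)) (I'' := 𝓘(ℝ, ℝ))
      (by
        refine DifferentiableAt.mdifferentiableAt ?_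
        fun_prop)
      ((ht.smooth x).mdifferentiableAt (by simp))
    have hab : t ∘ W.dil s = (fun c : ℝ ↦ c * s) ∘ t := funext fun y ↦ ht.dil s y hs
    rw [hab] at ha
    have hc := congrArg (fun l : F →L[ℝ] ℝ ↦ l w) (ha.symm.trans hb)
    refine hc.trans ?_
    have hm : (mfderiv 𝓘(ℝ, ℝ) 𝓘(ℝ, ℝ) (fun c : ℝ ↦ c * s) (t x) : ℝ →L[ℝ] ℝ) =
        fderiv ℝ (fun c : ℝ ↦ c * s) (t x) := mfderiv_eq_fderiv
    refine (congrArg (fun l : ℝ →L[ℝ] ℝ ↦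
      l ((mvfderiv 𝓘(ℝ, F) t x : F →L[ℝ] ℝ) w)) hm).trans ?_
    rw [fderiv_mul_const (by fun_prop)]
    simp
  have h2 : (mfderiv 𝓘(ℝ, F) 𝓘(ℝ, E) W.proj (W.dil s x) : F →L[ℝ] E)
      ((mfderiv 𝓘(ℝ, F) 𝓘(ℝ, F) (W.dil s) x : F →L[ℝ] F) w) =
      (mfderiv 𝓘(ℝ, F) 𝓘(ℝ, E) W.proj x : F →L[ℝ] E) w := by
    have ha := mfderiv_comp x ((W.smooth_proj (W.dil s x)).mdifferentiableAt (by simp)) hd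
    have hab : W.proj ∘ W.dil s = W.proj := funext fun y ↦ W.proj_dil s y hs
    rw [hab] at ha
    exact (congrArg (fun l : F →L[ℝ] E ↦ l w) ha).symm
  have h3 : ∀ (m m' : M) (_ : m = m') (u u' : E) (_ : u = u'),
      (r.a m : E →L[ℝ] ℝ) u = (r.a m' : E →L[ℝ] ℝ) u' := by
    rintro m m' rfl u u' rfl
    rfl
  have h4 : ∀ (x : P) (w : F), connectionCLM W r t x w =
      (t x)⁻¹ * (mvfderiv 𝓘(ℝ, F) t x : F →L[ℝ] ℝ) w +
      (r.a (W.proj x) : E →L[ℝ] ℝ)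
        ((mfderiv 𝓘(ℝ, F) 𝓘(ℝ, E) W.proj x : F →L[ℝ] E) w) := fun _ _ ↦ rfl
  refine (h4 _ _).trans (Eq.trans ?_ (h4 _ _).symm)
  refine congrArg₂ (· + ·) ?_ (h3 _ _ (W.proj_dil s x hs) _ _ h2)
  refine (congrArg ((t (W.dil s x))⁻¹ * ·) h1).trans ?_
  have := (ht.pos x).ne'
  simp only [ht.dil s x hs]
  field_simp

end WeylStructure

/-! ### The null vector with prescribed products along a degenerate hyperplane -/

section NullSolution

variable {F : Type*} [NormedAddCommGroup F] [NormedSpace ℝ F]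

/-- For a nondegenerate `B` on `F × ℝ` degenerate on `F`, the null vector `U` with
`B (U, w) = ν w` for all `w` in `F`. -/
noncomputable def nullSolution (B : F × ℝ →L[ℝ] F × ℝ →L[ℝ] ℝ) (ν : F →L[ℝ] ℝ) : F × ℝ :=
  B.inverse (ν.comp (ContinuousLinearMap.fst ℝ F ℝ)) -
    (ν (B.inverse (ν.comp (ContinuousLinearMap.fst ℝ F ℝ))).1 /
      (2 * (B.inverse (ν.comp (ContinuousLinearMap.fst ℝ F ℝ))).2)) •
      B.inverse (ContinuousLinearMap.snd ℝ F ℝ)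

/-- The vectors characterised by `nullSolution`. -/
def IsNullSolution (B : F × ℝ →L[ℝ] F × ℝ →L[ℝ] ℝ) (ν : F →L[ℝ] ℝ) (U : F × ℝ) : Prop :=
  (∀ w : F, B U (w, 0) = ν w) ∧ B U U = 0

variable {B : F × ℝ →L[ℝ] F × ℝ →L[ℝ] ℝ} {ν : F →L[ℝ] ℝ} {T : F}

theorem bilin_apply_of_vanish {u : F × ℝ} (h : ∀ w : F, B u (w, 0) = 0) (z : F × ℝ) :
    B u z = B u (0, 1) * z.2 := by
  have h1 : z = (z.1, 0) + z.2 • ((0, 1) : F × ℝ) := by ext <;> simp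
  conv_lhs => rw [h1]
  rw [map_add, map_smul, h, smul_eq_mul]
  ring

theorem bilin_null_ne_zero (hi : B.IsInvertible) (hT : ∀ w : F, B (T, 0) (w, 0) = 0)
    (hν : ν T ≠ 0) : B (T, 0) (0, 1) ≠ 0 := by
  intro h0
  obtain ⟨e, rfl⟩ := hi
  have h1 : e (T, 0) = 0 := by
    refine ContinuousLinearMap.ext fun z ↦ ?_
    have := bilin_apply_of_vanish hT z
    rw [h0, zero_mul] at this
    exact this
  have h2 : (T, (0 : ℝ)) = 0 := by simpa using h1
  have h3 : T = 0 := congrArg Prod.fst h2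
  exact hν (by rw [h3, map_zero])

/-- If `u = B⁻¹ ν` had no component along `ℝ`, it would be orthogonal to the degenerate vector `T`,
while `B (u, T) = ν T ≠ 0`. -/
theorem nullSolution_denom_ne_zero (hs : ∀ u v, B u v = B v u) (hi : B.IsInvertible)
    (hT : ∀ w : F, B (T, 0) (w, 0) = 0) (hν : ν T ≠ 0) :
    (B.inverse (ν.comp (ContinuousLinearMap.fst ℝ F ℝ))).2 ≠ 0 := by
  intro h0
  set u := B.inverse (ν.comp (ContinuousLinearMap.fst ℝ F ℝ)) with hu
  have h1 : B u = ν.comp (ContinuousLinearMap.fst ℝ F ℝ) := by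
    rw [hu, hi.self_apply_inverse]
  have h2 := bilin_apply_of_vanish hT u
  rw [h0, mul_zero, hs, h1] at h2
  exact hν h2

/-- The vector `u = B⁻¹ ν` has the right products with `F`. Subtracting multiples of `N = B⁻¹ dρ`,
which is orthogonal to `F`, preserves them. Moreover `N` is null and `B (u, N) = u.2`, so `B (u - c
N, u - c N) = ν u.1 - 2 c u.2`, which fixes the coefficient `c`. -/
theorem isNullSolution_nullSolution (hs : ∀ u v, B u v = B v u) (hi : B.IsInvertible)
    (hT : ∀ w : F, B (T, 0) (w, 0) = 0) (hν : ν T ≠ 0) :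
    IsNullSolution B ν (nullSolution B ν) := by
  have hu2 := nullSolution_denom_ne_zero hs hi hT hν
  unfold nullSolution
  set u := B.inverse (ν.comp (ContinuousLinearMap.fst ℝ F ℝ)) with hu
  set N := B.inverse (ContinuousLinearMap.snd ℝ F ℝ) with hN
  have h1 : ∀ z, B u z = ν z.1 := fun z ↦ by
    rw [hu, hi.self_apply_inverse]; rfl
  have h2 : ∀ z, B N z = z.2 := fun z ↦ by
    rw [hN, hi.self_apply_inverse]; rfl
  -- `T` pairs with a vector through its `ℝ` component only, and it is orthogonal to `N`.
  have h3 : N.2 = 0 := by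
    have h4 := bilin_apply_of_vanish hT N
    rw [hs, h2] at h4
    have h5 := bilin_null_ne_zero hi hT hν
    have h4' : B (T, 0) (0, 1) * N.2 = 0 := h4.symm
    exact (mul_eq_zero.1 h4').resolve_left h5
  have h4 : ν N.1 = u.2 := by rw [← h1, hs, h2]
  refine ⟨fun w ↦ ?_, ?_⟩
  · simp only [map_sub, map_smul, sub_apply, smul_apply, h1, h2]
    simp
  · simp only [map_sub, map_smul, sub_apply, smul_apply, h1, h2, h3, h4, smul_eq_mul]
    field_simp
    ring

/-- The difference of two solutions is orthogonal to `F`, hence a multiple `c T` by nondegeneracy.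
Comparing squares leaves `2 c ν(T) = 0`. -/
theorem IsNullSolution.unique (hs : ∀ u v, B u v = B v u) (hi : B.IsInvertible)
    (hT : ∀ w : F, B (T, 0) (w, 0) = 0) (hν : ν T ≠ 0) {U U' : F × ℝ}
    (hU : IsNullSolution B ν U) (hU' : IsNullSolution B ν U') : U' = U := by
  have hk := bilin_null_ne_zero hi hT hν
  have hD : ∀ w : F, B (U' - U) (w, 0) = 0 := fun w ↦ by
    rw [map_sub, sub_apply, hU.1, hU'.1, sub_self]
  set c := B (U' - U) (0, 1) / B (T, 0) (0, 1) with hc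
  have h1 : U' - U = c • ((T, 0) : F × ℝ) := by
    obtain ⟨e, he⟩ := hi
    refine e.injective ?_
    change (e : F × ℝ →L[ℝ] F × ℝ →L[ℝ] ℝ) _ = (e : F × ℝ →L[ℝ] F × ℝ →L[ℝ] ℝ) _
    rw [he]
    refine ContinuousLinearMap.ext fun z ↦ ?_
    rw [bilin_apply_of_vanish hD, map_smul, smul_apply, bilin_apply_of_vanish hT, hc, smul_eq_mul]
    field_simp
  have h2 : U' = U + c • ((T, 0) : F × ℝ) := by rw [← h1]; abel
  have h3 := hU'.2
  rw [h2] at h3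
  simp only [map_add, map_smul, add_apply, smul_apply, hU.2, hU.1, hT, hs (T, 0) U,
    smul_eq_mul] at h3
  have h4 : c = 0 := by
    have : 2 * ν T * c = 0 := by linarith
    exact (mul_eq_zero.1 this).resolve_left (by simpa using hν)
  rw [h2, h4, zero_smul, add_zero]

theorem contDiffOn_nullSolution [FiniteDimensional ℝ F] {N : Type*} [NormedAddCommGroup N]
    [NormedSpace ℝ N]
    {B : N → F × ℝ →L[ℝ] F × ℝ →L[ℝ] ℝ} {ν : N → F →L[ℝ] ℝ} {s : Set N}
    (hB : ContDiffOn ℝ ∞ B s) (hν : ContDiffOn ℝ ∞ ν s) (hi : ∀ y ∈ s, (B y).IsInvertible)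
    (hd : ∀ y ∈ s, ((B y).inverse ((ν y).comp (ContinuousLinearMap.fst ℝ F ℝ))).2 ≠ 0) :
    ContDiffOn ℝ ∞ (fun y ↦ nullSolution (B y) (ν y)) s := by
  have : CompleteSpace F := FiniteDimensional.complete ℝ F
  have hI : ContDiffOn ℝ ∞ (fun y ↦ (B y).inverse) s := fun y hy ↦
    (hi y hy).contDiffAt_map_inverse.comp_contDiffWithinAt y (hB y hy)
  have hu : ContDiffOn ℝ ∞ (fun y ↦ (B y).inverse
      ((ν y).comp (ContinuousLinearMap.fst ℝ F ℝ))) s :=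
    hI.clm_apply (hν.clm_comp contDiffOn_const)
  have hN : ContDiffOn ℝ ∞ (fun y ↦ (B y).inverse (ContinuousLinearMap.snd ℝ F ℝ)) s :=
    hI.clm_apply contDiffOn_const
  exact hu.sub (((hν.clm_apply hu.fst).div (contDiffOn_const.mul hu.snd)
    fun y hy ↦ mul_ne_zero two_ne_zero (hd y hy)).smul hN)

end NullSolution

/-! ### Smoothness of pulled back one-forms -/

section OneForm

variable {V H : Type*} [NormedAddCommGroup V] [NormedSpace ℝ V] [TopologicalSpace H]
  {I : ModelWithCorners ℝ V H} {X : Type*} [TopologicalSpace X] [ChartedSpace H X]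
  {N : Type*} [NormedAddCommGroup N] [NormedSpace ℝ N]

theorem contDiffOn_oneForm_mfderiv [IsManifold I ∞ X] {a : ∀ x : X, TangentSpace I x →L[ℝ] ℝ}
    (ha : ContMDiff I (I.prod 𝓘(ℝ, V →L[ℝ] ℝ)) ∞ (fun x ↦ TotalSpace.mk' (V →L[ℝ] ℝ)
      (E := fun x : X ↦ TangentSpace I x →L[ℝ] ℝ) x (a x))) {f : N → X} {s : Set N}
    (hs : IsOpen s) (hf : ContMDiffOn 𝓘(ℝ, N) I ∞ f s) (w : N) :
    ContDiffOn ℝ ∞ (fun y ↦ a (f y) (mfderiv 𝓘(ℝ, N) I f y w)) s := by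
  have : IsManifold I 1 X := IsManifold.of_le (n := ∞) (by simp)
  have h1 : ContMDiffOn 𝓘(ℝ, N) I.tangent ∞ (fun y ↦
      (⟨f y, mfderiv 𝓘(ℝ, N) I f y w⟩ : TangentBundle I X)) s := by
    have h2 := hf.contMDiffOn_tangentMapWithin (m := ∞) (by simp) hs.uniqueMDiffOn
    have h3 : ContMDiff 𝓘(ℝ, N) 𝓘(ℝ, N).tangent ∞
        (fun y ↦ (⟨y, w⟩ : TangentBundle 𝓘(ℝ, N) N)) :=
      contMDiff_vectorSpace_iff_contDiff (V := fun _ : N ↦ w) |>.2 contDiff_const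
    refine (h2.comp h3.contMDiffOn fun y hy ↦ hy).congr fun y hy ↦ ?_
    simp only [Function.comp_apply, tangentMapWithin]
    rw [mfderivWithin_of_isOpen hs hy]
  intro y hy
  have h4 : ContMDiffWithinAt 𝓘(ℝ, N) (I.prod 𝓘(ℝ)) ∞
      (fun y ↦ TotalSpace.mk' ℝ (E := Bundle.Trivial X ℝ) (f y)
        (a (f y) (mfderiv 𝓘(ℝ, N) I f y w))) s y := by
    apply ContMDiffWithinAt.clm_bundle_apply (F₁ := V)
    · exact ContMDiffAt.comp_contMDiffWithinAt y ha.contMDiffAt (hf y hy)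
    · exact h1 y hy
  rw [contMDiffWithinAt_totalSpace] at h4
  exact h4.2.contDiffWithinAt

end OneForm

/-! ### Existence, uniqueness and smoothness of transversal vectors -/

section Transversal

variable {E F M P : Type*}
  [NormedAddCommGroup E] [NormedSpace ℝ E]
  [NormedAddCommGroup F] [NormedSpace ℝ F] [FiniteDimensional ℝ F]
  [TopologicalSpace M] [ChartedSpace E M] [IsManifold 𝓘(ℝ, E) ∞ M]
  [TopologicalSpace P] [ChartedSpace F P] [IsManifold 𝓘(ℝ, F) ∞ P]
  {p q : ℕ} {W : WeylStructure E F M P} {C : WeylClass E M p q} {h : MetricBundleIso W C}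
  {r : WeylPair E M p q} {t : P → ℝ} {Ω : Set (P × ℝ)} {g : BilinField (ambientModel F) (P × ℝ)}
  {A : ∀ z : P × ℝ, TangentSpace (ambientModel F) z → TangentSpace (ambientModel F) z}

/-- The value of a field of bilinear forms on `P × ℝ`, as a form on the model space. -/
noncomputable def ambientForm (g : BilinField (ambientModel F) (P × ℝ)) (z : P × ℝ) :
    F × ℝ →L[ℝ] F × ℝ →L[ℝ] ℝ := g z

/-- The fundamental vector field, as a vector of the model space. -/
noncomputable def fundamentalVec (W : WeylStructure E F M P) (x : P) : F := fundamentalField W x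

/-- The derivative of a dilatation, as a map of the model space. -/
noncomputable def dilDeriv (W : WeylStructure E F M P) (s : ℝ) (x : P) : F →L[ℝ] F :=
  mfderiv 𝓘(ℝ, F) 𝓘(ℝ, F) (W.dil s) x

/-- The derivative of a dilatation of `P × ℝ`, as a map of the model space. -/
noncomputable def ambientDilDeriv (W : WeylStructure E F M P) (s : ℝ) (z : P × ℝ) :
    F × ℝ →L[ℝ] F × ℝ :=
  mfderiv (ambientModel F) (ambientModel F) (W.ambientDil s) z

theorem ambientDilDeriv_apply (W : WeylStructure E F M P) {s : ℝ} (hs : 0 < s) (z : P × ℝ)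
    (w : F) (c : ℝ) : ambientDilDeriv W s z (w, c) = (dilDeriv W s z.1 w, c) :=
  W.mfderiv_ambientDil hs z w c

theorem IsWeylPreAmbient.hasSignature_ambientForm (hg : IsWeylPreAmbient h Ω g) {z : P × ℝ}
    (hz : z ∈ Ω) : HasSignature (ambientForm g z) (p + 1) (q + 1) :=
  hg.signature z hz

theorem IsWeylPreAmbient.symm (hg : IsWeylPreAmbient h Ω g) {z : P × ℝ} (hz : z ∈ Ω)
    (u v : F × ℝ) : ambientForm g z u v = ambientForm g z v u :=
  (hg.hasSignature_ambientForm hz).symm u v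

theorem IsWeylPreAmbient.isInvertible (hg : IsWeylPreAmbient h Ω g) {z : P × ℝ} (hz : z ∈ Ω) :
    (ambientForm g z).IsInvertible :=
  (hg.hasSignature_ambientForm hz).isInvertible

theorem IsWeylPreAmbient.isSmoothLaw (hg : IsWeylPreAmbient h Ω g)
    (hA : IsAccelerationLaw W Ω g A) : IsSmoothLaw g A Ω where
  isOpen := hg.domain.isOpen
  smooth_metric := (smoothBilinOn_iff hg.domain.isOpen).1 hg.smooth
  symm _ hz := hg.symm hz
  isInvertible _ hz := hg.isInvertible hz
  smooth_law := hA.smooth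

/-- `T` is vertical, so the tautological tensor annihilates it. -/
theorem IsWeylPreAmbient.fundamentalVec_apply (hg : IsWeylPreAmbient h Ω g) (x : P) (w : F) :
    ambientForm g (x, 0) (fundamentalVec W x, 0) (w, 0) = 0 := by
  refine (hg.initial x (fundamentalField W x) w).trans ?_
  have h1 := W.mfderiv_proj_fundamentalField x
  refine (congrArg (fun e : E ↦ (h.form x : E →L[ℝ] E →L[ℝ] ℝ) e
    ((mfderiv 𝓘(ℝ, F) 𝓘(ℝ, E) W.proj x : F →L[ℝ] E) w)) h1).trans ?_
  exact congrArg (fun l : E →L[ℝ] ℝ ↦ l ((mfderiv 𝓘(ℝ, F) 𝓘(ℝ, E) W.proj x : F →L[ℝ] E) w))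
    (map_zero (h.form x : E →L[ℝ] E →L[ℝ] ℝ))

theorem IsFibreCoordinate.connectionCLM_fundamentalVec (ht : IsFibreCoordinate h r t) (x : P) :
    connectionCLM W r t x (fundamentalVec W x) = 1 :=
  ht.connectionCLM_fundamentalField x

/-- Since `n(T) = 1`, every `w` splits as `(w - n(w) T) + n(w) T` with first summand horizontal. The
conditions on `T` and on the horizontal space thus combine into `g (U, w) = t² n(w)`. -/
theorem isTransversal_iff_isNullSolution (ht : IsFibreCoordinate h r t) (x : P) (U : F × ℝ) :
    IsTransversal W r t g x U ↔
      IsNullSolution (ambientForm g (x, 0)) ((t x) ^ 2 • connectionCLM W r t x) U := by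
  have hT := ht.connectionCLM_fundamentalVec x
  constructor
  · rintro ⟨h1, h2, h3⟩
    refine ⟨fun w ↦ ?_, h3⟩
    have h1' : ambientForm g (x, 0) U (fundamentalVec W x, 0) = (t x) ^ 2 := h1
    set T : F := fundamentalVec W x with hTdef
    have h4 : connectionCLM W r t x (w - connectionCLM W r t x w • T) = 0 := by
      rw [map_sub, map_smul, hT, smul_eq_mul, mul_one, sub_self]
    have h5 : ambientForm g (x, 0) U (w - connectionCLM W r t x w • T, 0) = 0 := h2 _ h4
    have h6 : ((w, 0) : F × ℝ) = (w - connectionCLM W r t x w • T, 0) +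
        connectionCLM W r t x w • ((T, 0) : F × ℝ) := by ext <;> simp
    rw [h6, map_add, map_smul, h5, h1', zero_add, smul_apply, smul_eq_mul, smul_eq_mul, mul_comm]
  · rintro ⟨h1, h2⟩
    refine ⟨?_, fun w hw ↦ ?_, h2⟩
    · refine (h1 (fundamentalVec W x)).trans ?_
      rw [smul_apply, hT, smul_eq_mul, mul_one]
    · have hw' : connectionCLM W r t x w = 0 := hw
      refine (h1 w).trans ?_
      exact (congrArg ((t x) ^ 2 • ·) hw').trans (smul_zero _)

theorem IsFibreCoordinate.smul_connectionCLM_ne_zero (ht : IsFibreCoordinate h r t) (x : P) :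
    ((t x) ^ 2 • connectionCLM W r t x) (fundamentalVec W x) ≠ 0 := by
  rw [smul_apply, ht.connectionCLM_fundamentalVec x]
  exact smul_ne_zero (pow_ne_zero 2 (ht.pos x).ne') one_ne_zero

theorem IsTransversal.unique (hg : IsWeylPreAmbient h Ω g) (ht : IsFibreCoordinate h r t) {x : P}
    {U U' : F × ℝ} (hU : IsTransversal W r t g x U) (hU' : IsTransversal W r t g x U') :
    U' = U :=
  IsNullSolution.unique (T := fundamentalVec W x) (hg.symm (hg.domain.zero_mem x))
    (hg.isInvertible (hg.domain.zero_mem x)) (hg.fundamentalVec_apply x)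
    (ht.smul_connectionCLM_ne_zero x) ((isTransversal_iff_isNullSolution ht x U).1 hU)
    ((isTransversal_iff_isNullSolution ht x U').1 hU')

theorem IsWeylPreAmbient.ambientForm_dil (hg : IsWeylPreAmbient h Ω g) {s : ℝ} (hs : 0 < s)
    {z : P × ℝ} (hz : z ∈ Ω) (u v : F × ℝ) :
    ambientForm g (W.ambientDil s z) (ambientDilDeriv W s z u) (ambientDilDeriv W s z v) =
      s ^ 2 * ambientForm g z u v :=
  congrArg (fun l : F × ℝ →L[ℝ] F × ℝ →L[ℝ] ℝ ↦ l u v) (hg.homogeneous s z hs hz)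

/-- Both sides of `g (U, w) = t² n(w)` scale by `s²`: the metric by homogeneity, and `t²` because
`t` scales by `s` while `n` is invariant. -/
theorem IsTransversal.dil (hg : IsWeylPreAmbient h Ω g) (ht : IsFibreCoordinate h r t) {x : P}
    {U : F × ℝ} (hU : IsTransversal W r t g x U) {s : ℝ} (hs : 0 < s) :
    IsTransversal W r t g (W.dil s x) (ambientDilDeriv W s (x, 0) U) := by
  rw [isTransversal_iff_isNullSolution ht] at hU ⊢
  obtain ⟨h1, h2⟩ := hU
  have hh := hg.ambientForm_dil hs (hg.domain.zero_mem x)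
  refine ⟨fun w ↦ ?_, ?_⟩
  · set w' : F := dilDeriv W s⁻¹ (W.dil s x) w with hw'
    have h3 : dilDeriv W s x w' = w := W.mfderiv_dil_inv' hs x w
    have h4 := ambientDilDeriv_apply W hs (x, 0) w' 0
    have h5 := hh U (w', 0)
    rw [h4, h1] at h5
    simp only [h3] at h5
    refine h5.trans ?_
    have h6 : connectionCLM W r t (W.dil s x) (dilDeriv W s x w') = _ :=
      ht.connectionCLM_dil hs x w'
    rw [h3] at h6
    rw [smul_apply, smul_apply, h6, ht.dil s x hs, smul_eq_mul, smul_eq_mul]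
    ring
  · refine (hh U U).trans ?_
    rw [h2, mul_zero]

theorem mfderiv_ambientChart_symm (x₀ : P) {y : F} (hy : y ∈ (extChartAt 𝓘(ℝ, F) x₀).target)
    (ρ₀ ρ : ℝ) (w : F) (c : ℝ) :
    (mfderiv 𝓘(ℝ, F × ℝ) (ambientModel F) (extChartAt (ambientModel F) (x₀, ρ₀)).symm (y, ρ) :
      F × ℝ →L[ℝ] F × ℝ) (w, c) =
      ((mfderiv 𝓘(ℝ, F) 𝓘(ℝ, F) (extChartAt 𝓘(ℝ, F) x₀).symm y : F →L[ℝ] F) w, c) := by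
  have h0 : ((extChartAt (ambientModel F) (x₀, ρ₀)).symm : F × ℝ → P × ℝ) =
      fun z ↦ (((extChartAt 𝓘(ℝ, F) x₀).symm ∘ Prod.fst) z, Prod.snd z) := by
    rw [extChartAt_prod]
    simp only [PartialEquiv.prod_symm]
    rw [extChartAt_model_space_eq_id]
    rfl
  have hs := (contMDiffAt_extChartAt_symm hy).mdifferentiableAt (n := ∞) (by simp)
  have hf : MDifferentiableAt 𝓘(ℝ, F × ℝ) 𝓘(ℝ, F) (Prod.fst : F × ℝ → F) (y, ρ) :=
    differentiableAt_fst.mdifferentiableAt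
  have hf' : MDifferentiableAt 𝓘(ℝ, F × ℝ) 𝓘(ℝ, ℝ) (Prod.snd : F × ℝ → ℝ) (y, ρ) :=
    differentiableAt_snd.mdifferentiableAt
  have h := mfderiv_prodMk (hs.comp (y, ρ) hf) hf'
  have h1 : (mfderiv 𝓘(ℝ, F × ℝ) 𝓘(ℝ, F) (Prod.fst : F × ℝ → F) (y, ρ) : F × ℝ →L[ℝ] F) =
      ContinuousLinearMap.fst ℝ F ℝ := mfderiv_eq_fderiv.trans fderiv_fst
  have h2 : (mfderiv 𝓘(ℝ, F × ℝ) 𝓘(ℝ, ℝ) (Prod.snd : F × ℝ → ℝ) (y, ρ) : F × ℝ →L[ℝ] ℝ) =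
      ContinuousLinearMap.snd ℝ F ℝ := mfderiv_eq_fderiv.trans fderiv_snd
  have h3 := mfderiv_comp (y, ρ) hs hf
  rw [h0]
  refine (congrArg (fun l : F × ℝ →L[ℝ] F × ℝ ↦ l (w, c)) h).trans (Prod.ext ?_ ?_)
  · refine (congrArg (fun l : F × ℝ →L[ℝ] F ↦ l (w, c)) h3).trans ?_
    exact congrArg (fun l : F × ℝ →L[ℝ] F ↦
      (mfderiv 𝓘(ℝ, F) 𝓘(ℝ, F) (extChartAt 𝓘(ℝ, F) x₀).symm y : F →L[ℝ] F) (l (w, c))) h1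
  · exact congrArg (fun l : F × ℝ →L[ℝ] ℝ ↦ l (w, c)) h2

theorem ambientChart_symm_apply (x₀ : P) (ρ₀ : ℝ) (y : F) (ρ : ℝ) :
    (extChartAt (ambientModel F) (x₀, ρ₀)).symm (y, ρ) =
      ((extChartAt 𝓘(ℝ, F) x₀).symm y, ρ) := by
  rw [extChartAt_prod]
  simp only [PartialEquiv.prod_symm]
  rw [extChartAt_model_space_eq_id]
  rfl

theorem ambientChart_apply (x₀ : P) (ρ₀ : ℝ) (z : P × ℝ) :
    extChartAt (ambientModel F) (x₀, ρ₀) z = (extChartAt 𝓘(ℝ, F) x₀ z.1, z.2) := by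
  rw [extChartAt_prod]
  rw [extChartAt_model_space_eq_id]
  rfl

theorem mem_ambientChart_target (x₀ : P) (ρ₀ : ℝ) (y : F) (ρ : ℝ) :
    (y, ρ) ∈ (extChartAt (ambientModel F) (x₀, ρ₀)).target ↔
      y ∈ (extChartAt 𝓘(ℝ, F) x₀).target := by
  rw [extChartAt_prod]
  rw [extChartAt_model_space_eq_id]
  simp

/-- The transversal vectors depend smoothly on the base point. -/
theorem exists_contDiffOn_isTransversal (hg : IsWeylPreAmbient h Ω g)
    (ht : IsFibreCoordinate h r t) (x₀ : P) :
    ∃ v : F → F × ℝ, ContDiffOn ℝ ∞ v (extChartAt 𝓘(ℝ, F) x₀).target ∧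
      ∀ y ∈ (extChartAt 𝓘(ℝ, F) x₀).target,
        IsTransversal W r t g ((extChartAt 𝓘(ℝ, F) x₀).symm y)
          ((mfderiv 𝓘(ℝ, F × ℝ) (ambientModel F) (extChartAt (ambientModel F) (x₀, (0 : ℝ))).symm
            (y, 0) : F × ℝ →L[ℝ] F × ℝ) (v y)) := by
  set κ := extChartAt 𝓘(ℝ, F) x₀ with hκ
  set s := κ.target with hs
  have hso : IsOpen s := isOpen_extChartAt_target x₀
  have hκs : ContMDiffOn 𝓘(ℝ, F) 𝓘(ℝ, F) ∞ κ.symm s := contMDiffOn_extChartAt_symm x₀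
  have hsymm : ∀ y, (extChartAt (ambientModel F) (x₀, (0 : ℝ))).symm (y, 0) = (κ.symm y, 0) :=
    fun y ↦ ambientChart_symm_apply x₀ 0 y 0
  let B : F → F × ℝ →L[ℝ] F × ℝ →L[ℝ] ℝ := fun y ↦ chartMetric g (x₀, (0 : ℝ)) (y, 0)
  let L : F → F →L[ℝ] F := fun y ↦ mfderiv 𝓘(ℝ, F) 𝓘(ℝ, F) κ.symm y
  let ν : F → F →L[ℝ] ℝ := fun y ↦
    ((t (κ.symm y)) ^ 2 • connectionCLM W r t (κ.symm y)).comp (L y)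
  have hBapp : ∀ y ∈ s, ∀ u v : F × ℝ, B y u v =
      ambientForm g (κ.symm y, 0) (L y u.1, u.2) (L y v.1, v.2) := by
    intro y hy u v
    have h1 := chartMetric_apply g (x₀, (0 : ℝ)) (y, 0) u v
    exact h1.trans (bilinField_apply_congr (V := F × ℝ) g (hsymm y)
      (mfderiv_ambientChart_symm x₀ hy 0 0 u.1 u.2) (mfderiv_ambientChart_symm x₀ hy 0 0 v.1 v.2))
  have hmem : ∀ y ∈ s, (extChartAt (ambientModel F) (x₀, (0 : ℝ))).symm (y, 0) ∈ Ω := by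
    intro y _
    rw [hsymm]
    exact hg.domain.zero_mem _
  have htar : ∀ y ∈ s, (y, (0 : ℝ)) ∈ (extChartAt (ambientModel F) (x₀, (0 : ℝ))).target :=
    fun y hy ↦ (mem_ambientChart_target x₀ 0 y 0).2 hy
  have hB : ContDiffOn ℝ ∞ B s := by
    intro y hy
    have h1 := (smoothBilinOn_iff hg.domain.isOpen).1 hg.smooth (x₀, (0 : ℝ)) (y, 0) (htar y hy)
      (hmem y hy)
    exact (ContDiffAt.comp (g := chartMetric g (x₀, (0 : ℝ))) y h1
      (contDiff_prodMk_left (0 : ℝ)).contDiffAt).contDiffWithinAt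
  have hLi : ∀ y ∈ s, (L y).IsInvertible := fun y hy ↦ isInvertible_mfderiv_extChartAt_symm' hy
  have hBi : ∀ y ∈ s, (B y).IsInvertible := by
    intro y hy
    obtain ⟨e, he⟩ := hLi y hy
    obtain ⟨b, hb⟩ := hg.isInvertible (hg.domain.zero_mem (κ.symm y))
    let e' : (F × ℝ) ≃L[ℝ] F × ℝ := e.prodCongr (ContinuousLinearEquiv.refl ℝ ℝ)
    refine ⟨e'.trans (b.trans (e'.symm.arrowCongr (ContinuousLinearEquiv.refl ℝ ℝ))), ?_⟩
    refine ContinuousLinearMap.ext fun u ↦ ContinuousLinearMap.ext fun v ↦ ?_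
    rw [hBapp y hy, ← hb, ← he]
    rfl
  have hBs : ∀ y ∈ s, ∀ u v, B y u v = B y v u := fun y hy u v ↦ by
    rw [hBapp y hy, hBapp y hy, hg.symm (hg.domain.zero_mem _)]
  -- A map into linear forms is smooth when its values on each fixed `w` are. Here these values are
  -- the components of `t² n` pulled back along the chart.
  have hν : ContDiffOn ℝ ∞ ν s := by
    refine contDiffOn_clm_apply.2 fun w ↦ ?_
    have ht1 : ContDiffOn ℝ ∞ (fun y ↦ t (κ.symm y)) s := (ht.smooth.comp_contMDiffOn hκs).contDiffOn
    have hπ : ContMDiffOn 𝓘(ℝ, F) 𝓘(ℝ, E) ∞ (fun y ↦ W.proj (κ.symm y)) s :=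
      W.smooth_proj.comp_contMDiffOn hκs
    have h1 := contDiffOn_oneForm_mfderiv r.smooth_a hso hπ w
    have h2 : ContDiffOn ℝ ∞ (fun y ↦ fderiv ℝ (fun y ↦ t (κ.symm y)) y w) s :=
      (ht1.fderiv_of_isOpen (m := ∞) hso (by simp)).clm_apply contDiffOn_const
    refine ((ht1.pow 2).mul (((ht1.inv fun y _ ↦ (ht.pos _).ne').mul h2).add h1)).congr ?_
    intro y hy
    have hd := (hκs.contMDiffAt (hso.mem_nhds hy)).mdifferentiableAt (by simp)
    have h3 : (mfderiv 𝓘(ℝ, F) 𝓘(ℝ, E) (fun y ↦ W.proj (κ.symm y)) y : F →L[ℝ] E) w =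
        (mfderiv 𝓘(ℝ, F) 𝓘(ℝ, E) W.proj (κ.symm y) : F →L[ℝ] E) (L y w) :=
      congrArg (fun l : F →L[ℝ] E ↦ l w)
        (mfderiv_comp y ((W.smooth_proj _).mdifferentiableAt (by simp)) hd)
    have h4 : (fderiv ℝ (fun y ↦ t (κ.symm y)) y : F →L[ℝ] ℝ) w =
        (mvfderiv 𝓘(ℝ, F) t (κ.symm y) : F →L[ℝ] ℝ) (L y w) := by
      have h5 := mfderiv_comp y ((ht.smooth (κ.symm y)).mdifferentiableAt (by simp)) hd
      have h6 : (mfderiv 𝓘(ℝ, F) 𝓘(ℝ, ℝ) (t ∘ κ.symm) y : F →L[ℝ] ℝ) =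
        fderiv ℝ (fun y ↦ t (κ.symm y)) y := mfderiv_eq_fderiv
      exact congrArg (fun l : F →L[ℝ] ℝ ↦ l w) (h6.symm.trans h5)
    have h7 : ν y w = (t (κ.symm y)) ^ 2 * ((t (κ.symm y))⁻¹ *
        (mvfderiv 𝓘(ℝ, F) t (κ.symm y) : F →L[ℝ] ℝ) (L y w) +
        (r.a (W.proj (κ.symm y)) : E →L[ℝ] ℝ)
          ((mfderiv 𝓘(ℝ, F) 𝓘(ℝ, E) W.proj (κ.symm y) : F →L[ℝ] E) (L y w))) := rfl
    rw [h7, ← h4]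
    exact congrArg (fun e : E ↦ (t (κ.symm y)) ^ 2 * ((t (κ.symm y))⁻¹ *
        (fderiv ℝ (fun y ↦ t (κ.symm y)) y : F →L[ℝ] ℝ) w +
        (r.a (W.proj (κ.symm y)) : E →L[ℝ] ℝ) e)) h3.symm
  -- The degenerate direction required by the null solution is the fundamental vector read in the
  -- chart.
  have hT : ∀ y ∈ s, ∃ T : F, (∀ w, B y (T, 0) (w, 0) = 0) ∧ ν y T ≠ 0 := by
    intro y hy
    have h1 : L y ((L y).inverse (fundamentalVec W (κ.symm y))) =
      (fundamentalVec W (κ.symm y)) := (hLi y hy).self_apply_inverse _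
    refine ⟨(L y).inverse (fundamentalVec W (κ.symm y)), fun w ↦ ?_, ?_⟩
    · rw [hBapp y hy]
      simp only
      rw [h1]
      exact hg.fundamentalVec_apply _ _
    · have h2 := ht.smul_connectionCLM_ne_zero (κ.symm y)
      rw [← h1] at h2
      exact h2
  refine ⟨fun y ↦ nullSolution (B y) (ν y), contDiffOn_nullSolution hB hν hBi fun y hy ↦ ?_,
    fun y hy ↦ ?_⟩
  · obtain ⟨T, hT1, hT2⟩ := hT y hy
    exact nullSolution_denom_ne_zero (hBs y hy) (hBi y hy) hT1 hT2
  · obtain ⟨T, hT1, hT2⟩ := hT y hy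
    obtain ⟨h1, h2⟩ := isNullSolution_nullSolution (hBs y hy) (hBi y hy) hT1 hT2
    set U := nullSolution (B y) (ν y) with hU
    have h3 := mfderiv_ambientChart_symm x₀ hy 0 0 U.1 U.2
    refine (congrArg (fun v : F × ℝ ↦ IsTransversal W r t g (κ.symm y) v) h3).mpr ?_
    refine (isTransversal_iff_isNullSolution ht _ _).2 ⟨fun w ↦ ?_, (hBapp y hy U U).symm.trans h2⟩
    have h4 : L y ((L y).inverse w) = w := (hLi y hy).self_apply_inverse _
    have h5 := hBapp y hy U ((L y).inverse w, 0)
    simp only at h5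
    rw [h4] at h5
    refine h5.symm.trans ((h1 _).trans ?_)
    change ((t (κ.symm y)) ^ 2 • connectionCLM W r t (κ.symm y)) (L y ((L y).inverse w)) = _
    rw [h4]

end Transversal

/-! ### Invariance of acceleration under homotheties; openness of invertibility -/

section Homothety

theorem fderiv_const_smul_apply {V N : Type*} [NormedAddCommGroup V] [NormedSpace ℝ V]
    [NormedAddCommGroup N] [NormedSpace ℝ N] {f : V → N} {y : V} (hf : DifferentiableAt ℝ f y)
    (k : ℝ) (u : V) : fderiv ℝ (fun y ↦ k • f y) y u = k • fderiv ℝ f y u := by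
  rw [fderiv_fun_const_smul hf k, smul_apply]

/-- The constant factor scales the Christoffel symbols of the first kind and cancels against the
inverse metric. -/
theorem flatAcceleration_smul {V : Type*} [NormedAddCommGroup V] [NormedSpace ℝ V]
    {G : V → V →L[ℝ] V →L[ℝ] ℝ} {c : ℝ → V} {τ : ℝ} {k : ℝ} (hk : k ≠ 0)
    (hG : DifferentiableAt ℝ G (c τ)) (hi : (G (c τ)).IsInvertible) :
    flatAcceleration (fun y ↦ k • G y) c τ = flatAcceleration G c τ := by
  have h1 : christoffelForm (fun y ↦ k • G y) (c τ) (deriv c τ) (deriv c τ) =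
      k • christoffelForm G (c τ) (deriv c τ) (deriv c τ) := by
    refine ContinuousLinearMap.ext fun w ↦ ?_
    rw [smul_apply, christoffelForm_apply, christoffelForm_apply]
    have hs : ∀ u, fderiv ℝ (fun y ↦ k • G y) (c τ) u = k • fderiv ℝ G (c τ) u := fun u ↦
      fderiv_const_smul_apply (V := V) (N := V →L[ℝ] V →L[ℝ] ℝ) hG k u
    simp only [hs]
    simp only [smul_apply, smul_eq_mul]
    ring
  have h2 : (k • G (c τ)).IsInvertible := by
    obtain ⟨e, he⟩ := hi
    refine ⟨e.trans (ContinuousLinearEquiv.smulLeft (Units.mk0 k hk)), ?_⟩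
    rw [← he]
    rfl
  simp only [flatAcceleration]
  rw [h1]
  congr 1
  rw [h2.inverse_apply_eq, smul_apply, hi.self_apply_inverse]

variable {V H : Type*} [NormedAddCommGroup V] [NormedSpace ℝ V] [TopologicalSpace H]
  {I : ModelWithCorners ℝ V H} {X : Type*} [TopologicalSpace X] [ChartedSpace H X]

theorem acceleration_of_eq_smul [IsManifold I ∞ X] [I.Boundaryless] {g g' : BilinField I X}
    {c : ℝ → X} {τ : ℝ} {k : ℝ} (hk : k ≠ 0) (hg' : ∀ᶠ z in 𝓝 (c τ), g' z = k • g z)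
    (hg : ContDiffAt ℝ ∞ (chartMetric g (c τ)) (extChartAt I (c τ) (c τ)))
    (hi : (g (c τ)).IsInvertible) :
    (acceleration g' c τ : V) = (acceleration g c τ : V) := by
  rw [acceleration_eq_flatAcceleration, acceleration_eq_flatAcceleration]
  have h1 : chartMetric g' (c τ) =ᶠ[𝓝 (extChartAt I (c τ) (c τ))]
      fun y ↦ k • chartMetric g (c τ) y := by
    have h2 : Filter.Tendsto (extChartAt I (c τ)).symm (𝓝 (extChartAt I (c τ) (c τ)))
        (𝓝 (c τ)) := by
      have := continuousAt_extChartAt_symm (I := I) (c τ)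
      rwa [ContinuousAt, extChartAt_to_inv] at this
    filter_upwards [h2.eventually hg'] with y hy
    refine ContinuousLinearMap.ext fun u ↦ ContinuousLinearMap.ext fun v ↦ ?_
    have h3 := chartMetric_apply g' (c τ) y u v
    rw [hy] at h3
    exact h3
  rw [flatAcceleration_congr (V := V) (c := fun σ ↦ extChartAt I (c τ) (c σ))
    Filter.EventuallyEq.rfl h1]
  refine flatAcceleration_smul (V := V) hk (hg.differentiableAt (by simp)) ?_
  have h4 := chartMetric_self g (c τ)
  rw [h4]
  exact hi

theorem IsLawCurve.congr {g : BilinField I X} {A : ∀ z : X, TangentSpace I z → TangentSpace I z}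
    {Ω : Set X} {c c' : ℝ → X} {J : Set ℝ} (hJ : IsOpen J) (hc : IsLawCurve g A Ω c J)
    (h : EqOn c' c J) : IsLawCurve g A Ω c' J :=
  ⟨hc.smooth.congr h, fun τ hτ ↦ by rw [h hτ]; exact hc.mem τ hτ, fun τ hτ ↦
    (obeysLawAt_congr g A (h.eventuallyEq_of_mem (hJ.mem_nhds hτ))).2 (hc.obeys τ hτ)⟩

theorem isInvertible_of_injective [FiniteDimensional ℝ V] {L : V →L[ℝ] V}
    (h : ∀ v, L v = 0 → v = 0) : L.IsInvertible := by
  have hinj : Function.Injective (L : V →ₗ[ℝ] V) := by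
    rw [injective_iff_map_eq_zero]
    exact h
  exact ⟨(LinearEquiv.ofInjectiveEndo (L : V →ₗ[ℝ] V) hinj).toContinuousLinearEquiv, by ext; rfl⟩

/-- The derivative at nearby points lives in varying tangent spaces, so it is not compared with the
one at `x`. Instead a smooth local left inverse shows that it is injective. -/
theorem eventually_isInvertible_mfderiv [FiniteDimensional ℝ V] [IsManifold I ∞ X]
    [I.Boundaryless] {X' : Type*} [TopologicalSpace X'] [ChartedSpace H X'] [IsManifold I ∞ X']
    {f : X → X'} {x : X} (hf : ContMDiffAt I I ∞ f x)
    (hi : (mfderiv I I f x : V →L[ℝ] V).IsInvertible) :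
    ∀ᶠ z in 𝓝 x, (mfderiv I I f z : V →L[ℝ] V).IsInvertible := by
  have : CompleteSpace V := FiniteDimensional.complete ℝ V
  have : IsManifold I 1 X := IsManifold.of_le (n := ∞) (by simp)
  have : IsManifold I 1 X' := IsManifold.of_le (n := ∞) (by simp)
  obtain ⟨k, h0, h1, -, h2⟩ := exists_local_inverse hf hi
  have hk : ∀ᶠ w in 𝓝 (f x), ContMDiffAt I I 1 k w :=
    (contMDiffAt_iff_contMDiffAt_nhds (by simp)).1 (h1.of_le (by simp))
  have hfe : ∀ᶠ z in 𝓝 x, ContMDiffAt I I 1 f z :=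
    (contMDiffAt_iff_contMDiffAt_nhds (by simp)).1 (hf.of_le (by simp))
  filter_upwards [hf.continuousAt.eventually hk, hfe, h2.eventually_nhds] with z h3 h4 h5
  have h6 := mfderiv_comp z (h3.mdifferentiableAt (by simp)) (h4.mdifferentiableAt (by simp))
  have h7 : (mfderiv I I (k ∘ f) z : V →L[ℝ] V) = ContinuousLinearMap.id ℝ V :=
    (Filter.EventuallyEq.mfderiv_eq (h5 : k ∘ f =ᶠ[𝓝 z] id)).trans mfderiv_id
  refine isInvertible_of_injective (V := V) fun v hv ↦ ?_
  have h8 : v = (mfderiv I I k (f z) : V →L[ℝ] V) ((mfderiv I I f z : V →L[ℝ] V) v) :=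
    congrArg (fun l : V →L[ℝ] V ↦ l v) (h7.symm.trans h6)
  exact h8.trans ((congrArg (mfderiv I I k (f z) : V →L[ℝ] V) hv).trans (map_zero _))

end Homothety

/-! ### Rays and the normal map -/

section NormalMap

variable {E F M P : Type*}
  [NormedAddCommGroup E] [NormedSpace ℝ E]
  [NormedAddCommGroup F] [NormedSpace ℝ F] [FiniteDimensional ℝ F]
  [TopologicalSpace M] [ChartedSpace E M] [IsManifold 𝓘(ℝ, E) ∞ M]
  [TopologicalSpace P] [ChartedSpace F P] [IsManifold 𝓘(ℝ, F) ∞ P]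
  {p q : ℕ} {W : WeylStructure E F M P} {C : WeylClass E M p q} {h : MetricBundleIso W C}
  {r : WeylPair E M p q} {t : P → ℝ} {Ω : Set (P × ℝ)} {g : BilinField (ambientModel F) (P × ℝ)}
  {A : ∀ z : P × ℝ, TangentSpace (ambientModel F) z → TangentSpace (ambientModel F) z}

/-- A law curve starting from `(x, 0)` with transversal initial velocity, defined on `(-ε, ε)`. -/
structure IsRay (W : WeylStructure E F M P) (r : WeylPair E M p q) (t : P → ℝ) (Ω : Set (P × ℝ))
    (g : BilinField (ambientModel F) (P × ℝ))
    (A : ∀ z : P × ℝ, TangentSpace (ambientModel F) z → TangentSpace (ambientModel F) z)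
    (x : P) (ε : ℝ) (c : ℝ → P × ℝ) : Prop where
  pos : 0 < ε
  curve : IsLawCurve g A Ω c (Ioo (-ε) ε)
  start : c 0 = (x, 0)
  velocity : IsTransversal W r t g x (curveVelocity (ambientModel F) c 0 : F × ℝ)

theorem isLawCurve_eqOn_of_isTransversal [T2Space P] (hg : IsWeylPreAmbient h Ω g) (ht : IsFibreCoordinate h r t)
    (hA : IsAccelerationLaw W Ω g A) {x : P} {c c' : ℝ → P × ℝ} {J : Set ℝ}
    (hJ : IsOpen J) (hJc : IsPreconnected J) (h0 : (0 : ℝ) ∈ J)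
    (hc : IsLawCurve g A Ω c J) (hs : c 0 = (x, 0))
    (hv : IsTransversal W r t g x (curveVelocity (ambientModel F) c 0 : F × ℝ))
    (hc' : IsLawCurve g A Ω c' J) (hs' : c' 0 = (x, 0))
    (hv' : IsTransversal W r t g x (curveVelocity (ambientModel F) c' 0 : F × ℝ)) :
    EqOn c c' J :=
  hc.eqOn (hg.isSmoothLaw hA) hJ hJc hc' h0 (hs.trans hs'.symm)
    (IsTransversal.unique hg ht hv' hv)

theorem IsRay.mono {x : P} {ε ε' : ℝ} {c : ℝ → P × ℝ} (hc : IsRay W r t Ω g A x ε c)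
    (h0 : 0 < ε') (hε : ε' ≤ ε) : IsRay W r t Ω g A x ε' c :=
  ⟨h0, hc.curve.mono (Ioo_subset_Ioo (by linarith) hε), hc.start, hc.velocity⟩

theorem IsRay.congr {x : P} {ε : ℝ} {c c' : ℝ → P × ℝ} (hc : IsRay W r t Ω g A x ε c)
    (h : EqOn c' c (Ioo (-ε) ε)) : IsRay W r t Ω g A x ε c' := by
  have h0 : (0 : ℝ) ∈ Ioo (-ε) ε := by simpa using hc.pos
  refine ⟨hc.pos, hc.curve.congr isOpen_Ioo h, (h h0).trans hc.start, ?_⟩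
  rw [curveVelocity_congr (h.eventuallyEq_of_mem (isOpen_Ioo.mem_nhds h0))]
  exact hc.velocity

theorem IsRay.eq [T2Space P] (hg : IsWeylPreAmbient h Ω g) (ht : IsFibreCoordinate h r t)
    (hA : IsAccelerationLaw W Ω g A) {x : P} {ε ε' ρ : ℝ} {c c' : ℝ → P × ℝ}
    (hc : IsRay W r t Ω g A x ε c) (hc' : IsRay W r t Ω g A x ε' c') (hρ : |ρ| < ε)
    (hρ' : |ρ| < ε') : c ρ = c' ρ := by
  have h1 := hc.mono (lt_min hc.pos hc'.pos) (min_le_left ε ε')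
  have h2 := hc'.mono (lt_min hc.pos hc'.pos) (min_le_right ε ε')
  exact isLawCurve_eqOn_of_isTransversal hg ht hA isOpen_Ioo isPreconnected_Ioo (by simpa using h1.pos) h1.curve h1.start
    h1.velocity h2.curve h2.start h2.velocity (abs_lt.1 (lt_min hρ hρ'))

open Classical in
/-- The map sending `(x, ρ)` to the value at `ρ` of the law curve with transversal initial velocity
at `(x, 0)`. -/
noncomputable def normalMap (W : WeylStructure E F M P) (r : WeylPair E M p q) (t : P → ℝ)
    (Ω : Set (P × ℝ)) (g : BilinField (ambientModel F) (P × ℝ))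
    (A : ∀ z : P × ℝ, TangentSpace (ambientModel F) z → TangentSpace (ambientModel F) z)
    (z : P × ℝ) : P × ℝ :=
  -- The choice of ray is immaterial by uniqueness. The default value `z` keeps the map equivariant
  -- even where no ray reaches.
  if H : ∃ c : ℝ → P × ℝ, ∃ ε, IsRay W r t Ω g A z.1 ε c ∧ |z.2| < ε then H.choose z.2 else z

theorem IsRay.normalMap_eq [T2Space P] (hg : IsWeylPreAmbient h Ω g)
    (ht : IsFibreCoordinate h r t) (hA : IsAccelerationLaw W Ω g A) {x : P} {ε ρ : ℝ}
    {c : ℝ → P × ℝ} (hc : IsRay W r t Ω g A x ε c) (hρ : |ρ| < ε) :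
    normalMap W r t Ω g A (x, ρ) = c ρ := by
  have H : ∃ c : ℝ → P × ℝ, ∃ ε, IsRay W r t Ω g A (x, ρ).1 ε c ∧ |(x, ρ).2| < ε :=
    ⟨c, ε, hc, hρ⟩
  rw [normalMap, dif_pos H]
  obtain ⟨ε', h1, h2⟩ := H.choose_spec
  exact h1.eq hg ht hA hc h2 hρ

theorem IsRay.normalMap [T2Space P] (hg : IsWeylPreAmbient h Ω g)
    (ht : IsFibreCoordinate h r t) (hA : IsAccelerationLaw W Ω g A) {x : P} {ε : ℝ}
    {c : ℝ → P × ℝ} (hc : IsRay W r t Ω g A x ε c) :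
    IsRay W r t Ω g A x ε (fun ρ ↦ normalMap W r t Ω g A (x, ρ)) :=
  hc.congr fun _ hρ ↦ hc.normalMap_eq hg ht hA (abs_lt.2 hρ)

/-- A dilatation pulls `g` back to `s² g`, so it preserves accelerations. The law is equivariant and
the transversal initial velocity is carried to a transversal one. -/
theorem IsRay.dil (hg : IsWeylPreAmbient h Ω g) (ht : IsFibreCoordinate h r t)
    (hA : IsAccelerationLaw W Ω g A) {x : P} {ε : ℝ} {c : ℝ → P × ℝ}
    (hc : IsRay W r t Ω g A x ε c) {s : ℝ} (hs : 0 < s) :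
    IsRay W r t Ω g A (W.dil s x) ε (fun ρ ↦ W.ambientDil s (c ρ)) := by
  have h0 : (0 : ℝ) ∈ Ioo (-ε) ε := by simpa using hc.pos
  have hct : ∀ τ ∈ Ioo (-ε) ε, ContMDiffAt 𝓘(ℝ, ℝ) (ambientModel F) ∞ c τ := fun τ hτ ↦
    hc.curve.smooth.contMDiffAt (isOpen_Ioo.mem_nhds hτ)
  have hvel : ∀ τ ∈ Ioo (-ε) ε,
      (curveVelocity (ambientModel F) (fun ρ ↦ W.ambientDil s (c ρ)) τ : F × ℝ) =
      ambientDilDeriv W s (c τ) (curveVelocity (ambientModel F) c τ) := fun τ hτ ↦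
    curveVelocity_comp ((W.contMDiff_ambientDil hs _).mdifferentiableAt (by simp))
      ((hct τ hτ).mdifferentiableAt (by simp))
  have hsm : ∀ z ∈ Ω, ContDiffAt ℝ ∞ (chartMetric g z) (extChartAt (ambientModel F) z z) :=
    fun z hz ↦ (hg.isSmoothLaw hA).smooth_metric z _ (mem_extChartAt_target z)
      (by rwa [extChartAt_to_inv])
  refine ⟨hc.pos, ⟨(W.contMDiff_ambientDil hs).comp_contMDiffOn hc.curve.smooth,
    fun τ hτ ↦ hg.domain.dil_mem s _ hs (hc.curve.mem τ hτ), fun τ hτ ↦ ?_⟩, ?_, ?_⟩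
  · have hm := hc.curve.mem τ hτ
    have hm' := hg.domain.dil_mem s _ hs hm
    have h1 := acceleration_comp (f := W.ambientDil s) (g := g)
      (W.contMDiff_ambientDil hs (c τ)) (W.isInvertible_mfderiv_ambientDil hs (c τ)) (hct τ hτ)
      (hsm _ hm') (hg.symm hm') (hg.isInvertible hm')
    have h2 : (acceleration (pullbackBilin (I := ambientModel F) (I' := ambientModel F)
        (W.ambientDil s) g) c τ : F × ℝ) = acceleration g c τ := by
      refine acceleration_of_eq_smul (I := ambientModel F) (V := F × ℝ) (k := s ^ 2)
        (pow_ne_zero 2 hs.ne') ?_ (hsm _ hm) (hg.isInvertible hm)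
      filter_upwards [hg.domain.isOpen.mem_nhds hm] with z hz
      exact hg.homogeneous s z hs hz
    have h3 : (acceleration g c τ : F × ℝ) = A (c τ) (curveVelocity (ambientModel F) c τ) :=
      hc.curve.obeys τ hτ
    have h4 := hA.equivariant s (c τ) (curveVelocity (ambientModel F) c τ) hs hm
    have h5 : (A (W.ambientDil s (c τ)) (curveVelocity (ambientModel F)
        (fun ρ ↦ W.ambientDil s (c ρ)) τ) : F × ℝ) =
        A (W.ambientDil s (c τ)) (ambientDilDeriv W s (c τ)
          (curveVelocity (ambientModel F) c τ)) :=
      congrArg (fun v : F × ℝ ↦ (A (W.ambientDil s (c τ)) v : F × ℝ)) (hvel τ hτ)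
    exact h1.trans ((congrArg (ambientDilDeriv W s (c τ)) (h2.trans h3)).trans
      (h4.symm.trans h5.symm))
  · simp only [hc.start]
    rfl
  · have h1 := hvel 0 h0
    have h2 := mfderiv_apply_congr (I := ambientModel F) (I' := ambientModel F) (V := F × ℝ)
      (V' := F × ℝ) (W.ambientDil s) hc.start
      (rfl : (curveVelocity (ambientModel F) c 0 : F × ℝ) = _)
    refine (congrArg (fun v : F × ℝ ↦ IsTransversal W r t g (W.dil s x) v) (h1.trans h2)).mpr ?_
    exact hc.velocity.dil hg ht hs

theorem IsRay.normalMap_dil [T2Space P] (hg : IsWeylPreAmbient h Ω g)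
    (ht : IsFibreCoordinate h r t) (hA : IsAccelerationLaw W Ω g A) {x : P} {ε ρ : ℝ}
    {c : ℝ → P × ℝ} (hc : IsRay W r t Ω g A x ε c) (hρ : |ρ| < ε) {s : ℝ} (hs : 0 < s) :
    _root_.normalMap W r t Ω g A (W.ambientDil s (x, ρ)) =
      W.ambientDil s (_root_.normalMap W r t Ω g A (x, ρ)) := by
  rw [hc.normalMap_eq hg ht hA hρ]
  exact (hc.dil hg ht hA hs).normalMap_eq hg ht hA hρ

/-- The rays exist locally uniformly, and depend smoothly on their origin. -/
theorem exists_isRay_normalMap [T2Space P] (hg : IsWeylPreAmbient h Ω g)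
    (ht : IsFibreCoordinate h r t) (hA : IsAccelerationLaw W Ω g A) (x₀ : P) :
    ∃ N : Set P, IsOpen N ∧ x₀ ∈ N ∧ ∃ ε > 0,
      ContMDiffOn (ambientModel F) (ambientModel F) ∞ (normalMap W r t Ω g A)
        (N ×ˢ Ioo (-ε) ε) ∧
      ∀ x ∈ N, IsRay W r t Ω g A x ε (fun ρ ↦ normalMap W r t Ω g A (x, ρ)) := by
  obtain ⟨v, hv, hvt⟩ := exists_contDiffOn_isTransversal hg ht x₀
  set κ := extChartAt 𝓘(ℝ, F) x₀ with hκ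
  set K := extChartAt (ambientModel F) (x₀, (0 : ℝ)) with hK
  have hK0 : K (x₀, 0) = (κ x₀, 0) := ambientChart_apply x₀ 0 (x₀, 0)
  obtain ⟨ε, hε, Y, hY, hYc⟩ := exists_isLawCurve (hg.isSmoothLaw hA) (hg.domain.zero_mem x₀)
    (v (κ x₀))
  rw [← hK, hK0] at hY hYc
  -- The initial data of the ray from `x`, in coordinates: the position `(x, 0)` and its transversal
  -- vector. Smoothness in `x` follows from smoothness of the flow in the initial data.
  let η : P → (F × ℝ) × F × ℝ := fun x ↦ ((κ x, 0), v (κ x))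
  have hκc : ContMDiffOn 𝓘(ℝ, F) 𝓘(ℝ, F) ∞ κ κ.source := by
    rw [hκ, extChartAt_source]
    exact contMDiffOn_extChartAt
  have hη : ContMDiffOn 𝓘(ℝ, F) 𝓘(ℝ, (F × ℝ) × F × ℝ) ∞ η κ.source := by
    refine ContMDiffOn.prodMk_space (ContMDiffOn.prodMk_space hκc contMDiffOn_const) ?_
    exact hv.contMDiffOn.comp hκc fun x hx ↦ κ.map_source hx
  have hso : IsOpen κ.source := isOpen_extChartAt_source x₀
  refine ⟨κ.source ∩ η ⁻¹' Metric.ball ((κ x₀, 0), v (κ x₀)) ε,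
    hη.continuousOn.isOpen_inter_preimage hso Metric.isOpen_ball,
    ⟨mem_extChartAt_source x₀, Metric.mem_ball_self hε⟩, ε, hε, ?_⟩
  have hray : ∀ x ∈ κ.source ∩ η ⁻¹' Metric.ball ((κ x₀, 0), v (κ x₀)) ε,
      IsRay W r t Ω g A x ε (fun ρ ↦ K.symm (Y (η x, ρ))) := by
    rintro x ⟨hx, hxb⟩
    obtain ⟨h1, h2, h3, h4⟩ := hYc (η x) hxb
    have h0 : (0 : ℝ) ∈ Ioo (-ε) ε := by simpa using hε
    have hks : K.symm (κ x, 0) = (x, 0) := by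
      rw [hK, ambientChart_symm_apply, ← hκ, κ.left_inv hx]
    refine ⟨hε, h4, by simp only [h1]; exact hks, ?_⟩
    have hm0 : (η x, (0 : ℝ)) ∈ Metric.ball ((κ x₀, 0), v (κ x₀)) ε ×ˢ Ioo (-ε) ε := ⟨hxb, h0⟩
    have hsm : ContDiffAt ℝ ∞ (fun s ↦ Y (η x, s)) 0 :=
      (hY.contDiffAt ((Metric.isOpen_ball.prod isOpen_Ioo).mem_nhds hm0)).comp 0
        (contDiff_prodMk_right (η x)).contDiffAt
    have h5 := curveVelocity_comp (I := 𝓘(ℝ, F × ℝ)) (I' := ambientModel F) (f := K.symm)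
      (c := fun s ↦ Y (η x, s)) (τ := 0)
      ((contMDiffAt_extChartAt_symm (h3 0 h0).1).mdifferentiableAt (by simp))
      (hsm.contMDiffAt.mdifferentiableAt (by simp))
    have h6 := mfderiv_apply_congr (I := 𝓘(ℝ, F × ℝ)) (I' := ambientModel F) (V := F × ℝ)
      (V' := F × ℝ) K.symm h1 ((curveVelocity_model (fun s ↦ Y (η x, s)) 0).trans h2)
    refine (congrArg (fun v : F × ℝ ↦ IsTransversal W r t g x v) (h5.trans h6)).mpr ?_
    have h7 := hvt (κ x) (κ.map_source hx)
    rwa [κ.left_inv hx] at h7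
  refine ⟨?_, fun x hx ↦ (hray x hx).normalMap hg ht hA⟩
  have h8 : ContMDiffOn (ambientModel F) (ambientModel F) ∞
      (fun z : P × ℝ ↦ K.symm (Y (η z.1, z.2)))
      ((κ.source ∩ η ⁻¹' Metric.ball ((κ x₀, 0), v (κ x₀)) ε) ×ˢ Ioo (-ε) ε) := by
    have h9 : ContMDiffOn (ambientModel F) 𝓘(ℝ, ((F × ℝ) × F × ℝ) × ℝ) ∞
        (fun z : P × ℝ ↦ (η z.1, z.2))
        ((κ.source ∩ η ⁻¹' Metric.ball ((κ x₀, 0), v (κ x₀)) ε) ×ˢ Ioo (-ε) ε) :=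
      ContMDiffOn.prodMk_space (hη.comp contMDiffOn_fst fun z hz ↦ hz.1.1) contMDiffOn_snd
    have h10 := hY.contMDiffOn.comp h9 fun z hz ↦ ⟨hz.1.2, hz.2⟩
    exact (contMDiffOn_extChartAt_symm (x₀, (0 : ℝ))).comp h10 fun z hz ↦
      ((hYc (η z.1) hz.1.2).2.2.1 z.2 hz.2).1
  refine h8.congr fun z hz ↦ ?_
  exact (hray z.1 hz.1).normalMap_eq hg ht hA (abs_lt.2 hz.2)

/-- A vector tangent to `P × {0}` is orthogonal to `T`, while a transversal one has product `t² ≠ 0`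
with it. -/
theorem IsTransversal.snd_ne_zero (hg : IsWeylPreAmbient h Ω g) (ht : IsFibreCoordinate h r t)
    {x : P} {U : F × ℝ} (hU : IsTransversal W r t g x U) : U.2 ≠ 0 := by
  intro h0
  have h1 : ambientForm g (x, 0) U (fundamentalVec W x, 0) = (t x) ^ 2 := hU.fundamental
  have h2 := hg.fundamentalVec_apply x U.1
  rw [hg.symm (hg.domain.zero_mem x), show (U.1, (0 : ℝ)) = U from Prod.ext rfl h0.symm, h1] at h2
  exact pow_ne_zero 2 (ht.pos x).ne' h2

/-- The velocity of a curve in `P × ℝ`, as a vector of the model space. -/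
noncomputable def ambientVelocity (c : ℝ → P × ℝ) (τ : ℝ) : F × ℝ :=
  curveVelocity (ambientModel F) c τ

/-- The derivative of a map fixing `P × {0}` at a point of `P × {0}`. -/
theorem mfderiv_apply_of_id_zero {f : P × ℝ → P × ℝ} {x : P}
    (hf : MDifferentiableAt (ambientModel F) (ambientModel F) f (x, 0))
    (h0 : ∀ x, f (x, 0) = (x, 0)) (w : F) (c : ℝ) :
    (mfderiv (ambientModel F) (ambientModel F) f (x, 0) : F × ℝ →L[ℝ] F × ℝ) (w, c) =
      (w, 0) + c • ambientVelocity (F := F) (fun ρ ↦ f (x, ρ)) 0 := by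
  have h1 : (mfderiv (ambientModel F) (ambientModel F) f (x, 0) : F × ℝ →L[ℝ] F × ℝ) (w, c) =
      (mfderiv 𝓘(ℝ, F) (ambientModel F) (fun y ↦ f (y, 0)) x : F →L[ℝ] F × ℝ) w +
      (mfderiv 𝓘(ℝ, ℝ) (ambientModel F) (fun ρ ↦ f (x, ρ)) 0 : ℝ →L[ℝ] F × ℝ) c :=
    mfderiv_prod_eq_add_apply (v := ((w, c) : F × ℝ)) hf
  have h2 : (mfderiv 𝓘(ℝ, F) (ambientModel F) (fun y ↦ f (y, 0)) x : F →L[ℝ] F × ℝ) =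
      ContinuousLinearMap.inl ℝ F ℝ := by
    have h3 : (fun y ↦ f (y, 0)) = fun y : P ↦ (y, (0 : ℝ)) := funext h0
    rw [h3]
    exact mfderiv_prod_left
  rw [h1, h2]
  refine congrArg₂ (· + ·) rfl ?_
  have h4 : ∀ L : ℝ →L[ℝ] F × ℝ, L c = c • L 1 := fun L ↦ by
    rw [← map_smul, smul_eq_mul, mul_one]
  exact h4 _

/-- The derivative is the identity on the tangent space of `P` and sends `∂_ρ` to a vector outside
it. -/
theorem isInvertible_mfderiv_of_isTransversal (hg : IsWeylPreAmbient h Ω g)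
    (ht : IsFibreCoordinate h r t) {f : P × ℝ → P × ℝ} {x : P}
    (hf : MDifferentiableAt (ambientModel F) (ambientModel F) f (x, 0))
    (h0 : ∀ x, f (x, 0) = (x, 0))
    (hU : IsTransversal W r t g x
      (ambientVelocity (F := F) (fun ρ ↦ f (x, ρ)) 0)) :
    (mfderiv (ambientModel F) (ambientModel F) f (x, 0) :
      F × ℝ →L[ℝ] F × ℝ).IsInvertible := by
  refine isInvertible_of_injective (V := F × ℝ) fun v hv ↦ ?_
  have h1 := mfderiv_apply_of_id_zero hf h0 v.1 v.2
  set U : F × ℝ := ambientVelocity (fun ρ ↦ f (x, ρ)) 0 with hUdef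
  have h2 : ((v.1, 0) : F × ℝ) + v.2 • U = 0 := h1.symm.trans hv
  have h3 : v.2 = 0 := by
    have h4 := congrArg Prod.snd h2
    simp only [Prod.snd_add, Prod.smul_snd, zero_add, smul_eq_mul, Prod.snd_zero] at h4
    exact (mul_eq_zero.1 h4).resolve_right (hU.snd_ne_zero hg ht)
  rw [h3, zero_smul, add_zero] at h2
  have h5 : v.1 = 0 := congrArg Prod.fst h2
  exact Prod.ext h5 h3

end NormalMap

/-! ### Dilatation-invariant neighbourhoods and global injectivity -/

section AmbientDomain

variable {E F M P : Type*}
  [NormedAddCommGroup E] [NormedSpace ℝ E]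
  [NormedAddCommGroup F] [NormedSpace ℝ F]
  [TopologicalSpace M] [ChartedSpace E M] [IsManifold 𝓘(ℝ, E) ∞ M]
  [TopologicalSpace P] [ChartedSpace F P] [IsManifold 𝓘(ℝ, F) ∞ P]

namespace WeylStructure

/-- The saturation of a neighbourhood under dilatations is the preimage of a neighbourhood. -/
theorem exists_isOpen_dil_mem (W : WeylStructure E F M P) (x₀ : P) {N : Set P} (hN : N ∈ 𝓝 x₀) :
    ∃ U : Set M, IsOpen U ∧ W.proj x₀ ∈ U ∧ ∀ x, W.proj x ∈ U → ∃ s, 0 < s ∧ W.dil s x ∈ N := by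
  obtain ⟨U, hU, hx₀, T, hs, htar, h1, h2⟩ := W.locallyTrivial (W.proj x₀)
  let e := T.toOpenPartialHomeomorph
  have hmem : ∀ x, W.proj x ∈ U → x ∈ e.source := fun x hx ↦ by
    change x ∈ T.source
    rw [hs]
    exact hx
  have hfst : ∀ x, W.proj x ∈ U → (e x).1 = W.proj x := fun x hx ↦ h1 x (hmem x hx)
  have hpos : ∀ x, W.proj x ∈ U → 0 < (e x).2 := fun x hx ↦ by
    have h3 : e x ∈ T.target := e.map_source (hmem x hx)
    rw [htar] at h3
    exact h3.2
  have hcont : ContinuousAt (fun m ↦ e.symm (m, (e x₀).2)) (W.proj x₀) := by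
    have h3 : ContinuousAt e.symm (W.proj x₀, (e x₀).2) := by
      have h4 : (W.proj x₀, (e x₀).2) = e x₀ := Prod.ext (hfst x₀ hx₀).symm rfl
      rw [h4]
      exact e.continuousAt_symm (e.map_source (hmem x₀ hx₀))
    exact ContinuousAt.comp (g := e.symm) (f := fun m ↦ (m, (e x₀).2)) h3 (by fun_prop)
  have h0 : e.symm (W.proj x₀, (e x₀).2) = x₀ := by
    rw [← hfst x₀ hx₀]
    exact e.left_inv (hmem x₀ hx₀)
  obtain ⟨U', hU'1, hU'2, hU'3⟩ := mem_nhds_iff.1 (Filter.inter_mem (hU.mem_nhds hx₀)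
    (hcont.preimage_mem_nhds (by rw [h0]; exact hN)))
  -- The factor moves `x` along its fibre to the height of `x₀` in the local trivialization; the
  -- resulting local section through `x₀` lies in `N` over `U'`.
  refine ⟨U', hU'2, hU'3, fun x hx ↦ ⟨(e x₀).2 / (e x).2, ?_, ?_⟩⟩
  · exact div_pos (hpos x₀ hx₀) (hpos x (hU'1 hx).1)
  · have hxU := (hU'1 hx).1
    have hsp := div_pos (hpos x₀ hx₀) (hpos x hxU)
    have hdU : W.proj (W.dil ((e x₀).2 / (e x).2) x) ∈ U := by
      rwa [W.proj_dil _ _ hsp]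
    have h5 : e (W.dil ((e x₀).2 / (e x).2) x) = (W.proj x, (e x₀).2) := by
      refine Prod.ext ?_ ?_
      · rw [hfst _ hdU, W.proj_dil _ _ hsp]
      · refine (h2 _ x hsp (hmem x hxU)).trans ?_
        exact mul_div_cancel₀ _ (hpos x hxU).ne'
    have h6 := e.left_inv (hmem _ hdU)
    rw [h5] at h6
    rw [← h6]
    exact (hU'1 hx).2

/-- The domain is the union of all tubes `π⁻¹(U) × (-ε, ε)` contained in `G`. Tubes are open,
dilatation-invariant and symmetric in `ρ`, which also makes the fibres intervals. -/
theorem exists_isAmbientDomain_subset (W : WeylStructure E F M P) {G : Set (P × ℝ)}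
    (hinv : ∀ s z, 0 < s → z ∈ G → W.ambientDil s z ∈ G) (hn : ∀ x : P, G ∈ 𝓝 (x, (0 : ℝ))) :
    ∃ Ω : Set (P × ℝ), IsAmbientDomain W Ω ∧ Ω ⊆ G ∧ ∀ x, OrdConnected {ρ : ℝ | (x, ρ) ∈ Ω} := by
  refine ⟨{z | ∃ U : Set M, IsOpen U ∧ W.proj z.1 ∈ U ∧ ∃ ε : ℝ, |z.2| < ε ∧
    ∀ y, W.proj y ∈ U → ∀ ρ, |ρ| < ε → (y, ρ) ∈ G}, ⟨?_, ?_, ?_⟩, ?_, ?_⟩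
  · rw [isOpen_iff_mem_nhds]
    rintro ⟨x, ρ⟩ ⟨U, hU, hx, ε, hρ, hG⟩
    have h1 : ∀ᶠ z : P × ℝ in 𝓝 (x, ρ), W.proj z.1 ∈ U :=
      (W.smooth_proj.continuous.comp continuous_fst).continuousAt.preimage_mem_nhds
        (hU.mem_nhds hx)
    have h2 : ∀ᶠ z : P × ℝ in 𝓝 (x, ρ), |z.2| < ε :=
      (continuous_snd.abs.continuousAt (x := (x, ρ))).preimage_mem_nhds (isOpen_Iio.mem_nhds hρ)
    filter_upwards [h1, h2] with z h3 h4
    exact ⟨U, hU, h3, ε, h4, hG⟩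
  · rintro s ⟨x, ρ⟩ hs ⟨U, hU, hx, ε, hρ, hG⟩
    refine ⟨U, hU, ?_, ε, hρ, hG⟩
    change W.proj (W.dil s x) ∈ U
    rwa [W.proj_dil s x hs]
  · intro x
    obtain ⟨N, hN, O, hO, hNO⟩ := mem_nhds_prod_iff.1 (hn x)
    obtain ⟨ε, hε, hεO⟩ := Metric.mem_nhds_iff.1 hO
    obtain ⟨U, hU, hx, hd⟩ := W.exists_isOpen_dil_mem x hN
    refine ⟨U, hU, hx, ε, by simpa using hε, fun y hy ρ hρ ↦ ?_⟩
    obtain ⟨s, hs, hsN⟩ := hd y hy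
    have h1 : W.ambientDil s (y, ρ) ∈ G := hNO ⟨hsN, hεO (by simpa [WeylStructure.ambientDil] using hρ)⟩
    have h2 := hinv s⁻¹ _ (inv_pos.2 hs) h1
    rwa [W.ambientDil_inv hs] at h2
  · rintro ⟨x, ρ⟩ ⟨U, hU, hx, ε, hρ, hG⟩
    exact hG x hx ρ hρ
  · refine fun x ↦ ⟨?_⟩
    rintro a ⟨U, hU, hx, ε, ha, hG⟩ b ⟨U', hU', hx', ε', hb, hG'⟩ c ⟨hac, hcb⟩
    -- A point between `a` and `b` lies in the tube of the endpoint of larger absolute value.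
    rcases abs_le_max_abs_abs hac hcb |>.trans_eq (max_def _ _) with h
    split_ifs at h with hab
    · exact ⟨U', hU', hx', ε', h.trans_lt hb, hG'⟩
    · exact ⟨U, hU, hx, ε, h.trans_lt ha, hG⟩

/-- An equivariant map which is injective near a point is injective near its orbit. -/
theorem exists_injOn_saturated (W : WeylStructure E F M P) {t : P → ℝ} (htc : Continuous t)
    (htp : ∀ x, 0 < t x) (htd : ∀ s x, 0 < s → t (W.dil s x) = t x * s) {f : P × ℝ → P × ℝ}
    (hf : ∀ s z, 0 < s → f (W.ambientDil s z) = W.ambientDil s (f z)) {x₀ : P}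
    (hfc : ContinuousAt f (x₀, 0)) {O : Set (P × ℝ)} (hO : O ∈ 𝓝 (x₀, (0 : ℝ)))
    (hinj : InjOn f O) :
    ∃ U : Set M, IsOpen U ∧ W.proj x₀ ∈ U ∧ ∃ ε > 0,
      InjOn f {z | W.proj z.1 ∈ U ∧ |z.2| < ε} := by
  -- For points `δ_a z`, `δ_b z'` with `f z = f z'` this ratio is `a / b`. It recovers the relative
  -- dilatation continuously and is close to `1` near `x₀`.
  let k : (P × ℝ) × (P × ℝ) → ℝ := fun w ↦ t (f w.1).1 / t (f w.2).1
  have hk : ContinuousAt k ((x₀, 0), (x₀, 0)) := by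
    have h1 : ContinuousAt (fun z ↦ t (f z).1) (x₀, (0 : ℝ)) :=
      htc.continuousAt.comp (f := fun z ↦ (f z).1) hfc.fst
    exact (h1.comp_of_eq continuousAt_fst rfl).div (h1.comp_of_eq continuousAt_snd rfl)
      (htp _).ne'
  have hk1 : k ((x₀, 0), (x₀, 0)) = 1 := div_self (htp _).ne'
  have hd : ContinuousAt (fun w ↦ W.ambientDil (k w) w.2) ((x₀, (0 : ℝ)), (x₀, (0 : ℝ))) := by
    have h1 : ContinuousAt (fun z : ℝ × P ↦ W.dil z.1 z.2) (k ((x₀, 0), (x₀, 0)), x₀) := by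
      rw [hk1]
      exact (W.contMDiffAt_dil one_pos x₀).continuousAt
    have h2 : ContinuousAt (fun w : (P × ℝ) × (P × ℝ) ↦ w.2.1) ((x₀, (0 : ℝ)), (x₀, (0 : ℝ))) := by
      fun_prop
    have h3 : ContinuousAt (fun w : (P × ℝ) × (P × ℝ) ↦ w.2.2) ((x₀, (0 : ℝ)), (x₀, (0 : ℝ))) := by
      fun_prop
    exact ContinuousAt.prodMk (ContinuousAt.comp (g := fun z : ℝ × P ↦ W.dil z.1 z.2)
      (f := fun w ↦ (k w, w.2.1)) h1 (hk.prodMk h2)) h3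
  have hd1 : W.ambientDil (k ((x₀, 0), (x₀, 0))) (x₀, 0) = (x₀, 0) := by
    rw [hk1]
    exact Prod.ext (W.dil_one x₀) rfl
  have hev : ∀ᶠ w : (P × ℝ) × (P × ℝ) in 𝓝 ((x₀, 0), (x₀, 0)), W.ambientDil (k w) w.2 ∈ O :=
    hd.preimage_mem_nhds (by rw [hd1]; exact hO)
  rw [nhds_prod_eq] at hev
  obtain ⟨N₀, hN₀, hN₀'⟩ := Filter.eventually_prod_self_iff'.1 hev
  obtain ⟨N, hN, O', hO', hNO⟩ := mem_nhds_prod_iff.1 (Filter.inter_mem hN₀ hO)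
  obtain ⟨ε, hε, hεO⟩ := Metric.mem_nhds_iff.1 hO'
  obtain ⟨U, hU, hx, hdU⟩ := W.exists_isOpen_dil_mem x₀ hN
  refine ⟨U, hU, hx, ε, hε, ?_⟩
  rintro z ⟨hz, hzε⟩ z' ⟨hz', hzε'⟩ hzz
  obtain ⟨a, ha, haN⟩ := hdU z.1 hz
  obtain ⟨b, hb, hbN⟩ := hdU z'.1 hz'
  have h1 : W.ambientDil a z ∈ N₀ ∩ O := hNO ⟨haN, hεO (by simpa [WeylStructure.ambientDil] using hzε)⟩
  have h2 : W.ambientDil b z' ∈ N₀ ∩ O := hNO ⟨hbN, hεO (by simpa [WeylStructure.ambientDil] using hzε')⟩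
  have h3 : k (W.ambientDil a z, W.ambientDil b z') = a / b := by
    simp only [k]
    rw [hf a z ha, hf b z' hb, hzz]
    change t (W.dil a (f z').1) / t (W.dil b (f z').1) = _
    rw [htd a _ ha, htd b _ hb]
    have := (htp (f z').1).ne'
    field_simp
  -- The factor that brings `z'` near `x₀` need not be the one used for `z`. Rescaling `δ_b z'` by
  -- `a / b` brings both points into `O` with the same factor `a`, so local injectivity applies.
  have h4 : W.ambientDil a z' ∈ O := by
    have h5 := hN₀' _ h1.1 _ h2.1
    rw [h3] at h5
    have h6 : W.ambientDil (a / b) (W.ambientDil b z') = W.ambientDil a z' := by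
      refine Prod.ext ?_ rfl
      change W.dil (a / b) (W.dil b z'.1) = W.dil a z'.1
      rw [← W.dil_mul _ _ _ (div_pos ha hb) hb, div_mul_cancel₀ _ hb.ne']
    rwa [h6] at h5
  have h7 : W.ambientDil a z = W.ambientDil a z' :=
    hinj h1.2 h4 (by rw [hf a z ha, hf a z' ha, hzz])
  have h8 := congrArg (W.ambientDil a⁻¹) h7
  rwa [W.ambientDil_inv ha, W.ambientDil_inv ha] at h8

/-- An equivariant map which is locally injective near `P × {0}` and fixes it is injective on a
dilatation-invariant neighbourhood. -/
theorem exists_injOn_of_locally (W : WeylStructure E F M P) [FiniteDimensional ℝ E] [T2Space M]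
    [SecondCountableTopology M] {t : P → ℝ}
    (htc : Continuous t) (htp : ∀ x, 0 < t x) (htd : ∀ s x, 0 < s → t (W.dil s x) = t x * s)
    {f : P × ℝ → P × ℝ} (hf : ∀ s z, 0 < s → f (W.ambientDil s z) = W.ambientDil s (f z))
    (hf0 : ∀ x, f (x, 0) = (x, 0)) (hfc : ∀ x, ContinuousAt f (x, 0))
    (hinj : ∀ x : P, ∃ O ∈ 𝓝 (x, (0 : ℝ)), InjOn f O) :
    ∃ G : Set (P × ℝ), (∀ s z, 0 < s → z ∈ G → W.ambientDil s z ∈ G) ∧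
      (∀ x : P, G ∈ 𝓝 (x, (0 : ℝ))) ∧ InjOn f G := by
  have : LocallyCompactSpace M := ChartedSpace.locallyCompactSpace E M
  have : TopologicalSpace.MetrizableSpace M := Manifold.metrizableSpace 𝓘(ℝ, E) M
  let _ : MetricSpace M := TopologicalSpace.metrizableSpaceMetric M
  have hsurj : ∀ m : M, ∃ x : P, W.proj x = m := by
    intro m
    obtain ⟨U, hU, hm, T, hs, htar, h1, -⟩ := W.locallyTrivial m
    let e := T.toOpenPartialHomeomorph
    have h2 : (m, (1 : ℝ)) ∈ e.target := by
      change (m, (1 : ℝ)) ∈ T.target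
      rw [htar]
      exact ⟨hm, (one_pos : (0 : ℝ) < 1)⟩
    refine ⟨e.symm (m, 1), (h1 _ (e.map_target h2)).symm.trans ?_⟩
    exact congrArg Prod.fst (e.right_inv h2)
  let S : M → ℝ → Set (P × ℝ) := fun m c ↦ {z | W.proj z.1 ∈ Metric.ball m c ∧ |z.2| < c}
  have hSmono : ∀ m c c', c ≤ c' → S m c ⊆ S m c' := fun m c c' hc z hz ↦
    ⟨Metric.ball_subset_ball hc hz.1, hz.2.trans_le hc⟩
  -- A continuous positive radius `R` on `M` such that `f` is injective over the ball of radius `R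
  -- m` about `m`, for `|ρ| < R m`. The admissible radii at each `m` form an interval, hence a
  -- convex set, and locally a constant radius is admissible.
  obtain ⟨R, hR⟩ := exists_continuous_forall_mem_convex_of_local_const
    (t := fun m : M ↦ {c : ℝ | 0 < c ∧ InjOn f (S m c)}) (fun m ↦ by
      refine OrdConnected.convex ⟨?_⟩
      rintro a ⟨ha, -⟩ b ⟨-, hb⟩ c ⟨hac, hcb⟩
      exact ⟨ha.trans_le hac, hb.mono (hSmono m c b hcb)⟩) (fun m ↦ by
      obtain ⟨x, rfl⟩ := hsurj m
      obtain ⟨O, hO, hOi⟩ := hinj x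
      obtain ⟨U, hU, hxU, ε, hε, hUi⟩ := W.exists_injOn_saturated htc htp htd hf (hfc x) hO hOi
      obtain ⟨δ, hδ, hδU⟩ := Metric.isOpen_iff.1 hU _ hxU
      refine ⟨min (δ / 2) ε, ?_⟩
      filter_upwards [Metric.ball_mem_nhds (W.proj x) (half_pos hδ)] with m hm
      refine ⟨lt_min (half_pos hδ) hε, hUi.mono ?_⟩
      rintro z ⟨hz1, hz2⟩
      refine ⟨hδU ?_, hz2.trans_le (min_le_right _ _)⟩
      have h1 := Metric.mem_ball.1 hz1
      have h2 := Metric.mem_ball.1 hm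
      have h3 := min_le_left (δ / 2) ε
      rw [Metric.mem_ball]
      linarith [dist_triangle (W.proj z.1) m (W.proj x)])
  -- Two points with the same image have base points within `R / 4 + R / 4` of each other, `R` being
  -- the larger of their radii. Both then lie in the region belonging to that radius, where `f` is
  -- injective.
  refine ⟨{z | |z.2| < R (W.proj z.1) / 4 ∧
    dist (W.proj (f z).1) (W.proj z.1) < R (W.proj z.1) / 4}, ?_, ?_, ?_⟩
  · rintro s z hs ⟨h1, h2⟩
    have h3 : W.proj (W.ambientDil s z).1 = W.proj z.1 := W.proj_dil s z.1 hs
    have h4 : W.proj (W.ambientDil s (f z)).1 = W.proj (f z).1 := W.proj_dil s (f z).1 hs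
    refine ⟨?_, ?_⟩
    · rw [h3]
      exact h1
    · rw [h3, hf s z hs, h4]
      exact h2
  · intro x
    have hπ : Continuous fun z : P × ℝ ↦ W.proj z.1 := W.smooth_proj.continuous.comp continuous_fst
    have hRc : ContinuousAt (fun z : P × ℝ ↦ R (W.proj z.1) / 4) (x, 0) :=
      ((R.continuous.comp hπ).div_const 4).continuousAt
    have hR0 : 0 < R (W.proj x) / 4 := div_pos (hR _).1 (by norm_num)
    have h1 : ∀ᶠ z : P × ℝ in 𝓝 (x, 0), |z.2| < R (W.proj z.1) / 4 :=
      continuous_snd.abs.continuousAt.eventually_lt hRc (by simpa using hR0)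
    have h2 : ContinuousAt (fun z : P × ℝ ↦ dist (W.proj (f z).1) (W.proj z.1)) (x, 0) :=
      Filter.Tendsto.dist (W.smooth_proj.continuous.continuousAt.comp (f := fun z ↦ (f z).1)
        (hfc x).fst) hπ.continuousAt
    have h3 : ∀ᶠ z : P × ℝ in 𝓝 (x, 0),
        dist (W.proj (f z).1) (W.proj z.1) < R (W.proj z.1) / 4 :=
      h2.eventually_lt hRc (by rw [hf0]; simpa using hR0)
    exact h1.and h3
  · have key : ∀ z z' : P × ℝ, |z.2| < R (W.proj z.1) / 4 →
        dist (W.proj (f z).1) (W.proj z.1) < R (W.proj z.1) / 4 → |z'.2| < R (W.proj z'.1) / 4 →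
        dist (W.proj (f z').1) (W.proj z'.1) < R (W.proj z'.1) / 4 →
        R (W.proj z'.1) ≤ R (W.proj z.1) → f z = f z' → z = z' := by
      intro z z' h1 h2 h3 h4 hle hzz
      have hpos := (hR (W.proj z.1)).1
      refine (hR (W.proj z.1)).2 ⟨Metric.mem_ball_self hpos, by linarith⟩ ⟨?_, by linarith⟩ hzz
      rw [← hzz] at h4
      rw [Metric.mem_ball]
      have h5 := dist_triangle (W.proj z'.1) (W.proj (f z).1) (W.proj z.1)
      rw [dist_comm (W.proj z'.1) (W.proj (f z).1)] at h5
      linarith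
    rintro z ⟨h1, h2⟩ z' ⟨h3, h4⟩ hzz
    rcases le_total (R (W.proj z'.1)) (R (W.proj z.1)) with hle | hle
    · exact key z z' h1 h2 h3 h4 hle hzz
    · exact (key z' z h3 h4 h1 h2 hle hzz.symm).symm

end WeylStructure

end AmbientDomain

theorem HasSignature.comp {V : Type*} [AddCommGroup V] [Module ℝ V] [TopologicalSpace V]
    {B B' : V →L[ℝ] V →L[ℝ] ℝ} {p q : ℕ} (h : HasSignature B p q) {L : V →L[ℝ] V}
    (hL : L.IsInvertible) (hB : ∀ u v, B' u v = B (L u) (L v)) : HasSignature B' p q := by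
  obtain ⟨b, h0, h1, h2⟩ := h
  obtain ⟨e, rfl⟩ := hL
  have he : ∀ i, (e : V →L[ℝ] V) ((b.map e.toLinearEquiv.symm) i) = b i := fun i ↦ by
    simp
  refine ⟨b.map e.toLinearEquiv.symm, fun i j hij ↦ ?_, fun i ↦ ?_, fun j ↦ ?_⟩
  · rw [hB, he, he, h0 i j hij]
  · rw [hB, he, h1]
  · rw [hB, he, h2]

/-! ### Normalising maps and the Weyl-normal form -/

section Normalisation

variable {E F M P : Type*}
  [NormedAddCommGroup E] [NormedSpace ℝ E]
  [NormedAddCommGroup F] [NormedSpace ℝ F] [FiniteDimensional ℝ F]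
  [TopologicalSpace M] [ChartedSpace E M] [IsManifold 𝓘(ℝ, E) ∞ M]
  [TopologicalSpace P] [ChartedSpace F P] [IsManifold 𝓘(ℝ, F) ∞ P]
  {p q : ℕ} {W : WeylStructure E F M P} {C : WeylClass E M p q} {h : MetricBundleIso W C}
  {r : WeylPair E M p q} {t : P → ℝ} {Ω Ω' : Set (P × ℝ)}
  {g : BilinField (ambientModel F) (P × ℝ)}
  {A : ∀ z : P × ℝ, TangentSpace (ambientModel F) z → TangentSpace (ambientModel F) z}

/-- The derivative of a map of `P × ℝ`, as a map of the model space. -/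
noncomputable def ambientDeriv (f : P × ℝ → P × ℝ) (z : P × ℝ) : F × ℝ →L[ℝ] F × ℝ :=
  mfderiv (ambientModel F) (ambientModel F) f z

/-- The map `f` carries the curves `ρ ↦ (x, ρ)` in `Ω'` to the law curves with transversal initial
velocity. -/
structure IsNormalisation (W : WeylStructure E F M P) (r : WeylPair E M p q) (t : P → ℝ)
    (Ω : Set (P × ℝ)) (g : BilinField (ambientModel F) (P × ℝ))
    (A : ∀ z : P × ℝ, TangentSpace (ambientModel F) z → TangentSpace (ambientModel F) z)
    (Ω' : Set (P × ℝ)) (f : P × ℝ → P × ℝ) : Prop where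
  smooth : ∀ z ∈ Ω', ContMDiffAt (ambientModel F) (ambientModel F) ∞ f z
  isInvertible : ∀ z ∈ Ω', (ambientDeriv (F := F) f z).IsInvertible
  mem : ∀ z ∈ Ω', f z ∈ Ω
  comm_dil : ∀ s z, 0 < s → z ∈ Ω' → f (W.ambientDil s z) = W.ambientDil s (f z)
  id_zero : ∀ x, f (x, 0) = (x, 0)
  obeys : ∀ x ρ, (x, ρ) ∈ Ω' → ObeysLawAt g A (fun ρ ↦ f (x, ρ)) ρ
  velocity : ∀ x, IsTransversal W r t g x (ambientVelocity (F := F) (fun ρ ↦ f (x, ρ)) 0)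

theorem normalMap_ambientDil [T2Space P] (hg : IsWeylPreAmbient h Ω g)
    (ht : IsFibreCoordinate h r t) (hA : IsAccelerationLaw W Ω g A) {s : ℝ} (z : P × ℝ)
    (hs : 0 < s) :
    normalMap W r t Ω g A (W.ambientDil s z) = W.ambientDil s (normalMap W r t Ω g A z) := by
  by_cases H : ∃ c : ℝ → P × ℝ, ∃ ε, IsRay W r t Ω g A z.1 ε c ∧ |z.2| < ε
  · obtain ⟨c, ε, hc, hρ⟩ := H
    exact hc.normalMap_dil hg ht hA hρ hs
  · have H' : ¬ ∃ c : ℝ → P × ℝ, ∃ ε,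
        IsRay W r t Ω g A (W.ambientDil s z).1 ε c ∧ |(W.ambientDil s z).2| < ε := by
      rintro ⟨c, ε, hc, hρ⟩
      have h1 := hc.dil hg ht hA (inv_pos.2 hs)
      have h2 : W.dil s⁻¹ (W.ambientDil s z).1 = z.1 := W.dil_inv hs z.1
      rw [h2] at h1
      exact H ⟨_, ε, h1, hρ⟩
    rw [normalMap, dif_neg H', normalMap, dif_neg H]

theorem normalMap_zero [T2Space P] (hg : IsWeylPreAmbient h Ω g)
    (ht : IsFibreCoordinate h r t) (hA : IsAccelerationLaw W Ω g A) (x : P) :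
    normalMap W r t Ω g A (x, 0) = (x, 0) := by
  obtain ⟨N, -, hx, ε, -, -, hr⟩ := exists_isRay_normalMap hg ht hA x
  exact (hr x hx).start

/-- The normal map is restricted to a domain on which the rays exist, the map is a local
diffeomorphism and it is injective. Each condition holds on a dilatation-invariant neighbourhood of
`P × {0}`, and the intersection contains an ambient domain with interval fibres. -/
theorem exists_isNormalisation [FiniteDimensional ℝ E] [T2Space M] [SecondCountableTopology M]
    [T2Space P] (hg : IsWeylPreAmbient h Ω g) (ht : IsFibreCoordinate h r t)
    (hA : IsAccelerationLaw W Ω g A) :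
    ∃ Ω' : Set (P × ℝ), IsAmbientDomain W Ω' ∧ (∀ x, OrdConnected {ρ : ℝ | (x, ρ) ∈ Ω'}) ∧
      ∃ f : P × ℝ → P × ℝ, InjOn f Ω' ∧ IsNormalisation W r t Ω g A Ω' f := by
  set f := normalMap W r t Ω g A with hf
  have hcomm : ∀ s z, 0 < s → f (W.ambientDil s z) = W.ambientDil s (f z) := fun s z hs ↦
    normalMap_ambientDil hg ht hA z hs
  have hf0 : ∀ x, f (x, 0) = (x, 0) := normalMap_zero hg ht hA
  let G : Set (P × ℝ) := {z | (∃ ε, |z.2| < ε ∧ IsRay W r t Ω g A z.1 ε (fun ρ ↦ f (z.1, ρ))) ∧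
    ContMDiffAt (ambientModel F) (ambientModel F) ∞ f z ∧ (ambientDeriv (F := F) f z).IsInvertible}
  have hGn : ∀ x : P, G ∈ 𝓝 (x, (0 : ℝ)) := by
    intro x
    obtain ⟨N, hN, hx, ε, hε, hsm, hr⟩ := exists_isRay_normalMap hg ht hA x
    have hopen : IsOpen (N ×ˢ Ioo (-ε) ε) := hN.prod isOpen_Ioo
    have hx0 : (x, (0 : ℝ)) ∈ N ×ˢ Ioo (-ε) ε := ⟨hx, by simpa using hε⟩
    have hx1 := hsm.contMDiffAt (hopen.mem_nhds hx0)
    have hinv := eventually_isInvertible_mfderiv hx1 (isInvertible_mfderiv_of_isTransversal hg ht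
      (hx1.mdifferentiableAt (by simp)) hf0 (hr x hx).velocity)
    filter_upwards [hopen.mem_nhds hx0, hinv] with z hz hzi
    exact ⟨⟨ε, abs_lt.2 hz.2, hr z.1 hz.1⟩, hsm.contMDiffAt (hopen.mem_nhds hz), hzi⟩
  have hGinv : ∀ s z, 0 < s → z ∈ G → W.ambientDil s z ∈ G := by
    rintro s z hs ⟨⟨ε, hε, hray⟩, hsm, hi⟩
    -- Conjugation by a dilatation transports smoothness and invertibility of the derivative from
    -- `z` to its dilate.
    have hfeq : f = W.ambientDil s ∘ f ∘ W.ambientDil s⁻¹ := by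
      funext y
      simp only [Function.comp_apply]
      rw [hcomm _ _ (inv_pos.2 hs), W.ambientDil_inv' hs]
    have hback : W.ambientDil s⁻¹ (W.ambientDil s z) = z := W.ambientDil_inv hs z
    have hd1 := W.contMDiff_ambientDil (inv_pos.2 hs) (W.ambientDil s z)
    have hsm' : ContMDiffAt (ambientModel F) (ambientModel F) ∞ f
        (W.ambientDil s⁻¹ (W.ambientDil s z)) := by rwa [hback]
    have hd2 := W.contMDiff_ambientDil hs (f (W.ambientDil s⁻¹ (W.ambientDil s z)))
    refine ⟨⟨ε, hε, ?_⟩, ?_, ?_⟩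
    · refine (hray.dil hg ht hA hs).congr fun ρ _ ↦ ?_
      exact hcomm s (z.1, ρ) hs
    · rw [hfeq]
      exact ContMDiffAt.comp (W.ambientDil s z) (g := W.ambientDil s) (f := f ∘ W.ambientDil s⁻¹)
        hd2 (hsm'.comp _ hd1)
    · have h1 := mfderiv_comp (W.ambientDil s z) (hd2.mdifferentiableAt (by simp))
        ((hsm'.comp _ hd1).mdifferentiableAt (by simp))
      have h2 := mfderiv_comp (W.ambientDil s z) (hsm'.mdifferentiableAt (by simp))
        (hd1.mdifferentiableAt (by simp))
      have h3 : ambientDeriv (F := F) f (W.ambientDil s z) =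
          (ambientDilDeriv W s (f (W.ambientDil s⁻¹ (W.ambientDil s z)))).comp
          ((ambientDeriv (F := F) f (W.ambientDil s⁻¹ (W.ambientDil s z))).comp
          (ambientDilDeriv W s⁻¹ (W.ambientDil s z))) := by
        refine Eq.trans ?_ (h1.trans (congrArg (fun L : F × ℝ →L[ℝ] F × ℝ ↦
          (ambientDilDeriv W s (f (W.ambientDil s⁻¹ (W.ambientDil s z)))).comp L) h2))
        exact congrArg (fun f ↦ ambientDeriv (F := F) f (W.ambientDil s z)) hfeq
      rw [h3, hback]
      exact (W.isInvertible_mfderiv_ambientDil hs _ : (ambientDilDeriv W s _).IsInvertible).comp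
        (hi.comp (W.isInvertible_mfderiv_ambientDil (inv_pos.2 hs) _ :
          (ambientDilDeriv W s⁻¹ _).IsInvertible))
  obtain ⟨G', hG'inv, hG'n, hinj⟩ := W.exists_injOn_of_locally ht.smooth.continuous ht.pos ht.dil
    hcomm hf0 (fun x ↦ (mem_of_mem_nhds (hGn x)).2.1.continuousAt) (fun x ↦
      have : CompleteSpace (F × ℝ) := FiniteDimensional.complete ℝ (F × ℝ)
      exists_injOn_of_isInvertible_mfderiv (mem_of_mem_nhds (hGn x)).2.1
        (mem_of_mem_nhds (hGn x)).2.2)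
  obtain ⟨Ω', hΩ', hsub, hord⟩ := W.exists_isAmbientDomain_subset (G := G ∩ G')
    (fun s z hs hz ↦ ⟨hGinv s z hs hz.1, hG'inv s z hs hz.2⟩)
    (fun x ↦ Filter.inter_mem (hGn x) (hG'n x))
  have hG : ∀ z ∈ Ω', z ∈ G := fun z hz ↦ (hsub hz).1
  refine ⟨Ω', hΩ', hord, f, hinj.mono fun z hz ↦ (hsub hz).2, fun z hz ↦ (hG z hz).2.1,
    fun z hz ↦ (hG z hz).2.2, fun z hz ↦ ?_, fun s z hs _ ↦ hcomm s z hs, hf0,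
    fun x ρ hz ↦ ?_, fun x ↦ ?_⟩
  · obtain ⟨ε, hε, hr⟩ := (hG z hz).1
    exact hr.curve.mem z.2 (abs_lt.1 hε)
  · obtain ⟨ε, hε, hr⟩ := (hG _ hz).1
    exact hr.curve.obeys ρ (abs_lt.1 hε)
  · obtain ⟨ε, hε, hr⟩ := (hG _ (hΩ'.zero_mem x)).1
    exact hr.velocity

namespace IsNormalisation

variable {f f' : P × ℝ → P × ℝ}

theorem isLawCurve (hf : IsNormalisation W r t Ω g A Ω' f) (x : P) :
    IsLawCurve g A Ω (fun ρ ↦ f (x, ρ)) {ρ | (x, ρ) ∈ Ω'} where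
  smooth ρ hρ := ((hf.smooth (x, ρ) hρ).comp ρ
    (contMDiffAt_const.prodMk contMDiffAt_id)).contMDiffWithinAt
  mem ρ hρ := hf.mem (x, ρ) hρ
  obeys ρ hρ := hf.obeys x ρ hρ

/-- Interval fibres are essential: both maps follow law curves with the same initial data on a
connected parameter set containing `0`. -/
theorem eqOn [T2Space P] (hg : IsWeylPreAmbient h Ω g) (ht : IsFibreCoordinate h r t)
    (hA : IsAccelerationLaw W Ω g A) (hΩ' : IsAmbientDomain W Ω')
    (hord : ∀ x, OrdConnected {ρ : ℝ | (x, ρ) ∈ Ω'}) (hf : IsNormalisation W r t Ω g A Ω' f)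
    (hf' : IsNormalisation W r t Ω g A Ω' f') : EqOn f f' Ω' := by
  rintro ⟨x, ρ⟩ hz
  have hopen : IsOpen {ρ : ℝ | (x, ρ) ∈ Ω'} :=
    hΩ'.isOpen.preimage (Continuous.prodMk_right x)
  exact isLawCurve_eqOn_of_isTransversal hg ht hA hopen (hord x).isPreconnected (hΩ'.zero_mem x)
    (hf.isLawCurve x) (hf.id_zero x) (hf.velocity x) (hf'.isLawCurve x) (hf'.id_zero x)
    (hf'.velocity x) hz

end IsNormalisation

/-- The vector `∂_ρ` in the model space is the velocity of `ρ ↦ (x, ρ)`. -/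
theorem curveVelocity_rho (x : P) (ρ : ℝ) :
    (curveVelocity (ambientModel F) (fun σ : ℝ ↦ (x, σ)) ρ : F × ℝ) = (0, 1) := by
  have h1 : (mfderiv 𝓘(ℝ, ℝ) (ambientModel F) (fun σ : ℝ ↦ (x, σ)) ρ : ℝ →L[ℝ] F × ℝ) =
      ContinuousLinearMap.inr ℝ F ℝ := mfderiv_prod_right
  exact congrArg (fun l : ℝ →L[ℝ] F × ℝ ↦ l 1) h1

theorem contMDiffAt_rho (x : P) (ρ : ℝ) :
    ContMDiffAt 𝓘(ℝ, ℝ) (ambientModel F) ∞ (fun σ : ℝ ↦ (x, σ)) ρ :=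
  contMDiffAt_const.prodMk contMDiffAt_id

theorem ambientVelocity_eq {f : P × ℝ → P × ℝ} {x : P} {ρ : ℝ}
    (hf : ContMDiffAt (ambientModel F) (ambientModel F) ∞ f (x, ρ)) :
    ambientVelocity (F := F) (fun σ ↦ f (x, σ)) ρ = ambientDeriv f (x, ρ) (0, 1) := by
  have h1 := curveVelocity_comp (hf.mdifferentiableAt (by simp))
    ((contMDiffAt_rho (F := F) x ρ).mdifferentiableAt (by simp))
  exact h1.trans (congrArg (ambientDeriv (F := F) f (x, ρ)) (curveVelocity_rho x ρ))

theorem ambientForm_pullbackBilin (f : P × ℝ → P × ℝ) (z : P × ℝ) (u v : F × ℝ) :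
    ambientForm (pullbackBilin (I := ambientModel F) (I' := ambientModel F) f g) z u v =
      ambientForm g (f z) (ambientDeriv f z u) (ambientDeriv f z v) := rfl

theorem acceleration_pullback_rho (hg : IsWeylPreAmbient h Ω g) {f : P × ℝ → P × ℝ} {x : P}
    {ρ : ℝ} (hf : ContMDiffAt (ambientModel F) (ambientModel F) ∞ f (x, ρ))
    (hi : (ambientDeriv (F := F) f (x, ρ)).IsInvertible) (hm : f (x, ρ) ∈ Ω) :
    (acceleration g (fun σ ↦ f (x, σ)) ρ : F × ℝ) = ambientDeriv f (x, ρ)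
      (acceleration (I := ambientModel F) (pullbackBilin (I := ambientModel F)
        (I' := ambientModel F) f g) (fun σ ↦ (x, σ)) ρ : F × ℝ) := by
  have hsm := (smoothBilinOn_iff hg.domain.isOpen).1 hg.smooth (f (x, ρ)) _
    (mem_extChartAt_target _) (by rwa [extChartAt_to_inv])
  exact acceleration_comp (c := fun σ : ℝ ↦ (x, σ)) hf hi (contMDiffAt_rho x ρ) hsm (hg.symm hm)
    (hg.isInvertible hm)

/-- The acceleration of the curves `ρ ↦ (x, ρ)` prescribed by the law `A` through `f`. -/
noncomputable def pulledAcceleration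
    (A : ∀ z : P × ℝ, TangentSpace (ambientModel F) z → TangentSpace (ambientModel F) z)
    (f : P × ℝ → P × ℝ) (z : P × ℝ) : F × ℝ :=
  (ambientDeriv (F := F) f z).inverse (A (f z) (ambientDeriv (F := F) f z (0, 1)))

namespace IsNormalisation

variable {f : P × ℝ → P × ℝ}

theorem ambientDeriv_pulledAcceleration (hf : IsNormalisation W r t Ω g A Ω' f) {z : P × ℝ}
    (hz : z ∈ Ω') : ambientDeriv (F := F) f z (pulledAcceleration A f z) =
      A (f z) (ambientDeriv (F := F) f z (0, 1)) :=
  (hf.isInvertible z hz).self_apply_inverse _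

theorem ambientDeriv_zero (hf : IsNormalisation W r t Ω g A Ω' f) (hΩ' : IsAmbientDomain W Ω')
    (x : P) (w : F) (c : ℝ) : ambientDeriv (F := F) f (x, 0) (w, c) =
      (w, 0) + c • ambientVelocity (F := F) (fun ρ ↦ f (x, ρ)) 0 :=
  mfderiv_apply_of_id_zero ((hf.smooth _ (hΩ'.zero_mem x)).mdifferentiableAt (by simp)) hf.id_zero
    w c

/-- The derivative sends `(w, c)` to `w + c U`. Expanding, the mixed terms are `t² n(w) c` and the
term in `c₁ c₂` vanishes because `U` is null. -/
theorem pullback_zero (hg : IsWeylPreAmbient h Ω g) (ht : IsFibreCoordinate h r t)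
    (hf : IsNormalisation W r t Ω g A Ω' f) (hΩ' : IsAmbientDomain W Ω') (x : P) (w₁ w₂ : F)
    (c₁ c₂ : ℝ) :
    ambientForm (pullbackBilin (I := ambientModel F) (I' := ambientModel F) f g) (x, 0)
      (w₁, c₁) (w₂, c₂) = tautological h x w₁ w₂ +
        (t x) ^ 2 * (connectionCLM W r t x w₁ * c₂ + connectionCLM W r t x w₂ * c₁) := by
  have h1 := (isTransversal_iff_isNullSolution ht x _).1 (hf.velocity x)
  rw [ambientForm_pullbackBilin, hf.ambientDeriv_zero hΩ', hf.ambientDeriv_zero hΩ', hf.id_zero]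
  set U := ambientVelocity (F := F) (fun ρ ↦ f (x, ρ)) 0 with hU
  have h2 : ambientForm g (x, 0) (w₁, 0) (w₂, 0) = tautological h x w₁ w₂ := hg.initial x w₁ w₂
  have h3 := h1.1 w₂
  have h4 := h1.1 w₁
  rw [hg.symm (hg.domain.zero_mem x)] at h4
  simp only [map_add, map_smul, add_apply, smul_apply, h2, h3, h4, h1.2, smul_eq_mul]
  ring

theorem isWeylNormalForm (hg : IsWeylPreAmbient h Ω g) (ht : IsFibreCoordinate h r t)
    (hA : IsAccelerationLaw W Ω g A) (hΩ' : IsAmbientDomain W Ω')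
    (hord : ∀ x, OrdConnected {ρ : ℝ | (x, ρ) ∈ Ω'}) (hf : IsNormalisation W r t Ω g A Ω' f) :
    IsWeylNormalForm h r t Ω'
      (pullbackBilin (I := ambientModel F) (I' := ambientModel F) f g)
      (fun z ↦ pulledAcceleration A f z) := by
  refine ⟨⟨hΩ', fun x w₁ w₂ ↦ ?_, ?_, fun z hz ↦ ?_, fun s z hs hz ↦ ?_⟩, hord, fun x ρ hz ↦ ?_,
    fun z hz ↦ ?_, fun x w₁ w₂ c₁ c₂ ↦ hf.pullback_zero hg ht hΩ' x w₁ w₂ c₁ c₂⟩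
  · refine (hf.pullback_zero hg ht hΩ' x w₁ w₂ 0 0).trans ?_
    rw [mul_zero, mul_zero, add_zero, mul_zero, add_zero]
  · exact hg.smooth.pullbackBilin hΩ'.isOpen hg.domain.isOpen
      (fun z hz ↦ (hf.smooth z hz).contMDiffWithinAt) hf.mem
  · exact (hg.hasSignature_ambientForm (hf.mem z hz)).comp (hf.isInvertible z hz)
      (ambientForm_pullbackBilin f z)
  · have hz' := hΩ'.dil_mem s z hs hz
    have hd := (W.contMDiff_ambientDil hs z).mdifferentiableAt (n := ∞) (by simp)
    have hd' := (W.contMDiff_ambientDil hs (f z)).mdifferentiableAt (n := ∞) (by simp)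
    have h1 := mfderiv_comp z ((hf.smooth _ hz').mdifferentiableAt (by simp)) hd
    have h2 := mfderiv_comp z hd' ((hf.smooth z hz).mdifferentiableAt (by simp))
    -- Equivariance is known on `Ω'` only, which suffices near `z` for comparing derivatives.
    have hev : f ∘ W.ambientDil s =ᶠ[𝓝 z] W.ambientDil s ∘ f := by
      filter_upwards [hΩ'.isOpen.mem_nhds hz] with y hy
      exact hf.comm_dil s y hs hy
    have h3 : ∀ u : F × ℝ, ambientDeriv (F := F) f (W.ambientDil s z) (ambientDilDeriv W s z u) =
        ambientDilDeriv W s (f z) (ambientDeriv f z u) := fun u ↦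
      congrArg (fun l : F × ℝ →L[ℝ] F × ℝ ↦ l u) (h1.symm.trans (hev.mfderiv_eq.trans h2))
    refine ContinuousLinearMap.ext fun u ↦ ContinuousLinearMap.ext fun v ↦ ?_
    have h4 : ∀ u v : F × ℝ, ambientForm g (f (W.ambientDil s z))
        (ambientDeriv (F := F) f (W.ambientDil s z) (ambientDilDeriv W s z u))
        (ambientDeriv (F := F) f (W.ambientDil s z) (ambientDilDeriv W s z v)) =
        s ^ 2 * ambientForm g (f z) (ambientDeriv f z u) (ambientDeriv f z v) := fun u v ↦ by
      rw [h3, h3, hf.comm_dil s z hs hz]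
      exact hg.ambientForm_dil hs (hf.mem z hz) _ _
    exact h4 u v
  · have h1 := acceleration_pullback_rho hg (hf.smooth _ hz) (hf.isInvertible _ hz) (hf.mem _ hz)
    have h2 : (acceleration g (fun σ ↦ f (x, σ)) ρ : F × ℝ) =
        A (f (x, ρ)) (ambientVelocity (F := F) (fun σ ↦ f (x, σ)) ρ) := hf.obeys x ρ hz
    rw [ambientVelocity_eq (hf.smooth _ hz)] at h2
    have h3 := h1.symm.trans h2
    exact ((hf.isInvertible _ hz).inverse_apply_eq.2 h3.symm).symm
  · change ambientForm g (f z) (ambientDeriv f z (ambientField W z : F × ℝ))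
      (ambientDeriv f z (pulledAcceleration A f z)) = 0
    have h1 : ambientDeriv f z (ambientField W z : F × ℝ) = ambientField W (f z) :=
      W.mfderiv_ambientField_of_comm ((hf.smooth z hz).mdifferentiableAt (by simp))
        fun s hs ↦ hf.comm_dil s z hs hz
    rw [h1, hf.ambientDeriv_pulledAcceleration hz]
    exact hA.perp (f z) (hf.mem z hz) _

end IsNormalisation

/-- The converse needed for uniqueness. The normal form of the pulled back metric forces the image
curves to obey the law, and its values along `ρ = 0` force their initial velocities to be
transversal. -/
theorem PutsInWeylNormalForm.isNormalisation (hg : IsWeylPreAmbient h Ω g)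
    (ht : IsFibreCoordinate h r t) (hΩ' : IsAmbientDomain W Ω')
    {B' : ∀ z : P × ℝ, TangentSpace (ambientModel F) z}
    {ψ : PartialDiffeomorph (ambientModel F) (ambientModel F) (P × ℝ) (P × ℝ) ∞}
    (hψ : PutsInWeylNormalForm h r t Ω g A Ω' B' ψ) : IsNormalisation W r t Ω g A Ω' ψ := by
  have hsm : ∀ z ∈ Ω', ContMDiffAt (ambientModel F) (ambientModel F) ∞ ψ z := fun z hz ↦
    ψ.contMDiffOn.contMDiffAt (ψ.open_source.mem_nhds (by rwa [hψ.source_eq]))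
  have hi : ∀ z ∈ Ω', (ambientDeriv (F := F) ψ z).IsInvertible := by
    intro z hz
    have h1 : IsLocalDiffeomorphAt (ambientModel F) (ambientModel F) ∞ ψ z :=
      ⟨ψ, by rwa [hψ.source_eq], fun _ _ ↦ rfl⟩
    exact ⟨h1.mfderivToContinuousLinearEquiv (by simp), rfl⟩
  have hm : ∀ z ∈ Ω', ψ z ∈ Ω := fun z hz ↦
    hψ.target_subset (ψ.map_source (by rwa [hψ.source_eq]))
  refine ⟨hsm, hi, hm, hψ.comm_dil, hψ.id_zero, fun x ρ hz ↦ ?_, fun x ↦ ?_⟩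
  · have h1 := acceleration_pullback_rho hg (hsm _ hz) (hi _ hz) (hm _ hz)
    have h2 := hψ.normalForm.acceleration_eq x ρ hz
    have h3 := hψ.related (x, ρ) hz
    have h4 : (A (ψ (x, ρ)) (ambientDeriv (F := F) ψ (x, ρ) (0, 1)) : F × ℝ) =
        A (ψ (x, ρ)) (ambientVelocity (F := F) (fun σ ↦ ψ (x, σ)) ρ) := by
      rw [ambientVelocity_eq (hsm _ hz)]
    exact (h1.trans (congrArg (ambientDeriv (F := F) ψ (x, ρ)) h2)).trans (h3.trans h4)
  · have hz := hΩ'.zero_mem x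
    rw [isTransversal_iff_isNullSolution ht]
    have h1 := fun w c ↦ mfderiv_apply_of_id_zero ((hsm _ hz).mdifferentiableAt (by simp))
      hψ.id_zero w c
    have h2 : ∀ (w : F) (c : ℝ), ambientDeriv (F := F) ψ (x, 0) (w, c) =
      (w, 0) + c • ambientVelocity (F := F) (fun ρ ↦ ψ (x, ρ)) 0 := h1
    have h3 : ∀ (w₁ w₂ : F) (c₁ c₂ : ℝ), ambientForm g (ψ (x, 0))
        (ambientDeriv (F := F) ψ (x, 0) (w₁, c₁)) (ambientDeriv (F := F) ψ (x, 0) (w₂, c₂)) =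
        tautological h x w₁ w₂ +
        (t x) ^ 2 * (connectionCLM W r t x w₁ * c₂ + connectionCLM W r t x w₂ * c₁) :=
      fun w₁ w₂ c₁ c₂ ↦ hψ.normalForm.initial_full x w₁ w₂ c₁ c₂
    rw [hψ.id_zero] at h3
    set U := ambientVelocity (F := F) (fun ρ ↦ ψ (x, ρ)) 0 with hU
    have h4 : ∀ w : F, tautological h x (0 : F) w = 0 := fun w ↦ by
      have h5 : ambientForm g (x, 0) (0, 0) (w, 0) = tautological h x (0 : F) w :=
        hg.initial x (0 : F) w
      rw [← h5, show ((0 : F), (0 : ℝ)) = 0 from rfl, map_zero, zero_apply]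
    have h6 : ∀ w : F, ((w, 0) : F × ℝ) + (0 : ℝ) • U = (w, 0) := fun w ↦ by
      rw [zero_smul, add_zero]
    have h7 : ((0 : F), (0 : ℝ)) + (1 : ℝ) • U = U := by
      rw [one_smul, show ((0 : F), (0 : ℝ)) = 0 from rfl, zero_add]
    -- Evaluating the normal form on `∂_ρ` and `w` gives the products `t² n(w)`; evaluating it on
    -- `∂_ρ` twice gives nullity.
    refine ⟨fun w ↦ ?_, ?_⟩
    · have h8 := h3 0 w 1 0
      rw [h2, h2, h6, h7, h4, map_zero] at h8
      rw [h8, smul_apply, smul_eq_mul]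
      ring
    · have h8 := h3 0 0 1 1
      rw [h2, h7, h4, map_zero] at h8
      rw [h8]
      ring

end Normalisation

/-! ### From an injective normalisation to a diffeomorphism -/

namespace IsNormalisation

variable {E F M P : Type*}
  [NormedAddCommGroup E] [NormedSpace ℝ E]
  [NormedAddCommGroup F] [NormedSpace ℝ F] [FiniteDimensional ℝ F]
  [TopologicalSpace M] [ChartedSpace E M] [IsManifold 𝓘(ℝ, E) ∞ M]
  [TopologicalSpace P] [ChartedSpace F P] [IsManifold 𝓘(ℝ, F) ∞ P]
  {p q : ℕ} {W : WeylStructure E F M P} {r : WeylPair E M p q} {t : P → ℝ}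
  {Ω Ω' : Set (P × ℝ)} {g : BilinField (ambientModel F) (P × ℝ)}
  {A : ∀ z : P × ℝ, TangentSpace (ambientModel F) z → TangentSpace (ambientModel F) z}

theorem exists_partialDiffeomorph {f : P × ℝ → P × ℝ} (hΩ' : IsOpen Ω') (hinj : InjOn f Ω')
    (hf : IsNormalisation W r t Ω g A Ω' f) :
    ∃ Φ : PartialDiffeomorph (ambientModel F) (ambientModel F) (P × ℝ) (P × ℝ) ∞,
      Φ.source = Ω' ∧ Φ.target ⊆ Ω ∧ IsNormalisation W r t Ω g A Ω' Φ := by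
  -- Inverting the injective map on its image needs a point of `P × ℝ`; if there is none, the
  -- identity serves.
  obtain hP | hP := isEmpty_or_nonempty (P × ℝ)
  · refine ⟨⟨PartialEquiv.refl _, isOpen_univ, isOpen_univ, contMDiffOn_id, contMDiffOn_id⟩,
      Subsingleton.elim _ _, fun z ↦ isEmptyElim z, fun z ↦ isEmptyElim z, fun z ↦ isEmptyElim z,
      fun z ↦ isEmptyElim z, fun _ z ↦ isEmptyElim z, fun x ↦ isEmptyElim (x, (0 : ℝ)),
      fun x ↦ isEmptyElim (x, (0 : ℝ)), fun x ↦ isEmptyElim (x, (0 : ℝ))⟩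
  · have : CompleteSpace (F × ℝ) := FiniteDimensional.complete ℝ (F × ℝ)
    obtain ⟨Φ, h1, h2, h3⟩ := _root_.exists_partialDiffeomorph hΩ' hf.smooth hf.isInvertible hinj
    refine ⟨Φ, h1, ?_, ?_⟩
    · rw [h2]
      rintro - ⟨z, hz, rfl⟩
      exact hf.mem z hz
    · rw [← h3] at hf
      exact hf

end IsNormalisation

/-! ### The normal form theorem -/

theorem mainTheorem2
    {E F M P : Type*}
    [NormedAddCommGroup E] [NormedSpace ℝ E] [FiniteDimensional ℝ E]
    [NormedAddCommGroup F] [NormedSpace ℝ F] [FiniteDimensional ℝ F]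
    [TopologicalSpace M] [ChartedSpace E M] [IsManifold 𝓘(ℝ, E) ∞ M]
    [T2Space M] [SecondCountableTopology M]
    [TopologicalSpace P] [ChartedSpace F P] [IsManifold 𝓘(ℝ, F) ∞ P]
    [T2Space P] [SecondCountableTopology P]
    {p q : ℕ} (W : WeylStructure E F M P) (C : WeylClass E M p q) (h : MetricBundleIso W C)
    (r : WeylPair E M p q) (hr : r.weylClass = C)
    (t : P → ℝ) (ht : IsFibreCoordinate h r t)
    (Ω : Set (P × ℝ)) (g : BilinField (ambientModel F) (P × ℝ))
    (hg : IsWeylPreAmbient h Ω g)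
    (A : ∀ z : P × ℝ, TangentSpace (ambientModel F) z → TangentSpace (ambientModel F) z)
    (hA : IsAccelerationLaw W Ω g A) :
    ∃ Ω' : Set (P × ℝ), IsAmbientDomain W Ω' ∧
      ∃ (φ : PartialDiffeomorph (ambientModel F) (ambientModel F) (P × ℝ) (P × ℝ) ∞)
        (A' : ∀ z : P × ℝ, TangentSpace (ambientModel F) z),
        PutsInWeylNormalForm h r t Ω g A Ω' A' φ ∧
        (∀ ψ B', PutsInWeylNormalForm h r t Ω g A Ω' B' ψ → EqOn ψ φ Ω' ∧ EqOn B' A' Ω') ∧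
        (∀ (x : P) (V : TangentSpace (ambientModel F) (x, (0 : ℝ))),
          IsTransversal W r t g x V ↔
            V = mfderiv (ambientModel F) (ambientModel F) φ (x, 0) (rhoVec (x, 0))) ∧
        (∀ x ρ, (x, ρ) ∈ Ω' →
          acceleration (I := ambientModel F) g (fun σ ↦ φ (x, σ)) ρ =
            A (φ (x, ρ)) (mfderiv (ambientModel F) (ambientModel F) φ (x, ρ) (rhoVec (x, ρ)))) ∧
        ((∀ z ∈ Ω, ∀ u, g z u (A z u) = 0) → ∀ z ∈ Ω',
          pullbackBilin (I := ambientModel F) (I' := ambientModel F) φ g z (rhoVec z) (A' z) = 0) := by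
  obtain ⟨Ω', hΩ', hord, f, hinj, hf'⟩ := exists_isNormalisation hg ht hA
  obtain ⟨φ, hsource, htarget, hf⟩ := hf'.exists_partialDiffeomorph hΩ'.isOpen hinj
  refine ⟨Ω', hΩ', φ, fun z ↦ pulledAcceleration A φ z,
    ⟨hsource, htarget, hf.comm_dil, hf.id_zero,
      fun z hz ↦ hf.ambientDeriv_pulledAcceleration hz, hf.isWeylNormalForm hg ht hA hΩ' hord⟩,
    fun ψ B' hψ ↦ ?_, fun x V ↦ ?_, fun x ρ hz ↦ ?_, fun hperp z hz ↦ ?_⟩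
  · have hn := hψ.isNormalisation hg ht hΩ'
    have heq : EqOn ψ φ Ω' := hn.eqOn hg ht hA hΩ' hord hf
    refine ⟨heq, fun z hz ↦ ?_⟩
    have hd : ambientDeriv (F := F) ψ z = ambientDeriv φ z :=
      (heq.eventuallyEq_of_mem (hΩ'.isOpen.mem_nhds hz)).mfderiv_eq
    have h1 : ambientDeriv (F := F) ψ z (B' z) = A (ψ z) (ambientDeriv (F := F) ψ z (0, 1)) :=
      hψ.related z hz
    -- The types depend on the base point, so point and derivative are made variable before
    -- replacing `ψ` by `φ`. Invertibility of the derivative then determines `B' z`.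
    have h2 : ∀ w, w = ψ z → ∀ L : F × ℝ →L[ℝ] F × ℝ, L = ambientDeriv (F := F) ψ z →
        L (B' z) = A w (L (0, 1)) := by
      rintro - rfl - rfl
      exact h1
    exact ((hf.isInvertible z hz).inverse_apply_eq.2
      (h2 (φ z) (heq hz).symm (ambientDeriv φ z) hd.symm).symm).symm
  · have hv := hf.velocity x
    have h1 := ambientVelocity_eq (hf.smooth _ (hΩ'.zero_mem x))
    refine ⟨fun hV ↦ (hv.unique hg ht hV).trans h1, fun hV ↦ ?_⟩
    have h2 : V = ambientVelocity (F := F) (fun ρ ↦ φ (x, ρ)) 0 := hV.trans h1.symm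
    rw [h2]
    exact hv
  · have h1 : (acceleration g (fun σ ↦ φ (x, σ)) ρ : F × ℝ) =
        A (φ (x, ρ)) (ambientVelocity (F := F) (fun σ ↦ φ (x, σ)) ρ) := hf.obeys x ρ hz
    rw [ambientVelocity_eq (hf.smooth _ hz)] at h1
    exact h1
  · change ambientForm g (φ z) (ambientDeriv φ z (0, 1))
      (ambientDeriv φ z (pulledAcceleration A φ z)) = 0
    rw [hf.ambientDeriv_pulledAcceleration hz]
    exact hperp (φ z) (hf.mem z hz) _
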